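/- All graphs are finite and simple. A graph is hamiltonian if it contains a cycle through all of its vertices. A graph $G$ is called $K_2$-hamiltonian if for every pair of adjacent vertices $u, v$ of $G$ the graph $G - u - v$ is hamiltonian, and it is called $K_2$-hypohamiltonian if it is $K_2$-hamiltonian but not itself hamiltonian. A graph is cubic if all its vertices have degree $3$, and planar if it can be drawn in the plane without edge crossings. Theorem. There exist infinitely many pairwise non-isomorphic cubic planar $K_2$-hypohamiltonian graphs. -/

import Mathlib

/-- The Euclidean plane. -/
abbrev Plane : Type := EuclideanSpace ℝ (Fin 2)

/-- `A` is an arc in the plane (a homeomorphic image of `[0, 1]`) with end points `p` and `q`.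
Since `[0, 1]` is compact and the plane is Hausdorff, a continuous injection is a homeomorphism
onto its image. -/
def IsPlaneArc (A : Set Plane) (p q : Plane) : Prop :=
  ∃ γ : unitInterval → Plane,
    Continuous γ ∧ Function.Injective γ ∧ γ 0 = p ∧ γ 1 = q ∧ Set.range γ = A

namespace SimpleGraph

/-- A drawing of `G` in the plane without crossings: distinct vertices are distinct points, every
edge is an arc between the points of its ends, an edge contains no vertex other than its ends, and
distinct edges meet only in vertices (hence only in common ends). -/
structure PlaneDrawing {V : Type*} (G : SimpleGraph V) where
  /-- the point representing a vertex -/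
  point : V → Plane
  /-- the arc representing an edge (irrelevant for pairs that are not edges) -/
  arc : Sym2 V → Set Plane
  point_injective : Function.Injective point
  isPlaneArc : ∀ u v : V, G.Adj u v → IsPlaneArc (arc s(u, v)) (point u) (point v)
  mem_of_point_mem_arc : ∀ e ∈ G.edgeSet, ∀ w : V, point w ∈ arc e → w ∈ e
  arc_inter_arc : ∀ e ∈ G.edgeSet, ∀ f ∈ G.edgeSet, e ≠ f → arc e ∩ arc f ⊆ Set.range point

/-- A graph is planar if it can be drawn in the plane without crossings. -/
def IsPlanar {V : Type*} (G : SimpleGraph V) : Prop := Nonempty G.PlaneDrawing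

open Classical in
/-- A finite graph is cubic if every vertex has degree `3`. -/
def IsCubic {V : Type*} [Fintype V] (G : SimpleGraph V) : Prop := G.IsRegularOfDegree 3

open Classical in
/-- `G` is `K₂`-hamiltonian: deleting any two adjacent vertices leaves a hamiltonian graph. -/
def IsK2Hamiltonian {V : Type*} [Fintype V] (G : SimpleGraph V) : Prop :=
  ∀ u v : V, G.Adj u v → (G.induce ({u, v}ᶜ : Set V)).IsHamiltonian

open Classical in
/-- `G` is `K₂`-hypohamiltonian: it is `K₂`-hamiltonian but not hamiltonian. -/
def IsK2Hypohamiltonian {V : Type*} [Fintype V] (G : SimpleGraph V) : Prop :=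
  G.IsK2Hamiltonian ∧ ¬ G.IsHamiltonian

end SimpleGraph

/-!
The graphs are built from three pieces of cubic plane maps: a core `cellC` with `213` vertices, a
tube `cellA` with `66` vertices, and a cap `cellP`, which is a pentagon. They are joined along
closed curves that cross five edges: the core, then `k ≥ 1` tubes one after the other, then the cap.
The cells are explicit tables, and the results on chains of cells hold for all cells that pass
finitely many local tests, so that only the three tables have to be examined, for all `k` at once.
Different values of `k` give different numbers of vertices (`card_hypoCell`).

*No hamiltonian cycle.* Except for three faces `C 0`, `C 1` and `C 3`, all faces have length `2`
modulo `3`. The exceptional faces are among the five faces `C t` that surround a set `Z` of vertices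
of the core, cut off by five edges. By Grinberg's formula modulo `3`, the three lie on the same side
of a hamiltonian cycle. On that side, the faces that meet `Z` and the edges off the cycle between
them that meet `Z` form a forest, by duality. Counting the corners in `Z` modulo `3` shows that the
number of its trees is divisible by `3`. But there is a tree, and every tree contains one of the
runs of consecutive faces `C t` on this side, of which there are at most two; not all five are on
this side, since otherwise the five edges of the cut would form a cycle in the dual tree
(`CubicMap.IsObstruction.not_isHamiltonian`). The Jordan curve theorem is not needed: for a cubic
map given by a rotation system and a labelling of its faces, Euler's formula implies that the edges
off the cycle join the faces of each side to a tree (`CubicMap.exists_isSide`).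

*Deletion of two adjacent vertices.* A hamiltonian cycle is a choice of an unused dart at each
vertex, called a pattern. The state of a pattern at a curve between two cells tells which of the
five edges are used there and how they are connected by the part of the cycle behind the curve.
Suitable patterns exist in each cell with the state in one list, `skipStates`, at all curves before
the deleted edge, and with a state in another list, `pairStates`, at all curves behind it; an
undamaged tube reproduces its state. So it suffices to have, for each edge of each cell and of each
kind of cut, patterns around this edge that change a state of the first kind to one of the second.
They are tabulated and verified by evaluation (`Reach.isHamiltonian`, `isK2Hamiltonian_hypoCell`).

*Planarity.* Each cell has a drawing with straight edges on a cylinder, whose ends match. The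
drawings are stacked, and the half cylinder is mapped to the complement of a disc in the plane
(`cyl`, `CellChain.isPlanar`).
-/

open SimpleGraph

/-! ### Cubic maps and hamiltonian cycles -/

/-- A finite cubic graph embedded in an oriented surface, as a rotation system: the three darts at
a vertex are numbered in cyclic order, and `opp` exchanges the two darts of each edge. The last two
fields exclude loops and multiple edges. -/
structure CubicMap (V : Type*) where
  /-- the other dart of the same edge -/
  opp : V × Fin 3 → V × Fin 3
  opp_opp : ∀ d, opp (opp d) = d
  opp_ne : ∀ d, (opp d).1 ≠ d.1
  opp_inj : ∀ v i j, (opp (v, i)).1 = (opp (v, j)).1 → i = j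

namespace CubicMap

variable {V : Type*} (M : CubicMap V)

/-- The underlying simple graph. -/
def graph : SimpleGraph V where
  Adj u v := ∃ i, (M.opp (u, i)).1 = v
  symm := ⟨by
    rintro u v ⟨i, rfl⟩
    exact ⟨(M.opp (u, i)).2, by rw [Prod.mk.eta, M.opp_opp]⟩⟩
  loopless := ⟨by rintro u ⟨i, h⟩; exact M.opp_ne _ h⟩

theorem adj_iff {u v : V} : M.graph.Adj u v ↔ ∃ i, (M.opp (u, i)).1 = v := Iff.rfl

theorem adj_opp (d : V × Fin 3) : M.graph.Adj d.1 (M.opp d).1 := ⟨d.2, rfl⟩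

theorem isCubic [Fintype V] : M.graph.IsCubic := by
  classical
  intro v
  have h : M.graph.neighborFinset v = Finset.univ.image (fun i => (M.opp (v, i)).1) := by
    ext w
    simp [adj_iff]
  rw [← card_neighborFinset_eq_degree]
  have h2 : (Finset.univ.image (fun i => (M.opp (v, i)).1)).card = 3 := by
    rw [Finset.card_image_of_injective _ (fun i j hij => M.opp_inj v i j hij)]
    rfl
  rw [← h2, ← h]

/-- Given an unused dart at each vertex that is kept (`none` at a deleted vertex), the darts that
are used. -/
def Used (d : V → Option (Fin 3)) (x : V × Fin 3) : Prop := ∃ u, d x.1 = some u ∧ x.2 ≠ u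

end CubicMap

/-- A connected graph, not a single vertex, in which all degrees are `2` is hamiltonian. -/
theorem SimpleGraph.IsCycles.isHamiltonian {α : Type*} [Fintype α] [DecidableEq α]
    {K : SimpleGraph α} (hK : K.IsCycles) (hc : K.Preconnected) {v : α}
    (hv : (K.neighborSet v).Nonempty) : K.IsHamiltonian := by
  intro _
  obtain ⟨p, hp, hs⟩ := hK.exists_cycle_toSubgraph_verts_eq_connectedComponentSupp
    (c := K.connectedComponentMk v) (v := v) rfl hv
  refine ⟨v, p, ⟨hp, hp.isPath_tail.isHamiltonian_of_mem fun w => ?_⟩⟩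
  have hw : w ∈ p.toSubgraph.verts := by
    rw [hs]
    exact ConnectedComponent.sound (hc w v)
  rw [Walk.mem_verts_toSubgraph] at hw
  rw [Walk.support_tail_of_not_nil _ hp.not_nil]
  rcases (Walk.mem_support_iff p).1 hw with rfl | h
  · exact Walk.end_mem_tail_support hp.not_nil
  · exact h

namespace CubicMap

variable {V : Type*} (M : CubicMap V)

/-- A choice of two used darts at each vertex of `S`, matched by `opp` and connecting `S`, is a
hamiltonian cycle of the graph induced on `S`. -/
theorem isHamiltonian_induce [Fintype V] [DecidableEq V] (d : V → Option (Fin 3)) (S : Set V)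
    [Fintype S] (hS : ∀ v, v ∈ S ↔ d v ≠ none) (hu : ∀ x, Used d x → Used d (M.opp x))
    (hconn : ∀ R : V → V → Prop, Equivalence R → (∀ x, Used d x → R x.1 (M.opp x).1) →
      ∀ v w, v ∈ S → w ∈ S → R v w) (hne : S.Nonempty) :
    (M.graph.induce S).IsHamiltonian := by
  classical
  let K : SimpleGraph S :=
    { Adj := fun u v => ∃ i, Used d (u.1, i) ∧ (M.opp (u.1, i)).1 = v.1
      symm := ⟨by
        rintro ⟨u, hu'⟩ ⟨v, hv'⟩ ⟨i, h1, h2⟩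
        refine ⟨(M.opp (u, i)).2, ?_, ?_⟩
        · have := hu _ h1
          simp only at h2 ⊢
          rwa [← h2]
        · simp only at h2 ⊢
          rw [← h2, Prod.mk.eta, M.opp_opp]⟩
      loopless := ⟨by rintro u ⟨i, _, h⟩; exact M.opp_ne _ h⟩ }
  have memS : ∀ x, Used d x → x.1 ∈ S := by
    rintro x ⟨u, h, _⟩
    rw [hS, h]; simp
  have hKle : K ≤ M.graph.induce S := by
    rintro u v ⟨i, _, h⟩
    exact ⟨i, h⟩
  have nbr : ∀ v : S, ∃ a b, a ≠ b ∧ K.neighborSet v = {a, b} := by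
    rintro ⟨v, hv⟩
    obtain ⟨m, hm⟩ := Option.ne_none_iff_exists'.1 ((hS v).1 hv)
    have h1 : Used d (v, m + 1) := ⟨m, hm, by simp⟩
    have h2 : Used d (v, m + 2) := ⟨m, hm, by simp⟩
    refine ⟨⟨_, memS _ (hu _ h1)⟩, ⟨_, memS _ (hu _ h2)⟩, ?_, ?_⟩
    · intro h
      have := M.opp_inj v _ _ (Subtype.mk.inj h)
      exact (by decide : ∀ m : Fin 3, m + 1 ≠ m + 2) m this
    · ext w
      simp only [mem_neighborSet, Set.mem_insert_iff, Set.mem_singleton_iff]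
      constructor
      · rintro ⟨i, ⟨u, hu1, hu2⟩, hi⟩
        simp only at hu1 hu2 hi
        rw [hm] at hu1
        obtain rfl := Option.some.inj hu1
        have : i = m + 1 ∨ i = m + 2 := by clear h1 h2 hi hu1 hm; revert i m; decide
        rcases this with rfl | rfl
        · left; exact Subtype.ext hi.symm
        · right; exact Subtype.ext hi.symm
      · rintro (rfl | rfl)
        · exact ⟨_, h1, rfl⟩
        · exact ⟨_, h2, rfl⟩
  have hcyc : K.IsCycles := by
    intro v _
    obtain ⟨a, b, hab, h⟩ := nbr v
    rw [h, Set.ncard_pair hab]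
  have hpre : K.Preconnected := by
    rintro ⟨v, hv⟩ ⟨w, hw⟩
    have := hconn (fun a b => a = b ∨ ∃ (ha : a ∈ S) (hb : b ∈ S), K.Reachable ⟨a, ha⟩ ⟨b, hb⟩)
      ⟨fun a => Or.inl rfl, by
        rintro a b (rfl | ⟨ha, hb, h⟩)
        · exact Or.inl rfl
        · exact Or.inr ⟨hb, ha, h.symm⟩, by
        rintro a b c (rfl | ⟨ha, hb, h⟩) (rfl | ⟨hb', hc, h'⟩)
        · exact Or.inl rfl
        · exact Or.inr ⟨hb', hc, h'⟩
        · exact Or.inr ⟨ha, hb, h⟩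
        · exact Or.inr ⟨ha, hc, h.trans h'⟩⟩
      (fun x hx => Or.inr ⟨memS _ hx, memS _ (hu _ hx), by
        apply Adj.reachable
        exact ⟨x.2, hx, rfl⟩⟩) v w hv hw
    rcases this with rfl | ⟨_, _, h⟩
    · exact Reachable.refl _
    · exact h
  obtain ⟨v, hv⟩ := hne
  obtain ⟨a, b, _, h⟩ := nbr ⟨v, hv⟩
  exact (hcyc.isHamiltonian hpre (v := ⟨v, hv⟩) (by rw [h]; simp)).mono hKle

end CubicMap

/-! ### The two sides of a hamiltonian cycle -/

namespace CubicMap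

variable {V : Type*} (M : CubicMap V)

/-- `out v` and `inn v` are the darts along which a directed hamiltonian cycle leaves and enters
the vertex `v`. -/
structure IsOrientation (out inn : V → Fin 3) : Prop where
  ne : ∀ v, out v ≠ inn v
  opp_out : ∀ v, (M.opp (v, out v)).2 = inn (M.opp (v, out v)).1
  opp_inn : ∀ v, (M.opp (v, inn v)).2 = out (M.opp (v, inn v)).1
  closed : ∀ Q : V → Prop, (∀ v, Q v → Q (M.opp (v, out v)).1) → ∀ v w, Q v → Q w

theorem IsOrientation.symm {M : CubicMap V} {out inn : V → Fin 3} (h : M.IsOrientation out inn) :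
    M.IsOrientation inn out where
  ne v := (h.ne v).symm
  opp_out := h.opp_inn
  opp_inn := h.opp_out
  closed Q hQ v w hv := by
    by_contra hw
    refine h.closed (fun x => ¬ Q x) (fun x hx hQx => hx ?_) w v hw hv
    have := hQ _ hQx
    rwa [← h.opp_out, Prod.mk.eta, M.opp_opp] at this

theorem exists_isOrientation [Fintype V] [DecidableEq V] (hcard : Fintype.card V ≠ 1)
    (h : M.graph.IsHamiltonian) : ∃ out inn, M.IsOrientation out inn := by
  obtain ⟨a, p, hp⟩ := h hcard
  set n := p.length with hn
  have hn3 : 3 ≤ n := hp.three_le_length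
  have hinj : ∀ s t, s < n → t < n → p.getVert s = p.getVert t → s = t := fun s t hs ht hst =>
    hp.isCycle.getVert_injOn' (by simp; omega) (by simp; omega) hst
  have hsurj : ∀ v, ∃ t, t < n ∧ p.getVert t = v := by
    intro v
    obtain ⟨t, ht, hle⟩ := Walk.mem_support_iff_exists_getVert.1 (hp.mem_support v)
    rcases hle.lt_or_eq with hlt | heq
    · exact ⟨t, hlt, ht⟩
    · refine ⟨0, by omega, ?_⟩
      rw [heq, Walk.getVert_length] at ht
      rw [Walk.getVert_zero, ht]
  choose t ht1 ht2 using hsurj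
  have hwrap : p.getVert n = p.getVert 0 := by
    rw [hn, Walk.getVert_length, Walk.getVert_zero]
  let σ : V → V := fun v => p.getVert (t v + 1)
  have hσ : ∀ s, s < n → σ (p.getVert s) = p.getVert (s + 1) := by
    intro s hs
    have : t (p.getVert s) = s := hinj _ _ (ht1 _) hs (ht2 _)
    simp only [σ, this]
  have hσ' : ∀ v, ∃ s, s < n ∧ p.getVert s = v ∧
      ((s + 1 < n ∧ σ v = p.getVert (s + 1)) ∨ (s + 1 = n ∧ σ v = p.getVert 0)) := by
    intro v
    refine ⟨t v, ht1 v, ht2 v, ?_⟩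
    rcases (Nat.succ_le_of_lt (ht1 v)).lt_or_eq with h1 | h1
    · exact Or.inl ⟨h1, rfl⟩
    · refine Or.inr ⟨h1, ?_⟩
      have : t v + 1 = n := h1
      simp only [σ, this, hwrap]
  have σinj : Function.Injective σ := by
    intro v w hvw
    obtain ⟨s, hs, rfl, h1⟩ := hσ' v
    obtain ⟨r, hr, rfl, h2⟩ := hσ' w
    rcases h1 with ⟨h1, h1'⟩ | ⟨h1, h1'⟩ <;> rcases h2 with ⟨h2, h2'⟩ | ⟨h2, h2'⟩ <;>
      rw [h1', h2'] at hvw <;> have := hinj _ _ (by omega) (by omega) hvw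
    · congr 1; omega
    · omega
    · omega
    · congr 1; omega
  have σσ : ∀ v, σ (σ v) ≠ v := by
    intro v hv
    obtain ⟨s, hs, rfl, h1⟩ := hσ' v
    rcases h1 with ⟨h1, h1'⟩ | ⟨h1, h1'⟩
    · rw [h1', hσ _ h1] at hv
      rcases (Nat.succ_le_of_lt h1).lt_or_eq with h2 | h2
      · have := hinj _ _ h2 hs hv
        omega
      · have h3 : s + 1 + 1 = n := h2
        rw [h3, hwrap] at hv
        have := hinj _ _ (by omega) hs hv
        omega
    · rw [h1', hσ _ (by omega)] at hv
      have := hinj _ _ (by omega) hs hv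
      omega
  let e : V ≃ V := Equiv.ofBijective σ (Finite.injective_iff_bijective.1 σinj)
  have hadj : ∀ v, M.graph.Adj v (σ v) := by
    intro v
    have := p.adj_getVert_succ (i := t v) (ht1 v)
    rwa [ht2 v] at this
  choose out hout using hadj
  have heπ : ∀ v, σ (e.symm v) = v := fun v => e.apply_symm_apply v
  have hπe : ∀ v, e.symm (σ v) = v := fun v => e.symm_apply_apply v
  let inn : V → Fin 3 := fun v => (M.opp (e.symm v, out (e.symm v))).2
  have hin : ∀ v, M.opp (e.symm v, out (e.symm v)) = (v, inn v) := by
    intro v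
    refine Prod.ext ?_ rfl
    rw [hout, heπ]
  have hin' : ∀ v, M.opp (v, inn v) = (e.symm v, out (e.symm v)) := by
    intro v
    rw [← hin, M.opp_opp]
  refine ⟨out, inn, ⟨?_, ?_, ?_, ?_⟩⟩
  · intro v hv
    have h1 := hout v
    rw [hv, hin' v] at h1
    apply σσ v
    rw [← h1, heπ]
  · intro v
    rw [hout]
    simp only [inn, hπe]
  · intro v
    rw [hin' v]
  · intro Q hQ v w hv
    have step : ∀ s, s < n → Q (p.getVert s) → Q (p.getVert (s + 1)) := by
      intro s hs h
      have := hQ _ h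
      rwa [hout, hσ s hs] at this
    have up : ∀ j s, s + j ≤ n → Q (p.getVert s) → Q (p.getVert (s + j)) := by
      intro j
      induction j with
      | zero => intro s _ h; exact h
      | succ j ih =>
        intro s hs h
        exact step (s + j) (by omega) (ih s (by omega) h)
    have h0 : Q (p.getVert 0) := by
      rw [← hwrap]
      have := up (n - t v) (t v) (by have := ht1 v; omega) (by rwa [ht2])
      rwa [Nat.add_sub_cancel' (ht1 v).le] at this
    have := up (t w) 0 (by have := ht1 w; omega) h0
    rwa [Nat.zero_add, ht2] at this

/-- In a connected multigraph on `L` at least `|L| - |S|` edges are not inside a nonempty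
`S ⊆ L`. Every edge is represented by two elements `v` and `mate v` of `V`, and `g₁ v` and `g₂ v`
are its ends. -/
theorem two_mul_card_le {F : Type*} [DecidableEq F] [Fintype V] [DecidableEq V] {g₁ g₂ : V → F}
    {mate : V → V} (hm : ∀ v, mate v ≠ v) (hg₁ : ∀ v, g₁ (mate v) = g₂ v)
    (hg₂ : ∀ v, g₂ (mate v) = g₁ v) {L : Finset F}
    (conn : ∀ T ⊆ L, T.Nonempty → T ≠ L → ∃ v, g₁ v ∈ T ∧ g₂ v ∈ L ∧ g₂ v ∉ T) :
    ∀ S ⊆ L, S.Nonempty → 2 * L.card ≤ 2 * S.card +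
      (Finset.univ.filter fun v => g₁ v ∈ L ∧ g₂ v ∈ L ∧ ¬ (g₁ v ∈ S ∧ g₂ v ∈ S)).card := by
  suffices H : ∀ j, ∀ S ⊆ L, S.Nonempty → L.card - S.card = j → 2 * L.card ≤ 2 * S.card +
      (Finset.univ.filter fun v => g₁ v ∈ L ∧ g₂ v ∈ L ∧ ¬ (g₁ v ∈ S ∧ g₂ v ∈ S)).card from
    fun S h1 h2 => H _ S h1 h2 rfl
  intro j
  induction j with
  | zero =>
    intro S _ _ h
    omega
  | succ j ih =>
    intro S hS hne hj
    obtain ⟨v, hv1, hv2, hv3⟩ := conn S hS hne (by rintro rfl; omega)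
    have hS' : insert (g₂ v) S ⊆ L := Finset.insert_subset hv2 hS
    have hc : (insert (g₂ v) S).card = S.card + 1 := Finset.card_insert_of_notMem hv3
    have := ih _ hS' (Finset.insert_nonempty _ _) (by omega)
    set X := Finset.univ.filter fun w => g₁ w ∈ L ∧ g₂ w ∈ L ∧ ¬ (g₁ w ∈ S ∧ g₂ w ∈ S)
    set Y := Finset.univ.filter fun w => g₁ w ∈ L ∧ g₂ w ∈ L ∧
      ¬ (g₁ w ∈ insert (g₂ v) S ∧ g₂ w ∈ insert (g₂ v) S)
    have hsub : insert v (insert (mate v) Y) ⊆ X := by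
      intro w hw
      simp only [Finset.mem_insert] at hw
      rcases hw with rfl | rfl | hw
      · simp [X, hS hv1, hv2, hv3]
      · simp [X, hg₁, hg₂, hS hv1, hv2, hv3]
      · simp only [X, Y, Finset.mem_filter, Finset.mem_univ, true_and] at hw ⊢
        refine ⟨hw.1, hw.2.1, fun h => hw.2.2 ⟨?_, ?_⟩⟩
        · exact Finset.mem_insert_of_mem h.1
        · exact Finset.mem_insert_of_mem h.2
    have h1 : mate v ∉ Y := by simp [Y, hg₁, hg₂, hv1]
    have h2 : v ∉ insert (mate v) Y := by simp [Y, hv1, (hm v).symm]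
    have h3 := Finset.card_le_card hsub
    rw [Finset.card_insert_of_notMem h2, Finset.card_insert_of_notMem h1] at h3
    omega

variable {F : Type*} [Fintype F] [DecidableEq F] [Fintype V] [DecidableEq V]

/-- The faces `L` on one side of a hamiltonian cycle that avoids the dart `un v` at `v`, given by
what Grinberg's argument needs: the edges off the cycle that lie on this side (each counted at both
of its ends) join the faces in `L` to a tree. -/
structure IsSide (f : V × Fin 3 → F) (un : V → Fin 3) (L : Finset F) : Prop where
  card_chord : (Finset.univ.filter fun v => f (v, un v) ∈ L).card + 2 = 2 * L.card
  le_card : ∀ S ⊆ L, S.Nonempty → 2 * L.card ≤ 2 * S.card +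
    (Finset.univ.filter fun v => f (v, un v) ∈ L ∧
      ¬ (f (v, un v) ∈ S ∧ f (v, un v - 1) ∈ S)).card

/-- The two sides of a hamiltonian cycle in a map on the sphere. The sphere enters through Euler's
formula `hcard` only: the faces met on the left of the cycle are connected through the edges off
the cycle, and so are those met on the right. If these classes were not disjoint, then the
`|V| / 2` edges off the cycle would connect all `|V| / 2 + 2` faces. -/
theorem exists_isSide (f : V × Fin 3 → F) (hf : ∀ d, f ((M.opp d).1, (M.opp d).2 - 1) = f d)
    (hs : Function.Surjective f) (hcard : 2 * Fintype.card F = Fintype.card V + 4)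
    (hV : Fintype.card V ≠ 1) (h : M.graph.IsHamiltonian) :
    ∃ (un : V → Fin 3) (L : Finset F), (∀ v, (M.opp (v, un v)).2 = un (M.opp (v, un v)).1) ∧
      (∀ v, f (v, un v - 1) ∈ L ↔ f (v, un v) ∈ L) ∧
      (∀ v, f (v, un v + 1) ∈ L ↔ f (v, un v) ∉ L) ∧ IsSide f un L ∧ IsSide f un Lᶜ := by
  obtain ⟨out, inn, ho⟩ := M.exists_isOrientation hV h
  let un : V → Fin 3 := fun v => - (out v + inn v)
  have hun : ∀ v, (M.opp (v, un v)).2 = un (M.opp (v, un v)).1 := by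
    intro v
    have key : ∀ o i x : Fin 3, o ≠ i → x ≠ o → x ≠ i → x = - (o + i) := by decide
    have key' : ∀ o i : Fin 3, o ≠ i → - (o + i) ≠ o ∧ - (o + i) ≠ i := by decide
    apply key _ _ _ (ho.ne _)
    · intro hx
      have h1 := ho.opp_out (M.opp (v, un v)).1
      rw [← hx, Prod.mk.eta, M.opp_opp] at h1
      exact (key' _ _ (ho.ne v)).2 h1
    · intro hx
      have h1 := ho.opp_inn (M.opp (v, un v)).1
      rw [← hx, Prod.mk.eta, M.opp_opp] at h1
      exact (key' _ _ (ho.ne v)).1 h1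
  have hf' : ∀ v i, f (v, i - 1) = f (M.opp (v, i)) := by
    intro v i
    have := hf (M.opp (v, i))
    rwa [M.opp_opp] at this
  -- the last corner on a side at `v` is the first one at the previous vertex
  have hprev : ∀ {out inn : V → Fin 3}, M.IsOrientation out inn → ∀ v,
      f (v, inn v - 1) = f ((M.opp (v, inn v)).1, out (M.opp (v, inn v)).1) := by
    intro out inn ho v
    rw [hf', ← ho.opp_inn]
  let side : (V → Fin 3) → Finset F := fun o => Finset.univ.image fun v => f (v, o v)
  have mem_side : ∀ (o : V → Fin 3) v, f (v, o v) ∈ side o := fun o v =>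
    Finset.mem_image_of_mem _ (Finset.mem_univ v)
  have hconn : ∀ {out inn : V → Fin 3}, M.IsOrientation out inn → (∀ v, un v = - (out v + inn v)) →
      ∀ T ⊆ side out, T.Nonempty → T ≠ side out → ∃ v, (f (v, un v) ∈ T ∧
        f (v, un v - 1) ∈ side out ∧ f (v, un v - 1) ∉ T) ∨ (f (v, un v - 1) ∈ T ∧
        f (v, un v) ∈ side out ∧ f (v, un v) ∉ T) := by
    intro out inn ho hu T hT hne hTne
    by_contra! hno
    apply hTne
    refine Finset.Subset.antisymm hT fun φ hφ => ?_
    obtain ⟨ψ, hψ⟩ := hne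
    obtain ⟨v, _, rfl⟩ := Finset.mem_image.1 (hT hψ)
    obtain ⟨w, _, rfl⟩ := Finset.mem_image.1 hφ
    refine ho.closed (fun v => f (v, out v) ∈ T) (fun v hv => ?_) v w hψ
    set w := (M.opp (v, out v)).1 with hw
    have h1 : f (w, inn w - 1) = f (v, out v) := by
      rw [hw, ← ho.opp_out, hf]
    have key : ∀ o i : Fin 3, o ≠ i → (i - 1 = o) ∨ (- (o + i) = i - 1 ∧ - (o + i) - 1 = o) := by
      decide
    rcases key _ _ (ho.ne w) with h2 | ⟨h2, h3⟩
    · rw [← h2, h1]; exact hv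
    · by_contra hcon
      rw [← hu] at h2 h3
      have h4 := (hno w).1 (by rw [h2, h1]; exact hv)
      rw [h3] at h4
      exact hcon (h4 (mem_side out w))
  let mate : V → V := fun v => (M.opp (v, un v)).1
  have hmate : ∀ v, M.opp (v, un v) = (mate v, un (mate v)) := fun v =>
    Prod.ext rfl (hun v)
  have hg1 : ∀ v, f (mate v, un (mate v)) = f (v, un v - 1) := by
    intro v
    rw [hf', hmate]
  have hg2 : ∀ v, f (mate v, un (mate v) - 1) = f (v, un v) := by
    intro v
    have := hf (v, un v)
    rwa [hmate] at this
  have hm : ∀ v, mate v ≠ v := fun v => M.opp_ne _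
  -- one of the two ends of an edge that leaves `T` can be taken as the one with `g₁` in `T`
  have hflip : ∀ {L T : Finset F} {v : V}, ((f (v, un v) ∈ T ∧ f (v, un v - 1) ∈ L ∧
      f (v, un v - 1) ∉ T) ∨ (f (v, un v - 1) ∈ T ∧ f (v, un v) ∈ L ∧ f (v, un v) ∉ T)) →
      ∃ v, f (v, un v) ∈ T ∧ f (v, un v - 1) ∈ L ∧ f (v, un v - 1) ∉ T := by
    rintro L T v (h | h)
    · exact ⟨v, h⟩
    · exact ⟨mate v, by rwa [hg1, hg2]⟩
  have hcL := hconn ho (fun v => rfl)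
  have hcR := hconn ho.symm (fun v => by simp only [un]; rw [add_comm])
  -- where the three corners at a vertex belong
  have hcorner : ∀ v, (f (v, un v) ∈ side out ∧ f (v, un v - 1) ∈ side out ∧
      f (v, un v + 1) ∈ side inn) ∨ (f (v, un v) ∈ side inn ∧ f (v, un v - 1) ∈ side inn ∧
      f (v, un v + 1) ∈ side out) := by
    intro v
    have key : ∀ o i : Fin 3, o ≠ i →
        (- (o + i) = i - 1 ∧ - (o + i) - 1 = o ∧ - (o + i) + 1 = i) ∨
        (- (o + i) = o - 1 ∧ - (o + i) - 1 = i ∧ - (o + i) + 1 = o) := by decide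
    rcases key _ _ (ho.ne v) with ⟨h1, h2, h3⟩ | ⟨h1, h2, h3⟩
    · left
      simp only [un] at *
      rw [h2, h3, h1, hprev ho]
      exact ⟨mem_side _ _, mem_side _ _, mem_side _ _⟩
    · right
      simp only [un] at *
      rw [h2, h3, h1, hprev ho.symm]
      exact ⟨mem_side _ _, mem_side _ _, mem_side _ _⟩
  have hcover : ∀ φ, φ ∈ side out ∨ φ ∈ side inn := by
    intro φ
    obtain ⟨⟨v, i⟩, rfl⟩ := hs φ
    have key : ∀ u i : Fin 3, i = u ∨ i = u - 1 ∨ i = u + 1 := by decide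
    rcases key (un v) i with h | h | h <;> subst h <;> rcases hcorner v with h | h
    · exact Or.inl h.1
    · exact Or.inr h.1
    · exact Or.inl h.2.1
    · exact Or.inr h.2.1
    · exact Or.inr h.2.2
    · exact Or.inl h.2.2
  have hdisj : ∀ φ, φ ∈ side out → φ ∉ side inn := by
    intro φ h1 h2
    have hall := two_mul_card_le (V := V) (g₁ := fun v => f (v, un v))
      (g₂ := fun v => f (v, un v - 1)) (mate := mate) hm hg1 hg2 (L := Finset.univ) (by
        intro T _ hne hTne
        by_contra hno
        have hin : ∀ A : Finset F, (∀ T ⊆ A, T.Nonempty → T ≠ A → ∃ v, (f (v, un v) ∈ T ∧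
            f (v, un v - 1) ∈ A ∧ f (v, un v - 1) ∉ T) ∨ (f (v, un v - 1) ∈ T ∧
            f (v, un v) ∈ A ∧ f (v, un v) ∉ T)) → (∃ ψ, ψ ∈ T ∧ ψ ∈ A) → A ⊆ T := by
          rintro A hA ⟨ψ, hψ1, hψ2⟩
          by_contra hAT
          obtain ⟨v, hv⟩ := hA (T ∩ A) Finset.inter_subset_right
            ⟨ψ, Finset.mem_inter.2 ⟨hψ1, hψ2⟩⟩
            (fun h => hAT (by rw [← h]; exact Finset.inter_subset_left))
          obtain ⟨w, hw1, hw2, hw3⟩ := hflip hv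
          exact hno ⟨w, (Finset.mem_inter.1 hw1).1, Finset.mem_univ _,
            fun h => hw3 (Finset.mem_inter.2 ⟨h, hw2⟩)⟩
        obtain ⟨ψ, hψ⟩ := hne
        have hφT : φ ∈ T := by
          rcases hcover ψ with h3 | h3
          · exact hin _ hcL ⟨ψ, hψ, h3⟩ h1
          · exact hin _ hcR ⟨ψ, hψ, h3⟩ h2
        apply hTne
        refine Finset.eq_univ_of_forall fun χ => ?_
        rcases hcover χ with h3 | h3
        · exact hin _ hcL ⟨φ, hφT, h1⟩ h3
        · exact hin _ hcR ⟨φ, hφT, h2⟩ h3)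
      {φ} (Finset.subset_univ _) (Finset.singleton_nonempty _)
    have hle := Finset.card_le_univ (Finset.univ.filter fun v => f (v, un v) ∈ Finset.univ ∧
      f (v, un v - 1) ∈ Finset.univ ∧ ¬ (f (v, un v) ∈ ({φ} : Finset F) ∧
      f (v, un v - 1) ∈ ({φ} : Finset F)))
    rw [Finset.card_univ, Finset.card_singleton] at hall
    omega
  have hcompl : (side out)ᶜ = side inn := by
    ext φ
    rw [Finset.mem_compl]
    exact ⟨fun h => (hcover φ).resolve_left h, fun h h' => hdisj φ h' h⟩
  have e1 : ∀ v, f (v, un v - 1) ∈ side out ↔ f (v, un v) ∈ side out := by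
    intro v
    rcases hcorner v with h | h
    · exact iff_of_true h.2.1 h.1
    · exact iff_of_false (fun h' => hdisj _ h' h.2.1) (fun h' => hdisj _ h' h.1)
  have e2 : ∀ v, f (v, un v + 1) ∈ side out ↔ f (v, un v) ∉ side out := by
    intro v
    rcases hcorner v with h | h
    · exact iff_of_false (fun h' => hdisj _ h' h.2.2) (fun h' => h' h.1)
    · exact iff_of_true h.2.2 (fun h' => hdisj _ h' h.1)
  have e3 : ∀ v, f (v, un v - 1) ∈ side inn ↔ f (v, un v) ∈ side inn := by
    intro v
    rw [← hcompl, Finset.mem_compl, Finset.mem_compl, e1]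
  have le : ∀ A : Finset F, (∀ v, f (v, un v - 1) ∈ A ↔ f (v, un v) ∈ A) →
      (∀ T ⊆ A, T.Nonempty → T ≠ A → ∃ v, (f (v, un v) ∈ T ∧
            f (v, un v - 1) ∈ A ∧ f (v, un v - 1) ∉ T) ∨ (f (v, un v - 1) ∈ T ∧
            f (v, un v) ∈ A ∧ f (v, un v) ∉ T)) → ∀ S ⊆ A, S.Nonempty → 2 * A.card ≤ 2 * S.card +
      (Finset.univ.filter fun v => f (v, un v) ∈ A ∧
        ¬ (f (v, un v) ∈ S ∧ f (v, un v - 1) ∈ S)).card := by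
    intro A hA hc S hS hne
    have := two_mul_card_le (V := V) (g₁ := fun v => f (v, un v))
      (g₂ := fun v => f (v, un v - 1)) (mate := mate) hm hg1 hg2 (L := A)
      (fun T h1 h2 h3 => by obtain ⟨v, hv⟩ := hc T h1 h2 h3; exact hflip hv) S hS hne
    refine this.trans (Nat.add_le_add_left (Finset.card_le_card ?_) _)
    intro v hv
    simp only [Finset.mem_filter, Finset.mem_univ, true_and] at hv ⊢
    exact ⟨hv.1, hv.2.2⟩
  have leL := le _ e1 hcL
  have leR := le _ e3 hcR
  have hcnt : (Finset.univ.filter fun v => f (v, un v) ∈ side out).card +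
      (Finset.univ.filter fun v => f (v, un v) ∈ side inn).card = Fintype.card V := by
    have : (Finset.univ.filter fun v => f (v, un v) ∈ side inn) =
        Finset.univ.filter fun v => ¬ f (v, un v) ∈ side out := by
      ext v
      simp [← hcompl]
    rw [this, Finset.card_filter_add_card_filter_not, Finset.card_univ]
  have hfc : (side out).card + (side inn).card = Fintype.card F := by
    rw [← hcompl, Finset.card_add_card_compl]
  have one : ∀ (A : Finset F) (o : V → Fin 3), A = side o → (∀ S ⊆ A, S.Nonempty →
      2 * A.card ≤ 2 * S.card + (Finset.univ.filter fun v => f (v, un v) ∈ A ∧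
        ¬ (f (v, un v) ∈ S ∧ f (v, un v - 1) ∈ S)).card) →
      2 * A.card ≤ 2 + (Finset.univ.filter fun v => f (v, un v) ∈ A).card := by
    intro A o hA hle
    have hVne : Nonempty V := by
      rw [← Fintype.card_pos_iff]
      by_contra h0
      have h1 : Fintype.card V = 0 := by omega
      have := Fintype.card_eq_zero_iff.1 h1
      have : IsEmpty F := ⟨fun φ => by obtain ⟨⟨v, _⟩, _⟩ := hs φ; exact isEmptyElim v⟩
      have := Fintype.card_eq_zero (α := F)
      omega
    obtain ⟨v⟩ := hVne
    have := hle {f (v, o v)} (by rw [hA, Finset.singleton_subset_iff]; exact mem_side o v)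
      (Finset.singleton_nonempty _)
    rw [Finset.card_singleton, mul_one] at this
    refine this.trans (Nat.add_le_add_left (Finset.card_le_card ?_) _)
    intro v hv
    simp only [Finset.mem_filter, Finset.mem_univ, true_and] at hv ⊢
    exact hv.1
  have oneL := one _ out rfl leL
  have oneR := one _ inn rfl leR
  refine ⟨un, side out, hun, e1, e2, ⟨by omega, leL⟩, ?_⟩
  rw [hcompl]
  exact ⟨by omega, leR⟩

end CubicMap

/-! ### Cuts of five edges that exclude hamiltonian cycles -/

namespace CubicMap

variable {V : Type*} (M : CubicMap V)
variable {F : Type*} [DecidableEq F] [Fintype V]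

/-- A set `Z` of vertices that is cut off by five edges, described by the darts `δ t` that leave it,
the faces `C t` that meet these edges, and the faces `I` all of whose vertices are in `Z`. Face
lengths are prescribed modulo `3` only: they are `2`, except that `C 0`, `C 1` and `C 3`
have length `0`, and the number of corners in `Z` of the faces `C 0, …, C 4` is `2, 2, 0, 0, 0`. -/
structure IsObstruction (f : V × Fin 3 → F) (Z : V → Prop) [DecidablePred Z] (I : Finset F)
    (C : Fin 5 → F) (δ : Fin 5 → V × Fin 3) : Prop where
  inj : Function.Injective C
  notMem : ∀ t, C t ∉ I
  mem : ∀ t, Z (δ t).1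
  opp_mem : ∀ t, ¬ Z (M.opp (δ t)).1
  inj_fst : ∀ s t, (δ s).1 = (δ t).1 → s = t
  exists_eq : ∀ d, Z d.1 → ¬ Z (M.opp d).1 → ∃ t, d = δ t
  face : ∀ t, f (δ t) = C t
  face_prev : ∀ t, f ((δ t).1, (δ t).2 - 1) = C (t - 1)
  face_of_mem : ∀ v i, Z v → f (v, i) ∈ I ∨ ∃ t, f (v, i) = C t
  face_of_notMem : ∀ v i, ¬ Z v → f (v, i) ∉ I
  fiber : ∀ φ, (Finset.univ.filter fun d => f d = φ).card % 3 =
    (2 + if ∃ t, (t = 0 ∨ t = 1 ∨ t = 3) ∧ C t = φ then 1 else 0) % 3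
  fiber_mem : ∀ φ, (Finset.univ.filter fun d : V × Fin 3 => Z d.1 ∧ f d = φ).card % 3 =
    (if φ ∈ I then 2 else if ∃ t, (t = 0 ∨ t = 1) ∧ C t = φ then 2 else 0) % 3
  card : Fintype.card V % 3 = 2
  card_mem : (Finset.univ.filter fun v => Z v).card % 3 = 2

theorem card_filter_comp {C : Fin 5 → F} (hC : Function.Injective C)
    (P : Fin 5 → Prop) [DecidablePred P] (L : Finset F) :
    (Finset.univ.filter fun t => P t ∧ C t ∈ L).card =
      ∑ φ ∈ L, if ∃ t, P t ∧ C t = φ then 1 else 0 := by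
  rw [← Finset.card_filter, ← Finset.card_image_of_injective _ hC]
  congr 1
  ext φ
  simp only [Finset.mem_image, Finset.mem_filter, Finset.mem_univ, true_and]
  constructor
  · rintro ⟨t, ⟨h1, h2⟩, rfl⟩; exact ⟨h2, t, h1, rfl⟩
  · rintro ⟨h2, t, h1, rfl⟩; exact ⟨t, ⟨h1, h2⟩, rfl⟩

theorem sum_mod_congr {ι : Type*} {L : Finset ι} {g h : ι → ℕ} {n : ℕ}
    (H : ∀ φ ∈ L, g φ % n = h φ % n) :
    (∑ φ ∈ L, g φ) % n = (∑ φ ∈ L, h φ) % n := by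
  rw [Finset.sum_nat_mod, Finset.sum_nat_mod (f := h), Finset.sum_congr rfl H]

/-- The number of corners on a side, modulo `3`. -/
theorem IsObstruction.count {M : CubicMap V} {f : V × Fin 3 → F} {Z : V → Prop}
    [DecidablePred Z] {I : Finset F} {C : Fin 5 → F} {δ : Fin 5 → V × Fin 3}
    (h : M.IsObstruction f Z I C δ) (L : Finset F) :
    (Finset.univ.filter fun d => f d ∈ L).card % 3 = (2 * L.card +
      (Finset.univ.filter fun t => (t = 0 ∨ t = 1 ∨ t = 3) ∧ C t ∈ L).card) % 3 := by
  rw [card_filter_comp h.inj, mul_comm, ← smul_eq_mul, ← Finset.sum_const,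
    ← Finset.sum_add_distrib]
  have h1 := Finset.card_eq_sum_card_fiberwise (s := Finset.univ.filter fun d => f d ∈ L) (t := L)
    (f := f) (by intro d hd; simpa using hd)
  rw [h1]
  refine sum_mod_congr fun φ hφ => ?_
  rw [← h.fiber φ]
  congr 2
  ext d
  simp only [Finset.mem_filter, Finset.mem_univ, true_and]
  exact ⟨fun h => h.2, fun h => ⟨by rw [h]; exact hφ, h⟩⟩

/-- The number of corners in `Z` on a side, modulo `3`. -/
theorem IsObstruction.count_mem {M : CubicMap V} {f : V × Fin 3 → F} {Z : V → Prop}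
    [DecidablePred Z] {I : Finset F} {C : Fin 5 → F} {δ : Fin 5 → V × Fin 3}
    (h : M.IsObstruction f Z I C δ) (L : Finset F) :
    (Finset.univ.filter fun d : V × Fin 3 => Z d.1 ∧ f d ∈ L).card % 3 = (2 * (L ∩ I).card +
      2 * (Finset.univ.filter fun t => (t = 0 ∨ t = 1) ∧ C t ∈ L).card) % 3 := by
  have h0 : 2 * (L ∩ I).card +
      2 * (Finset.univ.filter fun t => (t = 0 ∨ t = 1) ∧ C t ∈ L).card = ∑ φ ∈ L,
      2 * ((if φ ∈ I then 1 else 0) + if ∃ t, (t = 0 ∨ t = 1) ∧ C t = φ then 1 else 0) := by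
    rw [card_filter_comp h.inj, ← Finset.filter_mem_eq_inter, Finset.card_filter, ← mul_add,
      ← Finset.sum_add_distrib, Finset.mul_sum]
  have h1 := Finset.card_eq_sum_card_fiberwise
    (s := Finset.univ.filter fun d : V × Fin 3 => Z d.1 ∧ f d ∈ L) (t := L)
    (f := f) (by intro d hd; simp at hd; exact hd.2)
  rw [h0, h1]
  refine sum_mod_congr fun φ hφ => ?_
  have h2 := h.fiber_mem φ
  have h3 : (Finset.univ.filter fun d : V × Fin 3 => Z d.1 ∧ f d = φ) =
      (Finset.univ.filter fun d : V × Fin 3 => Z d.1 ∧ f d ∈ L).filter fun d => f d = φ := by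
    ext d
    simp only [Finset.mem_filter, Finset.mem_univ, true_and]
    exact ⟨fun h => ⟨⟨h.1, by rw [h.2]; exact hφ⟩, h.2⟩, fun h => ⟨h.1.1, h.2⟩⟩
  rw [← h3, h2]
  by_cases hI : φ ∈ I
  · have : ¬ ∃ t, (t = 0 ∨ t = 1) ∧ C t = φ := by
      rintro ⟨t, _, rfl⟩
      exact h.notMem t hI
    simp [hI, this]
  · simp only [hI, if_false, zero_add]
    split <;> rfl

/-- Each vertex has one corner on the side `L`, and two if its edge off the cycle is there. -/
theorem card_corner {f : V × Fin 3 → F} {un : V → Fin 3} {L : Finset F}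
    (e1 : ∀ v, f (v, un v - 1) ∈ L ↔ f (v, un v) ∈ L)
    (e2 : ∀ v, f (v, un v + 1) ∈ L ↔ f (v, un v) ∉ L) (Z : V → Prop) [DecidablePred Z] :
    (Finset.univ.filter fun d : V × Fin 3 => Z d.1 ∧ f d ∈ L).card =
      (Finset.univ.filter fun v => Z v).card +
      (Finset.univ.filter fun v => Z v ∧ f (v, un v) ∈ L).card := by
  simp only [Finset.card_filter]
  rw [Fintype.sum_prod_type, ← Finset.sum_add_distrib]
  refine Finset.sum_congr rfl fun v _ => ?_
  have h3 : ∀ (u : Fin 3) (g : Fin 3 → ℕ), ∑ i, g i = g u + g (u - 1) + g (u + 1) := by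
    intro u g
    rw [Fin.sum_univ_three]
    fin_cases u <;> simp <;> ring_nf; rfl
  rw [h3 (un v)]
  by_cases hz : Z v <;> by_cases h : f (v, un v) ∈ L <;> simp [e1, e2, hz, h]

/-- No side of a hamiltonian cycle contains the face `C 0` of an obstruction. Here `X p q` is the
set of the ends of the edges off the cycle on the side `L`, where `p` and `q` tell whether this end
and the other one are in `Z`. -/
theorem IsObstruction.false_of_mem [DecidableEq V] [Fintype F] {M : CubicMap V}
    {f : V × Fin 3 → F} {Z : V → Prop}
    [DecidablePred Z] {I : Finset F} {C : Fin 5 → F} {δ : Fin 5 → V × Fin 3}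
    (h : M.IsObstruction f Z I C δ)
    (hf : ∀ d, f ((M.opp d).1, (M.opp d).2 - 1) = f d) {un : V → Fin 3} {L : Finset F}
    (hun : ∀ v, (M.opp (v, un v)).2 = un (M.opp (v, un v)).1)
    (e1 : ∀ v, f (v, un v - 1) ∈ L ↔ f (v, un v) ∈ L)
    (e2 : ∀ v, f (v, un v + 1) ∈ L ↔ f (v, un v) ∉ L) (hL : IsSide f un L) (h0 : C 0 ∈ L) :
    False := by
  let mate : V → V := fun v => (M.opp (v, un v)).1
  have hmate : ∀ v, M.opp (v, un v) = (mate v, un (mate v)) := fun v =>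
    Prod.ext rfl (hun v)
  have hmm : ∀ v, mate (mate v) = v := by
    intro v
    change (M.opp (mate v, un (mate v))).1 = v
    rw [← hmate, M.opp_opp]
  have hg2 : ∀ v, f (mate v, un (mate v) - 1) = f (v, un v) := by
    intro v
    have := hf (v, un v)
    rwa [hmate] at this
  have hg1 : ∀ v, f (mate v, un (mate v)) = f (v, un v - 1) := by
    intro v
    rw [← hg2 (mate v), hmm]
  have hm : ∀ v, mate v ≠ v := fun v => M.opp_ne _
  have hmL : ∀ v, f (mate v, un (mate v)) ∈ L ↔ f (v, un v) ∈ L := by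
    intro v
    rw [hg1, e1]
  let X : Bool → Bool → Finset V := fun p q => Finset.univ.filter fun v =>
    f (v, un v) ∈ L ∧ (Z v ↔ p = true) ∧ (Z (mate v) ↔ q = true)
  have memX : ∀ p q v, v ∈ X p q ↔
      f (v, un v) ∈ L ∧ (Z v ↔ p = true) ∧ (Z (mate v) ↔ q = true) := by
    intro p q v
    simp [X]
  have split : ∀ A : Finset V, (∀ v ∈ A, f (v, un v) ∈ L) →
      A.card = (A ∩ X true true).card + (A ∩ X true false).card +
        (A ∩ X false true).card + (A ∩ X false false).card := by
    intro A hA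
    rw [← Finset.card_filter_add_card_filter_not (s := A) (p := fun v => Z v),
      ← Finset.card_filter_add_card_filter_not (s := A.filter fun v => Z v)
        (p := fun v => Z (mate v)),
      ← Finset.card_filter_add_card_filter_not (s := A.filter fun v => ¬ Z v)
        (p := fun v => Z (mate v)), ← add_assoc]
    congr 1
    · congr 1
      · congr 1 <;>
        · congr 1
          ext v
          simp only [Finset.mem_filter, Finset.mem_inter, memX]
          have := hA v
          tauto
      · congr 1
        ext v
        simp only [Finset.mem_filter, Finset.mem_inter, memX]
        have := hA v
        simp
        tauto
    · congr 1
      ext v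
      simp only [Finset.mem_filter, Finset.mem_inter, memX]
      have := hA v
      simp
      tauto
  have hswap : (X false true).card = (X true false).card := by
    refine Finset.card_bij (fun v _ => mate v) ?_ ?_ ?_
    · intro v hv
      rw [memX] at hv ⊢
      rw [hmL, hmm]
      exact ⟨hv.1, hv.2.2, hv.2.1⟩
    · intro v _ w _ hvw
      rw [← hmm v, hvw, hmm]
    · intro v hv
      refine ⟨mate v, ?_, hmm v⟩
      rw [memX] at hv ⊢
      rw [hmL, hmm]
      exact ⟨hv.1, hv.2.2, hv.2.1⟩
  have heven : (X true true).card % 2 = 0 := by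
    have : ∑ v ∈ X true true, (1 : ZMod 2) = 0 := by
      refine Finset.sum_involution (fun v _ => mate v) ?_ ?_ ?_ ?_
      · intro v _; decide
      · intro v _ _; exact hm v
      · intro v hv
        rw [memX] at hv ⊢
        rw [hmL, hmm]
        exact ⟨hv.1, hv.2.2, hv.2.1⟩
      · intro v _; exact hmm v
    rw [Finset.sum_const, nsmul_eq_mul, mul_one] at this
    exact Nat.mod_eq_zero_of_dvd ((ZMod.natCast_eq_zero_iff _ _).1 this)
  -- an edge of the cut lies off the cycle on the side `L` iff both its faces do
  have hmd : (X true false).card =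
      (Finset.univ.filter fun t => C t ∈ L ∧ C (t - 1) ∈ L).card := by
    symm
    refine Finset.card_bij (fun t _ => (δ t).1) ?_ ?_ ?_
    · intro t ht
      simp only [Finset.mem_filter, Finset.mem_univ, true_and] at ht
      rw [memX]
      have hu : un (δ t).1 = (δ t).2 := by
        have key : ∀ u s : Fin 3, u = s ∨ (s = u + 1 ∧ s - 1 = u) ∨
          (s = u - 1 ∧ s - 1 = u + 1) := by decide
        have f1 : f ((δ t).1, (δ t).2) ∈ L := by
          rw [Prod.mk.eta, h.face]; exact ht.1
        have f2 := ht.2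
        rw [← h.face_prev] at f2
        rcases key (un (δ t).1) (δ t).2 with hk | ⟨k1, k2⟩ | ⟨k1, k2⟩
        · exact hk
        · rw [k2] at f2; rw [k1, e2] at f1; exact absurd f2 f1
        · rw [k2, e2] at f2; rw [k1, e1] at f1; exact absurd f1 f2
      refine ⟨?_, iff_of_true (h.mem t) rfl, iff_of_false ?_ (by simp)⟩
      · rw [hu, Prod.mk.eta, h.face]; exact ht.1
      · change ¬ Z (M.opp ((δ t).1, un (δ t).1)).1
        rw [hu, Prod.mk.eta]
        exact h.opp_mem t
    · intro s _ t _ hst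
      exact h.inj_fst s t hst
    · intro v hv
      rw [memX] at hv
      obtain ⟨t, ht⟩ := h.exists_eq (v, un v) (hv.2.1.2 rfl) (by
        intro hz; simpa using hv.2.2.1 hz)
      refine ⟨t, ?_, by rw [← ht]⟩
      simp only [Finset.mem_filter, Finset.mem_univ, true_and]
      rw [← h.face, ← h.face_prev, ← ht]
      exact ⟨hv.1, (e1 v).2 hv.1⟩
  have hx := split (Finset.univ.filter fun v => f (v, un v) ∈ L) (by simp)
  have hXsub : ∀ p q, (Finset.univ.filter fun v => f (v, un v) ∈ L) ∩ X p q = X p q := by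
    intro p q
    apply Finset.inter_eq_right.2
    intro v hv
    rw [memX] at hv
    simpa using hv.1
  rw [hXsub, hXsub, hXsub, hXsub, hswap] at hx
  have hxZ : (Finset.univ.filter fun v => Z v ∧ f (v, un v) ∈ L).card =
      (X true true).card + (X true false).card := by
    rw [← Finset.card_filter_add_card_filter_not
      (s := Finset.univ.filter fun v => Z v ∧ f (v, un v) ∈ L) (p := fun v => Z (mate v))]
    congr 2 <;>
    · ext v
      simp only [Finset.mem_filter, Finset.mem_univ, true_and, memX]
      simp
      tauto
  have hside := hL.card_chord
  -- Grinberg's formula for the whole map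
  have htot := h.count L
  have hc := card_corner e1 e2 (fun _ => True)
  simp only [true_and, Finset.filter_true, Finset.card_univ] at hc
  rw [hc] at htot
  have hV := h.card
  -- the count of the corners in `Z`
  have hZ := h.count_mem L
  rw [card_corner e1 e2 Z, hxZ] at hZ
  have hZc := h.card_mem
  set K : Finset F := Finset.univ.image C
  have memK : ∀ t, C t ∈ K := fun t => Finset.mem_image_of_mem _ (Finset.mem_univ t)
  have hKI : Disjoint (L ∩ I) (L ∩ K) := by
    rw [Finset.disjoint_left]
    intro φ h1 h2
    obtain ⟨t, _, rfl⟩ := Finset.mem_image.1 (Finset.mem_inter.1 h2).2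
    exact h.notMem t (Finset.mem_inter.1 h1).2
  have hKc : ∀ A : Finset F, (A ∩ K).card = (Finset.univ.filter fun t => C t ∈ A).card := by
    intro A
    rw [← Finset.card_image_of_injective _ h.inj]
    congr 1
    ext φ
    simp only [Finset.mem_inter, Finset.mem_image, Finset.mem_filter, Finset.mem_univ, true_and, K]
    constructor
    · rintro ⟨h1, t, rfl⟩; exact ⟨t, h1, rfl⟩
    · rintro ⟨t, h1, rfl⟩; exact ⟨h1, t, rfl⟩
  have hl := hKc L
  -- no edge with an end outside `Z` meets a face in `I`, so all those that meet such faces are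
  -- counted by `X true true`; there are at least as many of them as faces in `L ∩ I`, as the
  -- side is a tree
  have hup : 2 * (L ∩ I).card ≤ (X true true).card := by
    have h1 := hL.le_card (L \ I) Finset.sdiff_subset ⟨C 0, Finset.mem_sdiff.2 ⟨h0, h.notMem 0⟩⟩
    have h2 : (Finset.univ.filter fun v => f (v, un v) ∈ L ∧
        ¬ (f (v, un v) ∈ L \ I ∧ f (v, un v - 1) ∈ L \ I)) ⊆ X true true := by
      intro v hv
      simp only [Finset.mem_filter, Finset.mem_univ, true_and, Finset.mem_sdiff] at hv
      rw [memX]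
      refine ⟨hv.1, iff_of_true ?_ rfl, iff_of_true ?_ rfl⟩ <;> by_contra hz <;> apply hv.2
      · exact ⟨⟨hv.1, h.face_of_notMem _ _ hz⟩, (e1 v).2 hv.1, h.face_of_notMem _ _ hz⟩
      · rw [← hg1 v, ← hg2 v]
        exact ⟨⟨by rw [hg2]; exact hv.1, h.face_of_notMem _ _ hz⟩,
          by rw [hg1, e1]; exact hv.1, h.face_of_notMem _ _ hz⟩
    have h3 := Finset.card_le_card h2
    have h4 := Finset.card_sdiff_add_card_inter L I
    omega
  -- an edge off the cycle that meets `Z` joins two of the faces `I` and `C t`; all together these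
  -- edges form a forest
  have hlow : (X true true).card + 2 * (X true false).card + 2 ≤
      2 * ((L ∩ I).card + (L ∩ K).card) := by
    rw [← Finset.card_union_of_disjoint hKI]
    have h1 := hL.le_card (L ∩ I ∪ L ∩ K)
      (Finset.union_subset Finset.inter_subset_left Finset.inter_subset_left)
      ⟨C 0, Finset.mem_union_right _ (Finset.mem_inter.2 ⟨h0, memK 0⟩)⟩
    have h2 : (Finset.univ.filter fun v => f (v, un v) ∈ L ∧
        ¬ (f (v, un v) ∈ L ∩ I ∪ L ∩ K ∧ f (v, un v - 1) ∈ L ∩ I ∪ L ∩ K)) ⊆ X false false := by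
      have hin : ∀ v i, Z v → f (v, i) ∈ L → f (v, i) ∈ L ∩ I ∪ L ∩ K := by
        intro v i hz hi
        rcases h.face_of_mem v i hz with h3 | ⟨t, h3⟩
        · exact Finset.mem_union_left _ (Finset.mem_inter.2 ⟨hi, h3⟩)
        · exact Finset.mem_union_right _ (Finset.mem_inter.2 ⟨hi, by rw [h3]; exact memK t⟩)
      intro v hv
      simp only [Finset.mem_filter, Finset.mem_univ, true_and] at hv
      rw [memX]
      refine ⟨hv.1, iff_of_false ?_ (by simp), iff_of_false ?_ (by simp)⟩ <;> intro hz <;>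
        apply hv.2
      · exact ⟨hin _ _ hz hv.1, hin _ _ hz ((e1 v).2 hv.1)⟩
      · rw [← hg1 v, ← hg2 v]
        exact ⟨hin _ _ hz (by rw [hg2]; exact hv.1), hin _ _ hz (by rw [hg1, e1]; exact hv.1)⟩
    have h3 := Finset.card_le_card h2
    omega
  -- the five edges of the cut would form a cycle through the faces `C t`
  have hfive : (∀ t, C t ∈ L) → (X true false).card ≤ 4 := by
    intro hall
    have hKL : K ⊆ L := by
      intro φ hφ
      obtain ⟨t, _, rfl⟩ := Finset.mem_image.1 hφ
      exact hall t
    have h1 := hL.le_card K hKL ⟨C 0, memK 0⟩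
    have h5 : K.card = 5 := by
      rw [Finset.card_image_of_injective _ h.inj, Finset.card_univ, Fintype.card_fin]
    set Y := Finset.univ.filter fun v => f (v, un v) ∈ L ∧
        ¬ (f (v, un v) ∈ K ∧ f (v, un v - 1) ∈ K)
    have h2 := split Y (by intro v hv; exact (Finset.mem_filter.1 hv).2.1)
    have hcut : ∀ v, Z v → ¬ Z (mate v) → f (v, un v) ∈ K ∧ f (v, un v - 1) ∈ K := by
      intro v hz hz'
      obtain ⟨t, ht⟩ := h.exists_eq (v, un v) hz hz'
      have f1 := h.face t
      have f2 := h.face_prev t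
      rw [← ht] at f1 f2
      rw [f1, f2]
      exact ⟨memK _, memK _⟩
    have h3 : Y ∩ X true false = ∅ := by
      apply Finset.eq_empty_of_forall_notMem
      intro v hv
      obtain ⟨hv1, hv2⟩ := Finset.mem_inter.1 hv
      rw [memX] at hv2
      exact (Finset.mem_filter.1 hv1).2.2
        (hcut v (hv2.2.1.2 rfl) (fun hz => by simpa using hv2.2.2.1 hz))
    have h4 : Y ∩ X false true = ∅ := by
      apply Finset.eq_empty_of_forall_notMem
      intro v hv
      obtain ⟨hv1, hv2⟩ := Finset.mem_inter.1 hv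
      rw [memX] at hv2
      have := hcut (mate v) (hv2.2.2.2 rfl) (by
        rw [hmm]; exact fun hz => by simpa using hv2.2.1.1 hz)
      rw [hg1, hg2] at this
      exact (Finset.mem_filter.1 hv1).2.2 this.symm
    have h6 := Finset.card_le_card (Finset.inter_subset_right (s₁ := Y) (s₂ := X true true))
    have h7 := Finset.card_le_card (Finset.inter_subset_right (s₁ := Y) (s₂ := X false false))
    rw [h3, h4, Finset.card_empty] at h2
    omega
  rw [hmd] at *
  rw [hl] at hlow
  -- `b` tells which of the faces `C t` are on the side `L`
  have key : ∀ b : Fin 5 → Bool, b 0 = true →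
      (Finset.univ.filter fun t => (t = 0 ∨ t = 1 ∨ t = 3) ∧ b t = true).card % 3 = 0 →
      ((∀ t, b t = true) ∧ (Finset.univ.filter fun t => b t = true ∧ b (t - 1) = true).card = 5) ∨
      ((2 + 2 * (Finset.univ.filter fun t => b t = true).card +
        2 * (Finset.univ.filter fun t => b t = true ∧ b (t - 1) = true).card +
        (Finset.univ.filter fun t => (t = 0 ∨ t = 1) ∧ b t = true).card) % 3 = 0 ∧
      (Finset.univ.filter fun t => b t = true).card ≤
        (Finset.univ.filter fun t => b t = true ∧ b (t - 1) = true).card + 2) := by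
    decide
  have := key (fun t => decide (C t ∈ L)) (by simpa using h0)
    (by simp only [decide_eq_true_eq]; omega)
  simp only [decide_eq_true_eq] at this
  rcases this with ⟨h1, h2⟩ | ⟨h1, h2⟩
  · have := hfive h1
    omega
  · omega

/-- A map on the sphere with an obstruction is not hamiltonian. Of the exceptional faces `C 0`,
`C 1`, `C 3`, either all or none lie on a given side, by Grinberg's formula modulo `3`. On the side
that contains them, the edges off the cycle that meet `Z` form a forest whose number of components
is divisible by `3`, but positive and at most the number of runs of cut faces on that side, hence at
most `2`. -/
theorem IsObstruction.not_isHamiltonian [DecidableEq V] [Fintype F] {M : CubicMap V}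
    {f : V × Fin 3 → F} {Z : V → Prop}
    [DecidablePred Z] {I : Finset F} {C : Fin 5 → F} {δ : Fin 5 → V × Fin 3}
    (h : M.IsObstruction f Z I C δ)
    (hf : ∀ d, f ((M.opp d).1, (M.opp d).2 - 1) = f d) (hs : Function.Surjective f)
    (hcard : 2 * Fintype.card F = Fintype.card V + 4) : ¬ M.graph.IsHamiltonian := by
  intro hham
  have hV := h.card
  obtain ⟨un, L, hun, e1, e2, hL, hR⟩ := M.exists_isSide f hf hs hcard (by omega) hham
  by_cases h0 : C 0 ∈ L
  · exact h.false_of_mem hf hun e1 e2 hL h0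
  · refine h.false_of_mem hf hun (L := Lᶜ) (fun v => ?_) (fun v => ?_) hR (by simpa using h0)
    · rw [Finset.mem_compl, Finset.mem_compl, e1]
    · rw [Finset.mem_compl, Finset.mem_compl, e2]

end CubicMap

/-! ### Straight drawings on a cylinder -/

/-- The point of the plane with polar coordinates `1 + p.2` and `2 π p.1 / W`: the half cylinder of
circumference `W` is rolled out around the unit disc. -/
noncomputable def cyl (W : ℕ) (p : ℝ × ℝ) : Plane :=
  !₂[(1 + p.2) * Real.cos (2 * Real.pi * (p.1 / W)), (1 + p.2) * Real.sin (2 * Real.pi * (p.1 / W))]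

theorem continuous_cyl (W : ℕ) : Continuous (cyl W) := by
  unfold cyl
  refine (PiLp.continuous_toLp 2 _).comp (continuous_pi fun i => ?_)
  fin_cases i <;> simp <;> fun_prop

theorem cyl_inj {W : ℕ} (hW : 0 < W) {p q : ℝ × ℝ} (hp : 0 ≤ p.2) (hq : 0 ≤ q.2)
    (h : cyl W p = cyl W q) : p.2 = q.2 ∧ ∃ m : ℤ, p.1 = q.1 + m * W := by
  have h0 := congrArg (fun z : Plane => z 0) h
  have h1 := congrArg (fun z : Plane => z 1) h
  simp only [cyl] at h0 h1
  simp at h0 h1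
  set a := 2 * Real.pi * (p.1 / W) with ha
  set b := 2 * Real.pi * (q.1 / W) with hb
  have e1 := Real.sin_sq_add_cos_sq a
  have e2 := Real.sin_sq_add_cos_sq b
  have hsq : (1 + p.2) ^ 2 = (1 + q.2) ^ 2 := by
    calc (1 + p.2) ^ 2 = ((1 + p.2) * Real.sin a) ^ 2 + ((1 + p.2) * Real.cos a) ^ 2 := by
          rw [mul_pow, mul_pow, ← mul_add, e1, mul_one]
      _ = ((1 + q.2) * Real.sin b) ^ 2 + ((1 + q.2) * Real.cos b) ^ 2 := by rw [h0, h1]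
      _ = (1 + q.2) ^ 2 := by rw [mul_pow, mul_pow, ← mul_add, e2, mul_one]
  have hy : p.2 = q.2 := by
    have := (pow_left_inj₀ (by linarith : 0 ≤ 1 + p.2) (by linarith) two_ne_zero).1 hsq
    linarith
  refine ⟨hy, ?_⟩
  rw [hy] at h0 h1
  have hne : 1 + q.2 ≠ 0 := by linarith
  have hc := mul_left_cancel₀ hne h0
  have hs := mul_left_cancel₀ hne h1
  have hang := Real.Angle.cos_sin_inj hc hs
  obtain ⟨k, hk⟩ := Real.Angle.angle_eq_iff_two_pi_dvd_sub.1 hang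
  refine ⟨k, ?_⟩
  have hW' : (W : ℝ) ≠ 0 := by positivity
  have hpi := Real.pi_pos
  rw [ha, hb] at hk
  have h2 : p.1 / W - q.1 / W = k := by
    have h3 : 2 * Real.pi * (p.1 / W - q.1 / W - k) = 0 := by linarith
    rcases mul_eq_zero.1 h3 with h4 | h4
    · linarith
    · linarith
  field_simp at h2
  linarith

/-- The point at time `t` on the segment from `(a, b)` to `(c, d)`. -/
noncomputable def segPt (a b c d : ℝ) (t : ℝ) : ℝ × ℝ := (a + t * (c - a), b + t * (d - b))

/-- Two segments, the second one shifted by `m`, meet at most in common end points. -/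
def Apart (a b c d a' b' c' d' m : ℝ) : Prop :=
  ∀ s t : ℝ, 0 ≤ s → s ≤ 1 → 0 ≤ t → t ≤ 1 → b + s * (d - b) = b' + t * (d' - b') →
    a + s * (c - a) = a' + t * (c' - a') + m → (s = 0 ∨ s = 1) ∧ (t = 0 ∨ t = 1)

theorem Apart.symm {a b c d a' b' c' d' m : ℝ} (h : Apart a b c d a' b' c' d' m) :
    Apart a' b' c' d' a b c d (-m) := by
  intro s t hs hs' ht ht' h1 h2
  exact (h t s ht ht' hs hs' h1.symm (by linarith)).symm

/-- Straight line drawings on a cylinder are plane drawings. The edge `e` goes from the position of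
`src e` to `(ex e, Y (tgt e))`, which is the position of `tgt e` up to full turns. -/
theorem isPlanar_of_cylinder {V E : Type*} (G : SimpleGraph V) {W : ℕ} (hW : 0 < W)
    (src tgt : E → V) (X Y : V → ℕ) (ex : E → ℤ)
    (hadj : ∀ e, G.Adj (src e) (tgt e))
    (hE : ∀ u v, G.Adj u v → ∃ e, s(src e, tgt e) = s(u, v))
    (hEinj : ∀ e f, s(src e, tgt e) = s(src f, tgt f) → e = f)
    (hdeg : ∀ v, ∃ w, G.Adj v w)
    (hX : ∀ v, X v < W) (hXY : ∀ u v, X u = X v → Y u = Y v → u = v)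
    (hex : ∀ e, ∃ m : ℤ, ex e = X (tgt e) + m * W)
    (hlen : ∀ e, |ex e - X (src e)| < W)
    (hsep : ∀ e f, e ≠ f → ∀ m : ℤ, Apart (X (src e)) (Y (src e)) (ex e) (Y (tgt e))
      (X (src f)) (Y (src f)) (ex f) (Y (tgt f)) (m * W)) : G.IsPlanar := by
  let P : E → ℝ → ℝ × ℝ := fun e => segPt (X (src e)) (Y (src e)) (ex e) (Y (tgt e))
  let pt : V → Plane := fun v => cyl W (X v, Y v)
  have hpt0 : ∀ e, cyl W (P e 0) = pt (src e) := by
    intro e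
    simp [P, pt, segPt]
  have hWR : (W : ℝ) ≠ 0 := by positivity
  have hpt1 : ∀ e, cyl W (P e 1) = pt (tgt e) := by
    intro e
    obtain ⟨m, hm⟩ := hex e
    simp only [P, pt, segPt, hm, cyl]
    push_cast
    have : 2 * Real.pi * (((X (src e) : ℝ) + 1 * ((X (tgt e) : ℝ) + m * W - X (src e))) / W) =
        2 * Real.pi * ((X (tgt e) : ℝ) / W) + m * (2 * Real.pi) := by
      field_simp
      ring
    rw [this, Real.cos_add_int_mul_two_pi, Real.sin_add_int_mul_two_pi]
    ring_nf
  have hPy : ∀ e t, 0 ≤ t → t ≤ 1 → 0 ≤ (P e t).2 := by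
    intro e t h0 h1
    have h2 : (0 : ℝ) ≤ Y (src e) := Nat.cast_nonneg _
    have h3 : (0 : ℝ) ≤ Y (tgt e) := Nat.cast_nonneg _
    simp only [P, segPt]
    nlinarith [mul_nonneg h0 h3, mul_nonneg (sub_nonneg.2 h1) h2]
  have hptinj : Function.Injective pt := by
    intro u v huv
    obtain ⟨h1, m, h2⟩ := cyl_inj hW (by positivity) (by positivity) huv
    simp only at h1 h2
    have h3 : (X u : ℤ) = X v + m * W := by exact_mod_cast h2
    have hu := hX u
    have hv := hX v
    have hm : m = 0 := by
      by_contra hm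
      rcases lt_or_gt_of_ne hm with hm | hm <;> nlinarith
    subst hm
    exact hXY u v (by simpa using h3) (by exact_mod_cast h1)
  -- edges meet in common ends only
  have hmeet : ∀ e f, e ≠ f → ∀ s t : ℝ, 0 ≤ s → s ≤ 1 → 0 ≤ t → t ≤ 1 →
      cyl W (P e s) = cyl W (P f t) → (s = 0 ∨ s = 1) ∧ (t = 0 ∨ t = 1) := by
    intro e f hef s t hs hs' ht ht' h
    obtain ⟨h1, m, h2⟩ := cyl_inj hW (hPy e s hs hs') (hPy f t ht ht') h
    exact hsep e f hef m s t hs hs' ht ht' h1 h2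
  have hend : ∀ e (s : ℝ), s = 0 ∨ s = 1 → ∃ v, v ∈ s(src e, tgt e) ∧ cyl W (P e s) = pt v := by
    rintro e s (rfl | rfl)
    · exact ⟨src e, by simp, hpt0 e⟩
    · exact ⟨tgt e, by simp, hpt1 e⟩
  let arc : Sym2 V → Set Plane := fun z =>
    {p | ∃ e, s(src e, tgt e) = z ∧ ∃ t : ℝ, 0 ≤ t ∧ t ≤ 1 ∧ cyl W (P e t) = p}
  refine ⟨⟨pt, arc, hptinj, ?_, ?_, ?_⟩⟩
  · intro u v huv
    obtain ⟨e, he⟩ := hE u v huv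
    have key : IsPlaneArc (arc s(u, v)) (pt (src e)) (pt (tgt e)) := by
      refine ⟨fun t => cyl W (P e t), ?_, ?_, ?_, ?_, ?_⟩
      · refine (continuous_cyl W).comp ?_
        simp only [P, segPt]
        fun_prop
      · intro s t hst
        obtain ⟨h1, m, h2⟩ := cyl_inj hW (hPy e s s.2.1 s.2.2) (hPy e t t.2.1 t.2.2) hst
        simp only [P, segPt] at h1 h2
        apply Subtype.ext
        by_contra hne
        have hs : (s : ℝ) - t ≠ 0 := sub_ne_zero.2 hne
        have hY : (Y (tgt e) : ℝ) - Y (src e) = 0 := by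
          have : ((s : ℝ) - t) * (Y (tgt e) - Y (src e)) = 0 := by linarith
          exact (mul_eq_zero.1 this).resolve_left hs
        have hl : |(ex e : ℝ) - X (src e)| < W := by exact_mod_cast hlen e
        have hst1 : |(s : ℝ) - t| ≤ 1 := by
          rw [abs_le]
          constructor <;> linarith [s.2.1, s.2.2, t.2.1, t.2.2]
        have h3 : ((s : ℝ) - t) * (ex e - X (src e)) = m * W := by linarith
        have hWp : (0 : ℝ) < W := by positivity
        have h4 : |(m : ℝ)| * W < W := by
          rw [← abs_of_pos hWp, ← abs_mul, abs_of_pos hWp, ← h3, abs_mul]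
          calc |(s : ℝ) - t| * |(ex e : ℝ) - X (src e)| ≤ 1 * |(ex e : ℝ) - X (src e)| := by
                gcongr
            _ < W := by rwa [one_mul]
        have hm : m = 0 := by
          by_contra hm
          have : (1 : ℝ) ≤ |(m : ℝ)| := by exact_mod_cast Int.one_le_abs hm
          nlinarith
        subst hm
        have h5 : (ex e : ℝ) - X (src e) = 0 := by
          have : ((s : ℝ) - t) * (ex e - X (src e)) = 0 := by simpa using h3
          exact (mul_eq_zero.1 this).resolve_left hs
        have h6 : pt (src e) = pt (tgt e) := by
          rw [← hpt0, ← hpt1]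
          congr 1
          simp only [P, segPt]
          rw [h5, hY]
          simp
        exact (hadj e).ne (hptinj h6)
      · simpa using hpt0 e
      · simpa using hpt1 e
      · ext p
        constructor
        · rintro ⟨t, rfl⟩
          exact ⟨e, he, t, t.2.1, t.2.2, rfl⟩
        · rintro ⟨f, hf, t, h0, h1, rfl⟩
          obtain rfl := hEinj f e (hf.trans he.symm)
          exact ⟨⟨t, h0, h1⟩, rfl⟩
    rcases Sym2.eq_iff.1 he with ⟨rfl, rfl⟩ | ⟨rfl, rfl⟩
    · exact key
    · obtain ⟨γ, h1, h2, h3, h4, h5⟩ := key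
      refine ⟨γ ∘ unitInterval.symm, h1.comp unitInterval.continuous_symm,
        h2.comp unitInterval.symm_bijective.injective, by simp [h4], by simp [h3], ?_⟩
      rw [unitInterval.symm_bijective.surjective.range_comp, h5]
  · rintro z _ w ⟨e, rfl, s, hs, hs', hw⟩
    by_contra hwe
    obtain ⟨w', hw'⟩ := hdeg w
    obtain ⟨f, hf⟩ := hE w w' hw'
    have hef : e ≠ f := by
      rintro rfl
      apply hwe
      rw [hf]
      simp
    have hwf : ∃ t : ℝ, 0 ≤ t ∧ t ≤ 1 ∧ cyl W (P f t) = pt w := by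
      rcases Sym2.eq_iff.1 hf with ⟨h, _⟩ | ⟨_, h⟩
      · exact ⟨0, le_rfl, zero_le_one, by rw [hpt0, h]⟩
      · exact ⟨1, zero_le_one, le_rfl, by rw [hpt1, h]⟩
    obtain ⟨t, ht, ht', hw2⟩ := hwf
    obtain ⟨v, hv, hv'⟩ := hend e s (hmeet e f hef s t hs hs' ht ht' (hw.trans hw2.symm)).1
    rw [hv'] at hw
    exact hwe (by rwa [hptinj hw] at hv)
  · rintro z _ z' _ hzz p ⟨⟨e, rfl, s, hs, hs', hp⟩, ⟨f, rfl, t, ht, ht', hp'⟩⟩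
    have hef : e ≠ f := by rintro rfl; exact hzz rfl
    obtain ⟨v, _, hv'⟩ := hend e s (hmeet e f hef s t hs hs' ht ht' (hp.trans hp'.symm)).1
    exact ⟨v, hv'.symm.trans hp⟩

/-- Segments on different sides of a horizontal line meet at most in common end points, if none of
them lies on that line. -/
theorem apart_of_le {a b c d a' b' c' d' m τ : ℝ} (h1 : b ≤ τ) (h2 : d ≤ τ) (h3 : b < τ ∨ d < τ)
    (h4 : τ ≤ b') (h5 : τ ≤ d') (h6 : τ < b' ∨ τ < d') : Apart a b c d a' b' c' d' m := by
  intro s t hs hs' ht ht' e _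
  have u1 : b + s * (d - b) ≤ τ := by
    nlinarith [mul_nonneg hs (sub_nonneg.2 h2), mul_nonneg (sub_nonneg.2 hs') (sub_nonneg.2 h1)]
  have u2 : τ ≤ b' + t * (d' - b') := by
    nlinarith [mul_nonneg ht (sub_nonneg.2 h5), mul_nonneg (sub_nonneg.2 ht') (sub_nonneg.2 h4)]
  constructor
  · by_contra hcon
    push Not at hcon
    have s0 := lt_of_le_of_ne hs hcon.1.symm
    have s1 := lt_of_le_of_ne hs' hcon.2
    rcases h3 with h3 | h3 <;>
    nlinarith [mul_nonneg hs (sub_nonneg.2 h2), mul_nonneg (sub_nonneg.2 hs') (sub_nonneg.2 h1),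
      mul_pos (sub_pos.2 s1) (sub_pos.2 h3), mul_pos s0 (sub_pos.2 h3)]
  · by_contra hcon
    push Not at hcon
    have s0 := lt_of_le_of_ne ht hcon.1.symm
    have s1 := lt_of_le_of_ne ht' hcon.2
    rcases h6 with h6 | h6 <;>
    nlinarith [mul_nonneg ht (sub_nonneg.2 h5), mul_nonneg (sub_nonneg.2 ht') (sub_nonneg.2 h4),
      mul_pos (sub_pos.2 s1) (sub_pos.2 h6), mul_pos s0 (sub_pos.2 h6)]

/-- Segments separated by a vertical gap in height are disjoint. -/
theorem apart_of_lt {a b c d a' b' c' d' m : ℝ} (h1 : b < b') (h2 : b < d') (h3 : d < b')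
    (h4 : d < d') : Apart a b c d a' b' c' d' m := by
  refine apart_of_le (τ := (max b d + min b' d') / 2) ?_ ?_ ?_ ?_ ?_ ?_ <;>
  · have := max_lt (lt_min h1 h2) (lt_min h3 h4)
    first
      | linarith [le_max_left b d, le_max_right b d, min_le_left b' d', min_le_right b' d']
      | left; linarith [le_max_left b d, le_max_right b d, min_le_left b' d', min_le_right b' d']

theorem Apart.transpose {a b c d a' b' c' d' : ℝ} (h : Apart b a d c b' a' d' c' 0) :
    Apart a b c d a' b' c' d' 0 := by
  intro s t hs hs' ht ht' h1 h2
  exact h s t hs hs' ht ht' (by linarith) (by linarith)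

section Separation

/-- The point `(x, y)` is strictly to the left of the line from `(a, b)` to `(c, d)`. The terms of
the cross product are sorted by sign, so that natural numbers suffice. -/
def leftOf (a b c d x y : ℕ) : Bool :=
  Nat.blt (c * b + a * y + d * x) (c * y + d * a + b * x)

/-- The point `(x, y)` is strictly to the right of the line from `(a, b)` to `(c, d)`. -/
def rightOf (a b c d x y : ℕ) : Bool :=
  Nat.blt (c * y + d * a + b * x) (c * b + a * y + d * x)

theorem leftOf_iff {a b c d x y : ℕ} : leftOf a b c d x y = true ↔
    0 < ((c : ℝ) - a) * (y - b) - (d - b) * (x - a) := by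
  rw [leftOf, Nat.blt_eq]
  rw [← Nat.cast_lt (α := ℝ)]
  push_cast
  constructor <;> intro h <;> linarith

theorem rightOf_iff {a b c d x y : ℕ} : rightOf a b c d x y = true ↔
    ((c : ℝ) - a) * (y - b) - (d - b) * (x - a) < 0 := by
  rw [rightOf, Nat.blt_eq]
  rw [← Nat.cast_lt (α := ℝ)]
  push_cast
  constructor <;> intro h <;> linarith

/-- The second segment lies strictly on one side of the line through the first one. -/
def oneSide (a b c d a' b' c' d' : ℕ) : Bool :=
  or (and (leftOf a b c d a' b') (leftOf a b c d c' d'))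
    (and (rightOf a b c d a' b') (rightOf a b c d c' d'))

/-- `(a', b')` is an end point of the segment from `(a, b)` to `(c, d)`, and `(c', d')` is not on
the line through it. -/
def hinge (a b c d a' b' c' d' : ℕ) : Bool :=
  and (or (and (Nat.beq a a') (Nat.beq b b')) (and (Nat.beq c a') (Nat.beq d b')))
    (or (leftOf a b c d c' d') (rightOf a b c d c' d'))

/-- A test that implies `Apart` without a shift: the segments are separated horizontally, or one of
them lies on one side of the other, or they have a common end and different directions. -/
def sepTest (a b c d a' b' c' d' : ℕ) : Bool :=
  or (or (and (and (Nat.blt a a') (Nat.blt a c')) (and (Nat.blt c a') (Nat.blt c c')))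
      (and (and (Nat.blt a' a) (Nat.blt a' c)) (and (Nat.blt c' a) (Nat.blt c' c))))
    (or (or (oneSide a b c d a' b' c' d') (oneSide a' b' c' d' a b c d))
      (or (hinge a b c d a' b' c' d') (hinge a b c d c' d' a' b')))

theorem apart_of_oneSide {a b c d a' b' c' d' : ℕ} (h : oneSide a b c d a' b' c' d' = true) :
    Apart a b c d a' b' c' d' 0 := by
  intro s t _ _ ht ht' h1 h2
  exfalso
  have e : (1 - t) * (((c : ℝ) - a) * (b' - b) - (d - b) * (a' - a)) +
      t * (((c : ℝ) - a) * (d' - b) - (d - b) * (c' - a)) = 0 := by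
    linear_combination -((c : ℝ) - a) * h1 + ((d : ℝ) - b) * h2
  simp only [oneSide, Bool.or_eq_true, Bool.and_eq_true, leftOf_iff, rightOf_iff] at h
  rcases h with ⟨h3, h4⟩ | ⟨h3, h4⟩
  · rcases ht.eq_or_lt with rfl | ht0
    · linarith
    · nlinarith [mul_pos ht0 h4, mul_nonneg (sub_nonneg.2 ht') h3.le]
  · rcases ht.eq_or_lt with rfl | ht0
    · linarith
    · nlinarith [mul_neg_of_pos_of_neg ht0 h4,
        mul_nonpos_of_nonneg_of_nonpos (sub_nonneg.2 ht') h3.le]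

theorem apart_of_hinge {a b c d a' b' c' d' : ℕ} (h : hinge a b c d a' b' c' d' = true) :
    Apart a b c d a' b' c' d' 0 := by
  intro s t _ _ ht ht' h1 h2
  have e : (1 - t) * (((c : ℝ) - a) * (b' - b) - (d - b) * (a' - a)) +
      t * (((c : ℝ) - a) * (d' - b) - (d - b) * (c' - a)) = 0 := by
    linear_combination -((c : ℝ) - a) * h1 + ((d : ℝ) - b) * h2
  simp only [hinge, Bool.or_eq_true, Bool.and_eq_true, leftOf_iff, rightOf_iff, Nat.beq_eq] at h
  obtain ⟨h3, h4⟩ := h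
  have h5 : ((c : ℝ) - a) * (d' - b) - (d - b) * (c' - a) ≠ 0 := by
    rcases h4 with h4 | h4
    · exact h4.ne'
    · exact h4.ne
  have h6 : ((c : ℝ) - a) * (b' - b) - (d - b) * (a' - a) = 0 := by
    rcases h3 with ⟨rfl, rfl⟩ | ⟨rfl, rfl⟩ <;> ring
  rw [h6, mul_zero, zero_add] at e
  have ht0 : t = 0 := (mul_eq_zero.1 e).resolve_right h5
  subst ht0
  refine ⟨?_, Or.inl rfl⟩
  by_contra hs
  push Not at hs
  apply h5
  rcases h3 with ⟨rfl, rfl⟩ | ⟨rfl, rfl⟩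
  · have hc : (c : ℝ) - a = 0 := by
      have : s * ((c : ℝ) - a) = 0 := by linarith
      exact (mul_eq_zero.1 this).resolve_left hs.1
    have hd : (d : ℝ) - b = 0 := by
      have : s * ((d : ℝ) - b) = 0 := by linarith
      exact (mul_eq_zero.1 this).resolve_left hs.1
    rw [hc, hd]; ring
  · have hs1 : s - 1 ≠ 0 := sub_ne_zero.2 hs.2
    have hc : (c : ℝ) - a = 0 := by
      have : (s - 1) * ((c : ℝ) - a) = 0 := by linarith
      exact (mul_eq_zero.1 this).resolve_left hs1
    have hd : (d : ℝ) - b = 0 := by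
      have : (s - 1) * ((d : ℝ) - b) = 0 := by linarith
      exact (mul_eq_zero.1 this).resolve_left hs1
    rw [hc, hd]; ring

theorem Apart.swap {a b c d a' b' c' d' m : ℝ} (h : Apart a b c d a' b' c' d' m) :
    Apart a b c d c' d' a' b' m := by
  intro s t hs hs' ht ht' h1 h2
  have := h s (1 - t) hs hs' (by linarith) (by linarith) (by linarith) (by linarith)
  refine ⟨this.1, ?_⟩
  rcases this.2 with h3 | h3
  · right; linarith
  · left; linarith

theorem apart_of_sepTest {a b c d a' b' c' d' : ℕ} (h : sepTest a b c d a' b' c' d' = true) :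
    Apart a b c d a' b' c' d' 0 := by
  simp only [sepTest, Bool.or_eq_true] at h
  rcases h with (h | h) | ((h | h) | (h | h))
  · simp only [Bool.and_eq_true, Nat.blt_eq] at h
    obtain ⟨⟨h1, h2⟩, h3, h4⟩ := h
    exact (apart_of_lt (Nat.cast_lt.2 h1) (Nat.cast_lt.2 h2) (Nat.cast_lt.2 h3)
      (Nat.cast_lt.2 h4)).transpose
  · simp only [Bool.and_eq_true, Nat.blt_eq] at h
    obtain ⟨⟨h1, h2⟩, h3, h4⟩ := h
    have := (apart_of_lt (m := 0) (Nat.cast_lt (α := ℝ).2 h1) (Nat.cast_lt.2 h2)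
      (Nat.cast_lt.2 h3) (Nat.cast_lt.2 h4) (a := b') (c := d') (a' := b) (c' := d)).transpose.symm
    simpa using this
  · exact apart_of_oneSide h
  · simpa using (apart_of_oneSide h).symm
  · exact apart_of_hinge h
  · exact (apart_of_hinge h).swap

end Separation

/-! ### Cells and chains of cells -/

/-- The entry `i` of a table whose entries are the digits of `T` in base `2 ^ w`. It is written with
the functions on `ℕ` that the kernel evaluates directly on literals. -/
def digit (w T i : ℕ) : ℕ := Nat.mod (Nat.shiftRight T (Nat.mul w i)) (Nat.pow 2 w)

/-- Where a dart of a cell leads: to another dart of the same cell, or out of the cell. -/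
inductive Loc (n : ℕ) where
  | inn (v : Fin n) (i : Fin 3)
  | left (t : Fin 5)
  | right (t : Fin 5)
  deriving DecidableEq

/-- A piece of a cubic plane map that lies between two closed curves (or inside or outside one),
each of which crosses five edges: the left and the right danglers. The data are tables, to be read
with `digit`, of width `12` for `ex` and `10` for the others. The dart `i` at the vertex `v` has the
number `3 * v + i`; the corner between the darts `i` and `i + 1` has the same number. -/
structure Cell where
  /-- one less than the number of vertices -/
  m : ℕ
  /-- one less than the number of faces, without those that are cut by the right curve -/
  f : ℕ
  /-- the opposite darts; with `n` vertices, `3 * n + t` and `3 * n + 5 + t` stand for the left and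
  the right dangler `t` -/
  opp : ℕ
  /-- the darts that belong to the left danglers -/
  zl : ℕ
  /-- the darts that belong to the right danglers -/
  br : ℕ
  /-- the face at each corner; the faces cut by the right curve have the last numbers, and those cut
  by the left curve, if there is one, are `0, …, 4` -/
  lab : ℕ
  /-- horizontal coordinates of the vertices in a drawing on a cylinder -/
  X : ℕ
  /-- vertical coordinates of the vertices -/
  Y : ℕ
  /-- horizontal coordinate of the other end of each edge, shifted by the circumference -/
  ex : ℕ
  /-- the height of the drawing -/
  top : ℕ

namespace Cell

variable (c : Cell)

/-- The number of vertices. -/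
abbrev n : ℕ := c.m + 1

/-- The number of faces, without those cut by the right curve. -/
abbrev nf : ℕ := c.f + 1

/-- The code of the place where the dart `h` leads. -/
def code (h : ℕ) : ℕ := digit 10 c.opp h

/-- Where the dart `i` at `v` leads. -/
def loc (v : Fin c.n) (i : Fin 3) : Loc c.n :=
  if c.code (3 * v + i) < 3 * c.n then
    .inn (Fin.ofNat _ (c.code (3 * v + i) / 3)) (Fin.ofNat 3 (c.code (3 * v + i)))
  else if c.code (3 * v + i) < 3 * c.n + 5 then .left (Fin.ofNat 5 (c.code (3 * v + i) - 3 * c.n))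
  else .right (Fin.ofNat 5 (c.code (3 * v + i) - 3 * c.n - 5))

/-- The vertex at a dart given by its number. -/
def dartV (h : ℕ) : Fin c.n := Fin.ofNat _ (h / 3)

/-- The dart of the left dangler `t`. -/
def lv (t : Fin 5) : Fin c.n := c.dartV (digit 10 c.zl t)

/-- The slot of the left dangler `t`. -/
def ls (t : Fin 5) : Fin 3 := Fin.ofNat 3 (digit 10 c.zl t)

/-- The vertex at the right dangler `t`. -/
def rv (t : Fin 5) : Fin c.n := c.dartV (digit 10 c.br t)

/-- The slot of the right dangler `t`. -/
def rs (t : Fin 5) : Fin 3 := Fin.ofNat 3 (digit 10 c.br t)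

/-- The face at a corner: a face of the cell, or one that is cut by the right curve. -/
def face (v : Fin c.n) (i : Fin 3) : Fin c.nf ⊕ Fin 5 :=
  if digit 10 c.lab (3 * v + i) < c.nf then .inl (Fin.ofNat _ (digit 10 c.lab (3 * v + i)))
  else .inr (Fin.ofNat 5 (digit 10 c.lab (3 * v + i) - c.nf))

/-- The face cut by the left curve between the danglers `t` and `t + 1`. -/
def leftFace (t : Fin 5) : Fin c.nf := Fin.ofNat _ t

/-- Consistency of the darts at one vertex. -/
def DartOK (l r : Bool) (v : Fin c.n) (i : Fin 3) : Prop :=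
  match c.loc v i with
  | .inn w j => c.loc w j = .inn v i ∧ w ≠ v ∧ c.face w (j - 1) = c.face v i
  | .left t => l = true ∧ c.lv t = v ∧ c.ls t = i
  | .right t => r = true ∧ c.rv t = v ∧ c.rs t = i

/-- Two darts at a vertex lead to different vertices. -/
def SimpleAt (v : Fin c.n) (i j : Fin 3) : Prop :=
  i = j ∨ match c.loc v i, c.loc v j with
  | .inn w _, .inn w' _ => w ≠ w'
  | .left _, .left _ => False
  | .right _, .right _ => False
  | _, _ => True

instance (l r : Bool) (v : Fin c.n) (i : Fin 3) : Decidable (c.DartOK l r v i) := by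
  unfold DartOK
  split <;> infer_instance

instance (v : Fin c.n) (i j : Fin 3) : Decidable (c.SimpleAt v i j) := by
  unfold SimpleAt
  split <;> infer_instance

/-- The tables describe a cell, with left danglers if `l` and right danglers if `r`. -/
structure Valid (l r : Bool) : Prop where
  dart : ∀ v i, c.DartOK l r v i
  simple : ∀ v i j, c.SimpleAt v i j
  left : l = true → ∀ t, c.loc (c.lv t) (c.ls t) = .left t ∧
    c.face (c.lv t) (c.ls t - 1) = .inl (c.leftFace t) ∧
    c.face (c.lv t) (c.ls t) = .inl (c.leftFace (t - 1))
  right : r = true → ∀ t, c.loc (c.rv t) (c.rs t) = .right t ∧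
    c.face (c.rv t) (c.rs t) = .inr t ∧ c.face (c.rv t) (c.rs t - 1) = .inr (t - 1)
  face_right : r = false → ∀ v i, (c.face v i).isLeft = true
  face_surj : ∀ x : Fin c.nf, ∃ v i, c.face v i = .inl x

end Cell

/-- The vertices of the chain of the cells `c 0, …, c (m - 1)`. -/
abbrev ChainV (c : ℕ → Cell) (m : ℕ) : Type := (j : Fin m) × Fin (c j).n

/-- The faces of the chain. A face that is cut by a curve between two cells is attributed to the
right one of them. -/
abbrev ChainF (c : ℕ → Cell) (m : ℕ) : Type := (j : Fin m) × Fin (c j).nf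

/-- The cells `c 0, …, c (m - 1)` can be joined, each one to the next along its right curve. -/
def IsCellChain (c : ℕ → Cell) (m : ℕ) : Prop :=
  ∀ j, j < m → (c j).Valid (decide (0 < j)) (decide (j + 1 < m))

namespace CellChain

variable {c : ℕ → Cell} {m : ℕ}

/-- A vertex of a chain. -/
abbrev vtx {j : ℕ} (hj : j < m) (v : Fin (c j).n) : ChainV c m := ⟨⟨j, hj⟩, v⟩

/-- A face of a chain. -/
abbrev fc {j : ℕ} (hj : j < m) (x : Fin (c j).nf) : ChainF c m := ⟨⟨j, hj⟩, x⟩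

/-- The other dart of the same edge in a chain. -/
def opp (d : ChainV c m × Fin 3) : ChainV c m × Fin 3 :=
  match (c d.1.1).loc d.1.2 d.2 with
  | .inn w i => (⟨d.1.1, w⟩, i)
  | .left t => if 0 < d.1.1.1 then
      (vtx (j := d.1.1 - 1) (by omega) ((c (d.1.1 - 1)).rv t), (c (d.1.1 - 1)).rs t) else d
  | .right t => if h : d.1.1 + 1 < m then (vtx h ((c (d.1.1 + 1)).lv t), (c (d.1.1 + 1)).ls t)
      else d

/-- The face at a corner of a chain. -/
def face (d : ChainV c m × Fin 3) : ChainF c m :=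
  match (c d.1.1).face d.1.2 d.2 with
  | .inl x => ⟨d.1.1, x⟩
  | .inr t => if h : d.1.1 + 1 < m then fc h ((c (d.1.1 + 1)).leftFace t) else ⟨d.1.1, 0⟩

variable {j : ℕ} (hj : j < m) {v w : Fin (c j).n} {i i' : Fin 3} {t : Fin 5}

theorem opp_inn (h : (c j).loc v i = .inn w i') :
    opp (vtx hj v, i) = (vtx (c := c) hj w, i') := by
  simp only [opp, h]

theorem opp_right (hj' : j + 1 < m) (h : (c j).loc v i = .right t) :
    opp (vtx hj v, i) = (vtx (c := c) hj' ((c (j + 1)).lv t), (c (j + 1)).ls t) := by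
  simp only [opp, h]
  rw [dif_pos hj']

theorem opp_left {j : ℕ} (hj : j < m) (hj' : j + 1 < m) {v : Fin (c (j + 1)).n} {i : Fin 3}
    {t : Fin 5} (h : (c (j + 1)).loc v i = .left t) :
    opp (vtx hj' v, i) = (vtx (c := c) hj ((c j).rv t), (c j).rs t) := by
  simp only [opp, h]
  rw [if_pos (Nat.succ_pos j)]
  rfl

theorem face_inl {x : Fin (c j).nf} (h : (c j).face v i = .inl x) :
    face (vtx hj v, i) = fc (c := c) hj x := by
  simp only [face, h]

theorem face_inr (hj' : j + 1 < m) (h : (c j).face v i = .inr t) :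
    face (vtx hj v, i) = fc (c := c) hj' ((c (j + 1)).leftFace t) := by
  simp only [face, h]
  rw [dif_pos hj']

/-- A dart of a chain stays in its cell, or leads to the next or to the previous one. -/
theorem cases_loc {j : ℕ} (hj : j < m) (hc : IsCellChain c m) (v : Fin (c j).n) (i : Fin 3) :
    (∃ w i', (c j).loc v i = .inn w i' ∧ (c j).loc w i' = .inn v i ∧ w ≠ v ∧
      (c j).face w (i' - 1) = (c j).face v i) ∨
    (∃ t, j + 1 < m ∧ (c j).loc v i = .right t ∧ (c j).rv t = v ∧ (c j).rs t = i) ∨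
    (∃ j' t, j = j' + 1 ∧ (c j).loc v i = .left t ∧ (c j).lv t = v ∧ (c j).ls t = i) := by
  have h := (hc j hj).dart v i
  unfold Cell.DartOK at h
  cases hl : (c j).loc v i with
  | inn w i' =>
    rw [hl] at h
    exact Or.inl ⟨w, i', rfl, h.1, h.2.1, h.2.2⟩
  | left t =>
    rw [hl] at h
    have : 0 < j := of_decide_eq_true h.1
    exact Or.inr (Or.inr ⟨j - 1, t, by omega, rfl, h.2.1, h.2.2⟩)
  | right t =>
    rw [hl] at h
    exact Or.inr (Or.inl ⟨t, of_decide_eq_true h.1, rfl, h.2.1, h.2.2⟩)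

theorem left_ok (hc : IsCellChain c m) {j : ℕ} (hj' : j + 1 < m) (t : Fin 5) :
    (c (j + 1)).loc ((c (j + 1)).lv t) ((c (j + 1)).ls t) = .left t ∧
    (c (j + 1)).face ((c (j + 1)).lv t) ((c (j + 1)).ls t - 1) = .inl ((c (j + 1)).leftFace t) ∧
    (c (j + 1)).face ((c (j + 1)).lv t) ((c (j + 1)).ls t) =
      .inl ((c (j + 1)).leftFace (t - 1)) :=
  (hc (j + 1) hj').left (by simp) t

theorem right_ok (hc : IsCellChain c m) (hj' : j + 1 < m) (t : Fin 5) :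
    (c j).loc ((c j).rv t) ((c j).rs t) = .right t ∧
    (c j).face ((c j).rv t) ((c j).rs t) = .inr t ∧
    (c j).face ((c j).rv t) ((c j).rs t - 1) = .inr (t - 1) :=
  (hc j (by omega)).right (by simpa using hj') t

end CellChain

open CellChain

/-- The rotation system of a chain. -/
def chainMap {c : ℕ → Cell} {m : ℕ} (hc : IsCellChain c m) : CubicMap (ChainV c m) where
  opp := opp
  opp_opp := by
    rintro ⟨⟨⟨j, hj⟩, v⟩, i⟩
    rcases cases_loc hj hc v i with ⟨w, i', h1, h2, -, -⟩ | ⟨t, hj', h1, h2, h3⟩ |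
      ⟨j', t, rfl, h1, h2, h3⟩
    · rw [opp_inn hj h1, opp_inn hj h2]
    · rw [opp_right hj hj' h1, opp_left hj hj' (left_ok hc hj' t).1, h2, h3]
    · have hj'' : j' < m := by omega
      rw [opp_left hj'' hj h1, opp_right hj'' hj (right_ok hc hj t).1, h2, h3]
  opp_ne := by
    rintro ⟨⟨⟨j, hj⟩, v⟩, i⟩
    rcases cases_loc hj hc v i with ⟨w, i', h1, h2, h3, -⟩ | ⟨t, hj', h1, h2, h3⟩ |
      ⟨j', t, rfl, h1, h2, h3⟩
    · rw [opp_inn hj h1]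
      intro h
      exact h3 (eq_of_heq (Sigma.mk.inj h).2)
    · rw [opp_right hj hj' h1]
      intro h
      have := congrArg (fun x : ChainV c m => x.1.1) h
      simp at this
    · have hj'' : j' < m := by omega
      rw [opp_left hj'' hj h1]
      intro h
      have := congrArg (fun x : ChainV c m => x.1.1) h
      simp at this
  opp_inj := by
    rintro ⟨⟨j, hj⟩, v⟩ i i' h
    have hs := (hc j hj).simple v i i'
    unfold Cell.SimpleAt at hs
    refine hs.resolve_right fun hs => ?_
    rcases cases_loc hj hc v i with ⟨w, k, h1, -⟩ | ⟨t, hj', h1, -⟩ | ⟨j', t, rfl, h1, -⟩ <;>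
    rcases cases_loc hj hc v i' with ⟨w', k', h2, -⟩ | ⟨t', hj2, h2, -⟩ | ⟨j2, t', h3, h2, -⟩ <;>
    rw [h1, h2] at hs <;> simp only at hs
    · rw [opp_inn hj h1, opp_inn hj h2] at h
      exact hs (eq_of_heq (Sigma.mk.inj h).2)
    · rw [opp_inn hj h1, opp_right hj hj2 h2] at h
      have := congrArg (fun x : ChainV c m => x.1.1) h
      simp at this
    · subst h3
      rw [opp_inn hj h1, opp_left (by omega) hj h2] at h
      have := congrArg (fun x : ChainV c m => x.1.1) h
      simp at this
    · rw [opp_right hj hj' h1, opp_inn hj h2] at h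
      have := congrArg (fun x : ChainV c m => x.1.1) h
      simp at this
    · subst h3
      rw [opp_right hj hj' h1, opp_left (by omega) hj h2] at h
      have := congrArg (fun x : ChainV c m => x.1.1) h
      simp at this
      omega
    · rw [opp_left (by omega) hj h1, opp_inn hj h2] at h
      have := congrArg (fun x : ChainV c m => x.1.1) h
      simp at this
    · rw [opp_left (by omega) hj h1, opp_right hj hj2 h2] at h
      have := congrArg (fun x : ChainV c m => x.1.1) h
      simp at this
      omega

namespace CellChain

variable {c : ℕ → Cell} {m : ℕ}

theorem face_opp (hc : IsCellChain c m) (d : ChainV c m × Fin 3) :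
    face (((chainMap hc).opp d).1, ((chainMap hc).opp d).2 - 1) = face d := by
  change face ((opp d).1, (opp d).2 - 1) = face d
  obtain ⟨⟨⟨j, hj⟩, v⟩, i⟩ := d
  rcases cases_loc hj hc v i with ⟨w, i', h1, h2, h3, h4⟩ | ⟨t, hj', h1, rfl, rfl⟩ |
    ⟨j', t, rfl, h1, rfl, rfl⟩
  · rw [opp_inn hj h1]
    rcases hf : (c j).face v i with x | t
    · rw [face_inl hj hf, face_inl hj (h4.trans hf)]
    · simp only [face, hf, h4.trans hf]
  · rw [opp_right hj hj' h1, face_inl hj' (left_ok hc hj' t).2.1,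
      face_inr hj hj' (right_ok hc hj' t).2.1]
  · have hj'' : j' < m := by omega
    rw [opp_left hj'' hj h1, face_inr hj'' hj (right_ok hc hj t).2.2,
      face_inl hj (left_ok hc hj t).2.2]

theorem face_surjective (hc : IsCellChain c m) : Function.Surjective (face (c := c) (m := m)) := by
  rintro ⟨⟨j, hj⟩, x⟩
  obtain ⟨v, i, h⟩ := (hc j hj).face_surj x
  exact ⟨(vtx hj v, i), face_inl hj h⟩

theorem card_chainV : Fintype.card (ChainV c m) = ∑ j : Fin m, (c j).n := by
  rw [Fintype.card_sigma]
  simp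

theorem card_chainF : Fintype.card (ChainF c m) = ∑ j : Fin m, (c j).nf := by
  rw [Fintype.card_sigma]
  simp

end CellChain

/-! ### Obstructions in chains -/

namespace Cell

variable (c : Cell)

/-- The number of corners at a face, or at a face cut by the right curve. -/
def corners (s : Fin c.nf ⊕ Fin 5) : ℕ :=
  ∑ v : Fin c.n, ∑ i : Fin 3, if c.face v i = s then 1 else 0

/-- The number of corners at a face, at the vertices below `z`. -/
def cornersBelow (z : ℕ) (s : Fin c.nf ⊕ Fin 5) : ℕ :=
  ∑ v : Fin c.n, ∑ i : Fin 3, if (v : ℕ) < z ∧ c.face v i = s then 1 else 0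

/-- The face number `b + t` of a cell. -/
def faceAt (b : ℕ) (t : Fin 5) : Fin c.nf := Fin.ofNat _ (b + t)

/-- The vertex of the dart `t` of a table of five darts. -/
def cutV (T : ℕ) (t : Fin 5) : Fin c.n := c.dartV (digit 10 T t)

/-- The slot of the dart `t` of a table of five darts. -/
def cutS (T : ℕ) (t : Fin 5) : Fin 3 := Fin.ofNat 3 (digit 10 T t)

/-- The dart leads to a vertex below `z`, or is in the table `T`. -/
def StaysAt (z T : ℕ) (v : Fin c.n) (i : Fin 3) : Prop :=
  match c.loc v i with
  | .inn w _ => (w : ℕ) < z ∨ ∃ t, c.cutV T t = v ∧ cutS T t = i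
  | _ => False

/-- The dart leads to a vertex not below `z`. -/
def LeavesAt (z : ℕ) (v : Fin c.n) (i : Fin 3) : Prop :=
  match c.loc v i with
  | .inn w _ => z ≤ (w : ℕ)
  | _ => False

instance (z T : ℕ) (v : Fin c.n) (i : Fin 3) : Decidable (c.StaysAt z T v i) := by
  unfold StaysAt
  split <;> infer_instance

instance (z : ℕ) (v : Fin c.n) (i : Fin 3) : Decidable (c.LeavesAt z v i) := by
  unfold LeavesAt
  split <;> infer_instance

/-- The part of `CubicMap.IsObstruction` that concerns a cell whose first `z` vertices are the set
`Z`, with the faces below `b` in place of `I`, the faces `b + t` in place of `C t` and the table `T`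
of the darts that leave `Z`. -/
structure Obstructs (z b T : ℕ) : Prop where
  le : b + 5 ≤ c.nf
  lt : ∀ t, (c.cutV T t : ℕ) < z
  leaves : ∀ t, c.LeavesAt z (c.cutV T t) (cutS T t)
  inj : ∀ s t, c.cutV T s = c.cutV T t → s = t
  stays : ∀ v : Fin c.n, (v : ℕ) < z → ∀ i, c.StaysAt z T v i
  face : ∀ t, c.face (c.cutV T t) (cutS T t) = .inl (c.faceAt b t)
  face_prev : ∀ t, c.face (c.cutV T t) (cutS T t - 1) = .inl (c.faceAt b (t - 1))
  face_lt : ∀ v : Fin c.n, (v : ℕ) < z → ∀ i,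
    Sum.elim (fun x : Fin c.nf => (x : ℕ)) (fun _ => b + 5) (c.face v i) < b + 5
  face_ge : ∀ v : Fin c.n, z ≤ (v : ℕ) → ∀ i,
    b ≤ Sum.elim (fun x : Fin c.nf => (x : ℕ)) (fun _ => b) (c.face v i)
  corners : ∀ x : Fin c.nf, c.corners (.inl x) % 3 =
    (2 + if (x : ℕ) = b ∨ (x : ℕ) = b + 1 ∨ (x : ℕ) = b + 3 then 1 else 0) % 3
  cornersBelow : ∀ x : Fin c.nf, c.cornersBelow z (.inl x) % 3 =
    (if (x : ℕ) < b then 2 else if (x : ℕ) = b ∨ (x : ℕ) = b + 1 then 2 else 0) % 3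
  card : z % 3 = 2
  card_le : z ≤ c.n

theorem Obstructs.exists_face {c : Cell} {z b T : ℕ} (ho : c.Obstructs z b T) (v : Fin c.n)
    (hv : (v : ℕ) < z) (i : Fin 3) : ∃ x, c.face v i = .inl x ∧ (x : ℕ) < b + 5 := by
  have h := ho.face_lt v hv i
  rcases hf : c.face v i with x | t
  · rw [hf] at h
    exact ⟨x, rfl, h⟩
  · rw [hf] at h
    exact absurd h (lt_irrefl _)

variable {c} in
theorem face_eq_inl_iff {v : Fin c.n} {i : Fin 3} {x : Fin c.nf} :
    c.face v i = .inl x ↔ digit 10 c.lab (3 * v + i) = x := by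
  unfold face
  split_ifs with h
  · rw [Sum.inl.injEq, Fin.ext_iff]
    exact ⟨fun h' => by rw [← h']; exact (Nat.mod_eq_of_lt h).symm,
      fun h' => by rw [← h']; exact Nat.mod_eq_of_lt h⟩
  · simp only [false_iff]
    have := x.2
    omega

/-- The number of corners with the label `x` at the vertices below `z`. This form is fast to
evaluate. -/
def labCount (z x : ℕ) : ℕ :=
  Nat.rec 0 (fun h k => cond (Nat.beq (digit 10 c.lab h) x) k.succ k) (3 * z)

theorem labCount_eq_sum (x : ℕ) : ∀ z, c.labCount z x =
    ∑ v ∈ Finset.range z, ∑ i ∈ Finset.range 3, if digit 10 c.lab (3 * v + i) = x then 1 else 0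
  | 0 => rfl
  | z + 1 => by
    have hstep : ∀ h k : ℕ, cond (Nat.beq (digit 10 c.lab h) x) k.succ k =
        k + if digit 10 c.lab h = x then 1 else 0 := by
      intro h k
      by_cases hx : digit 10 c.lab h = x
      · rw [if_pos hx, show Nat.beq (digit 10 c.lab h) x = true by rwa [Nat.beq_eq], cond_true]
      · rw [if_neg hx, Bool.eq_false_iff.2 (mt Nat.eq_of_beq_eq_true hx), cond_false, Nat.add_zero]
    rw [Finset.sum_range_succ, ← labCount_eq_sum x z, Finset.sum_range_succ, Finset.sum_range_succ,
      Finset.sum_range_one, ← add_assoc, ← add_assoc, ← hstep, ← hstep, ← hstep]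
    rfl

theorem cornersBelow_eq_labCount {z : ℕ} (hz : z ≤ c.n) (x : Fin c.nf) :
    c.cornersBelow z (.inl x) = c.labCount z x := by
  let g : ℕ → ℕ := fun v => if v < z then
    ∑ i ∈ Finset.range 3, if digit 10 c.lab (3 * v + i) = x then 1 else 0 else 0
  have h : ∀ v : Fin c.n,
      (∑ i : Fin 3, if (v : ℕ) < z ∧ c.face v i = .inl x then 1 else 0) = g v := by
    intro v
    simp only [g, face_eq_inl_iff]
    rw [Finset.sum_range]
    split_ifs with hv <;> simp [hv]
  rw [cornersBelow, Finset.sum_congr rfl fun v _ => h v, Fin.sum_univ_eq_sum_range g,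
    labCount_eq_sum]
  refine (Finset.sum_subset (Finset.range_subset_range.2 hz) fun v _ hv => ?_).symm.trans
    (Finset.sum_congr rfl fun v hv => if_pos (Finset.mem_range.1 hv))
  exact if_neg (by simpa using hv)

theorem corners_eq_labCount (x : Fin c.nf) : c.corners (.inl x) = c.labCount c.n x := by
  rw [← cornersBelow_eq_labCount c le_rfl]
  refine Finset.sum_congr rfl fun v _ => Finset.sum_congr rfl fun i _ => if_congr ?_ rfl rfl
  exact (and_iff_right v.2).symm

theorem faceAt_val {c : Cell} {b : ℕ} (h : b + 5 ≤ c.nf) (t : Fin 5) :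
    (c.faceAt b t : ℕ) = b + t := by
  simp only [faceAt, Fin.ofNat]
  exact Nat.mod_eq_of_lt (by omega)

end Cell

namespace CellChain

variable {c : ℕ → Cell} {m : ℕ}

theorem face_eq_iff (hc : IsCellChain c m) {j : ℕ} (hj : j < m) (v : Fin (c j).n) (i : Fin 3)
    (x : Fin (c j).nf) : face (vtx hj v, i) = fc (c := c) hj x ↔ (c j).face v i = .inl x := by
  rcases hf : (c j).face v i with y | t
  · rw [face_inl hj hf]
    constructor
    · intro h
      rw [eq_of_heq (Sigma.mk.inj h).2]
    · intro h
      rw [Sum.inl.inj h]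
  · constructor
    · intro h
      by_cases hj' : j + 1 < m
      · rw [face_inr hj hj' hf] at h
        have := congrArg (fun x : ChainF c m => x.1.1) h
        simp at this
      · have := (hc j hj).face_right (by simpa using hj') v i
        rw [hf] at this
        simp at this
    · intro h
      simp at h

/-- The corners at a face that is cut by a curve between two cells are, modulo `3`, those in the
right one of the two. -/
theorem card_fiber (hc : IsCellChain c m)
    (hr : ∀ j, j + 1 < m → ∀ t, (c j).corners (.inr t) % 3 = 0) {j : ℕ} (hj : j < m)
    (x : Fin (c j).nf) :
    (Finset.univ.filter fun d : ChainV c m × Fin 3 => face d = fc hj x).card % 3 =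
      (c j).corners (.inl x) % 3 := by
  rw [Finset.card_filter, Fintype.sum_prod_type, Fintype.sum_sigma,
    ← Finset.add_sum_erase _ _ (Finset.mem_univ (⟨j, hj⟩ : Fin m))]
  have h1 : (∑ v : Fin (c j).n, ∑ i : Fin 3,
      if face (vtx (c := c) hj v, i) = fc hj x then 1 else 0) = (c j).corners (.inl x) := by
    refine Finset.sum_congr rfl fun v _ => Finset.sum_congr rfl fun i _ => ?_
    simp only [face_eq_iff hc hj v i x]
  refine (congrArg (fun a => (a + _) % 3) h1).trans ?_
  refine (Nat.add_mod _ _ _).trans ?_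
  rw [Nat.mod_eq_zero_of_dvd (n := Finset.sum _ _), Nat.add_zero, Nat.mod_mod]
  refine Finset.dvd_sum fun j' hj' => ?_
  obtain ⟨j', hj2⟩ := j'
  have hne : j' ≠ j := by
    rintro rfl
    simp at hj'
  have h2 : ∀ (v : Fin (c j').n) (i : Fin 3),
      (if face (vtx (c := c) hj2 v, i) = fc hj x then 1 else 0) =
      ∑ t : Fin 5, if (c j').face v i = .inr t then
        (if ∃ h : j' + 1 < m, fc (c := c) h ((c (j' + 1)).leftFace t) = fc hj x then 1 else 0)
        else 0 := by
    intro v i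
    rcases hf : (c j').face v i with y | t
    · rw [face_inl hj2 hf, if_neg]
      · simp
      · intro h
        exact hne (congrArg (fun x : ChainF c m => x.1.1) h)
    · simp only [Sum.inr.injEq, Finset.sum_ite_eq, Finset.mem_univ, if_true]
      by_cases h : j' + 1 < m
      · rw [face_inr hj2 h hf]
        exact if_congr ⟨fun e => ⟨h, e⟩, fun ⟨_, e⟩ => e⟩ rfl rfl
      · have := (hc j' hj2).face_right (by simpa using h) v i
        rw [hf] at this
        simp at this
  have h3 : (∑ v : Fin (c j').n, ∑ i : Fin 3,
      if face (vtx (c := c) hj2 v, i) = fc hj x then 1 else 0) =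
      ∑ t : Fin 5, ∑ v : Fin (c j').n, ∑ i : Fin 3, if (c j').face v i = .inr t then
        (if ∃ h : j' + 1 < m, fc (c := c) h ((c (j' + 1)).leftFace t) = fc hj x then 1 else 0)
        else 0 := by
    rw [Finset.sum_comm (γ := Fin 5)]
    refine Finset.sum_congr rfl fun v _ => ?_
    rw [Finset.sum_comm (γ := Fin 5)]
    exact Finset.sum_congr rfl fun i _ => h2 v i
  refine (Finset.dvd_sum fun t _ => ?_ : 3 ∣ ∑ t : Fin 5, _).trans (dvd_of_eq h3.symm)
  by_cases h : ∃ h : j' + 1 < m, fc (c := c) h ((c (j' + 1)).leftFace t) = fc hj x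
  · simp only [h, if_true]
    exact Nat.dvd_of_mod_eq_zero (hr j' h.1 t)
  · simp only [h, if_false, ite_self, Finset.sum_const_zero, dvd_zero]

/-- A chain whose first cell is obstructing is a map with an obstruction. -/
theorem isObstruction (hc : IsCellChain c m) (hm : 0 < m) {z b T : ℕ}
    (ho : (c 0).Obstructs z b T)
    (hl : ∀ j, 0 < j → j < m → ∀ x, (c j).corners (.inl x) % 3 = 2)
    (hr : ∀ j, j + 1 < m → ∀ t, (c j).corners (.inr t) % 3 = 0)
    (hcard : Fintype.card (ChainV c m) % 3 = 2) :
    (chainMap hc).IsObstruction face (fun v => v.1.1 = 0 ∧ (v.2 : ℕ) < z)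
      (Finset.univ.filter fun x => x.1.1 = 0 ∧ (x.2 : ℕ) < b)
      (fun t => fc hm ((c 0).faceAt b t))
      (fun t => (vtx hm ((c 0).cutV T t), Cell.cutS T t)) where
  inj s t h := by
    have h1 := eq_of_heq (Sigma.mk.inj h).2
    have h2 := congrArg Fin.val h1
    rw [Cell.faceAt_val ho.le, Cell.faceAt_val ho.le] at h2
    exact Fin.ext (by omega)
  notMem t := by
    simp only [Finset.mem_filter, Finset.mem_univ, true_and, not_lt]
    rw [Cell.faceAt_val ho.le]
    omega
  mem t := ⟨rfl, ho.lt t⟩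
  opp_mem t := by
    have h := ho.leaves t
    unfold Cell.LeavesAt at h
    change ¬ ((opp _).1.1.1 = 0 ∧ _)
    cases hl : (c 0).loc ((c 0).cutV T t) (Cell.cutS T t) with
    | inn w i =>
      rw [hl] at h
      change ¬ ((opp _).1.1.1 = 0 ∧ ((opp _).1.2 : ℕ) < z)
      rw [opp_inn hm hl]
      simpa using h
    | left _ => rw [hl] at h; exact h.elim
    | right _ => rw [hl] at h; exact h.elim
  inj_fst s t h := ho.inj s t (eq_of_heq (Sigma.mk.inj h).2)
  exists_eq := by
    rintro ⟨⟨⟨j, hj⟩, v⟩, i⟩ ⟨h1, h2⟩ h3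
    simp only at h1 h2
    subst h1
    have h := ho.stays v h2 i
    unfold Cell.StaysAt at h
    cases hl : (c 0).loc v i with
    | inn w i' =>
      rw [hl] at h
      change ¬ ((opp _).1.1.1 = 0 ∧ ((opp _).1.2 : ℕ) < z) at h3
      rw [opp_inn hm hl] at h3
      rcases h with h | ⟨t, rfl, rfl⟩
      · exact absurd ⟨rfl, h⟩ h3
      · exact ⟨t, rfl⟩
    | left _ => rw [hl] at h; exact h.elim
    | right _ => rw [hl] at h; exact h.elim
  face t := face_inl hm (ho.face t)
  face_prev t := face_inl hm (ho.face_prev t)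
  face_of_mem := by
    rintro ⟨⟨j, hj⟩, v⟩ i ⟨h1, h2⟩
    simp only at h1 h2
    subst h1
    obtain ⟨x, hx, hlt⟩ := ho.exists_face v h2 i
    rw [face_inl hm hx]
    by_cases hb : (x : ℕ) < b
    · left
      simpa using hb
    · right
      refine ⟨⟨x - b, by omega⟩, ?_⟩
      congr 1
      apply Fin.ext
      rw [Cell.faceAt_val ho.le]
      simp only
      omega
  face_of_notMem := by
    rintro ⟨⟨j, hj⟩, v⟩ i h
    simp only [Finset.mem_filter, Finset.mem_univ, true_and]
    rintro ⟨h1, h2⟩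
    rcases hf : (c j).face v i with x | t
    · rw [face_inl hj hf] at h1 h2
      simp only at h1 h2
      subst h1
      have := ho.face_ge v (by simpa using h) i
      rw [hf] at this
      simp only [Sum.elim_inl] at this
      omega
    · by_cases hj' : j + 1 < m
      · rw [face_inr hj hj' hf] at h1
        simp at h1
      · have := (hc j hj).face_right (by simpa using hj') v i
        rw [hf] at this
        simp at this
  fiber := by
    rintro ⟨⟨j, hj⟩, x⟩
    rw [card_fiber hc hr hj x]
    rcases Nat.eq_zero_or_pos j with rfl | hpos
    · rw [ho.corners x]
      congr 2
      refine if_congr ?_ rfl rfl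
      constructor
      · rintro (h | h | h)
        · exact ⟨0, by simp, congrArg _ (Fin.ext (by rw [Cell.faceAt_val ho.le, h]; rfl))⟩
        · exact ⟨1, by simp, congrArg _ (Fin.ext (by rw [Cell.faceAt_val ho.le, h]; rfl))⟩
        · exact ⟨3, by simp, congrArg _ (Fin.ext (by rw [Cell.faceAt_val ho.le, h]; rfl))⟩
      · rintro ⟨t, ht, h⟩
        have h1 := congrArg Fin.val (eq_of_heq (Sigma.mk.inj h).2)
        rw [Cell.faceAt_val ho.le] at h1
        rcases ht with rfl | rfl | rfl
        · left; simpa using h1.symm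
        · right; left; simpa using h1.symm
        · right; right; simpa using h1.symm
    · rw [hl j hpos hj, if_neg]
      rintro ⟨t, _, h⟩
      have := congrArg (fun x : ChainF c m => x.1.1) h
      simp only at this
      omega
  fiber_mem := by
    rintro ⟨⟨j, hj⟩, x⟩
    rw [Finset.card_filter, Fintype.sum_prod_type, Fintype.sum_sigma]
    rw [Finset.sum_eq_single (⟨0, hm⟩ : Fin m)]
    · rcases Nat.eq_zero_or_pos j with rfl | hpos
      · have h1 : (∑ v : Fin (c 0).n, ∑ i : Fin 3, if ((0 = 0 ∧ (v : ℕ) < z) ∧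
            face (vtx (c := c) hm v, i) = fc hj x) then 1 else 0) =
            (c 0).cornersBelow z (.inl x) := by
          refine Finset.sum_congr rfl fun v _ => Finset.sum_congr rfl fun i _ => ?_
          simp only [face_eq_iff hc hj v i x, true_and]
        refine (congrArg (· % 3) h1).trans ?_
        rw [ho.cornersBelow x]
        congr 1
        simp only [Finset.mem_filter, Finset.mem_univ, true_and]
        refine if_congr Iff.rfl rfl (if_congr ?_ rfl rfl)
        constructor
        · rintro (h | h)
          · exact ⟨0, by simp, congrArg _ (Fin.ext (by rw [Cell.faceAt_val ho.le, h]; rfl))⟩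
          · exact ⟨1, by simp, congrArg _ (Fin.ext (by rw [Cell.faceAt_val ho.le, h]; rfl))⟩
        · rintro ⟨t, ht, h⟩
          have h1 := congrArg Fin.val (eq_of_heq (Sigma.mk.inj h).2)
          rw [Cell.faceAt_val ho.le] at h1
          rcases ht with rfl | rfl
          · left; simpa using h1.symm
          · right; simpa using h1.symm
      · rw [if_neg, if_neg, Finset.sum_eq_zero]
        · intro v _
          refine Finset.sum_eq_zero fun i _ => if_neg ?_
          rintro ⟨⟨_, h2⟩, h3⟩
          obtain ⟨y, hy, _⟩ := ho.exists_face v h2 i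
          rw [face_inl hm hy] at h3
          have := congrArg (fun x : ChainF c m => x.1.1) h3
          simp only at this
          omega
        · rintro ⟨t, _, h⟩
          have := congrArg (fun x : ChainF c m => x.1.1) h
          simp only at this
          omega
        · simp only [Finset.mem_filter, Finset.mem_univ, true_and]
          omega
    · intro j' _ hj'
      refine Finset.sum_eq_zero fun v _ => Finset.sum_eq_zero fun i _ => if_neg ?_
      rintro ⟨⟨h1, _⟩, _⟩
      exact hj' (Fin.ext h1)
    · intro h
      exact absurd (Finset.mem_univ _) h
  card := hcard
  card_mem := by
    rw [Finset.card_filter, Fintype.sum_sigma, Finset.sum_eq_single (⟨0, hm⟩ : Fin m)]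
    · have h1 : (∑ v : Fin (c 0).n, if (0 = 0 ∧ (v : ℕ) < z) then 1 else 0) = z := by
        simp only [true_and]
        rw [← Finset.card_filter, Fin.card_filter_val_lt]
        exact Nat.min_eq_right ho.card_le
      exact (congrArg (· % 3) h1).trans ho.card
    · intro j' _ hj'
      refine Finset.sum_eq_zero fun v _ => if_neg ?_
      rintro ⟨h1, _⟩
      exact hj' (Fin.ext h1)
    · intro h
      exact absurd (Finset.mem_univ _) h

end CellChain

/-! ### Patterns in a cell -/

/-- `f x`, in a form that makes the kernel evaluate `x` first. -/
def force {α : Type} (x : ℕ) (f : ℕ → α) : α := Nat.rec (f 0) (fun k _ => f k.succ) x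

theorem force_eq {α : Type} (x : ℕ) (f : ℕ → α) : force x f = f x := by
  cases x <;> rfl

theorem natBeq_eq_true {a b : ℕ} : Nat.beq a b = true ↔ a = b := by rw [Nat.beq_eq]

theorem natBeq_eq_false {a b : ℕ} : Nat.beq a b = false ↔ a ≠ b := by
  rw [← Bool.not_eq_true, Nat.beq_eq]

/-- Whether `f` holds at all numbers below `n`. -/
def allBelow (n : ℕ) (f : ℕ → Bool) : Bool := Nat.rec true (fun k b => f k && b) n

theorem of_allBelow {f : ℕ → Bool} : ∀ {n : ℕ}, allBelow n f = true → ∀ k < n, f k = true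
  | 0, _, k, hk => absurd hk (Nat.not_lt_zero k)
  | n + 1, h, k, hk => by
    have h' : (f n && allBelow n f) = true := h
    rw [Bool.and_eq_true] at h'
    rcases Nat.lt_succ_iff_lt_or_eq.1 hk with h2 | rfl
    · exact of_allBelow h'.2 k h2
    · exact h'.1

/-- The state in which no dangler is used. A state is a table of width `3` that gives the partner of
each dangler, or its own number if it is not used. So this is the table of the identity. -/
def noState : ℕ := 0x4688

/-- A dangler that is used in the state `r`, if there is one. -/
def usedDangler (r : ℕ) : ℕ := Nat.rec 0 (fun t t' => cond (Nat.beq (digit 3 r t) t) t' t) 5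

namespace Cell

variable (c : Cell)

/-- A dart is used by the pattern `p`. A pattern is a table of width `2`, whose entry at a vertex is
the slot of the unused dart, or `3` at a deleted vertex. -/
def IsUsed (p h : ℕ) : Prop := digit 2 p (h / 3) ≠ 3 ∧ digit 2 p (h / 3) ≠ h % 3

/-- The boolean form of `IsUsed`. -/
def isUsed (p h : ℕ) : Bool :=
  force (digit 2 p (h / 3)) fun u => !Nat.beq u 3 && !Nat.beq u (h % 3)

/-- The danglers in the table `T` that are used according to the state `s` are used by the pattern
`p`. -/
def Agrees (T s p : ℕ) : Prop := ∀ t < 5, digit 3 s t < 5 ∧ digit 3 s (digit 3 s t) = t ∧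
  (digit 3 s t ≠ t → digit 10 T t < 3 * c.n ∧ IsUsed p (digit 10 T t))

/-- The boolean form of `Agrees`. -/
def agrees (T s p : ℕ) : Bool := allBelow 5 fun t => force (digit 3 s t) fun t' =>
  Nat.blt t' 5 && Nat.beq (digit 3 s t') t &&
  (Nat.beq t' t || force (digit 10 T t) fun h => Nat.blt h (3 * c.n) && isUsed p h)

/-- A used dart leads to a used dart or to a used dangler. -/
def CompatAt (l r p h : ℕ) : Prop :=
  (c.code h < 3 * c.n → IsUsed p (c.code h)) ∧
  (3 * c.n ≤ c.code h → c.code h < 3 * c.n + 5 → digit 10 c.zl (c.code h - 3 * c.n) = h ∧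
    digit 3 l (c.code h - 3 * c.n) ≠ c.code h - 3 * c.n) ∧
  (3 * c.n + 5 ≤ c.code h → c.code h < 3 * c.n + 10 ∧
    digit 10 c.br (c.code h - (3 * c.n + 5)) = h ∧
    digit 3 r (c.code h - (3 * c.n + 5)) ≠ c.code h - (3 * c.n + 5))

/-- The boolean form of `CompatAt`. -/
def compatAt (l r p h : ℕ) : Bool := force (c.code h) fun e =>
  cond (Nat.blt e (3 * c.n)) (isUsed p e)
    (cond (Nat.blt e (3 * c.n + 5))
      (Nat.beq (digit 10 c.zl (e - 3 * c.n)) h && !Nat.beq (digit 3 l (e - 3 * c.n)) (e - 3 * c.n))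
      (Nat.blt e (3 * c.n + 10) && Nat.beq (digit 10 c.br (e - (3 * c.n + 5))) h &&
        !Nat.beq (digit 3 r (e - (3 * c.n + 5))) (e - (3 * c.n + 5))))

/-- The pattern `p` is consistent, and agrees with the states `l` and `r` at the danglers. -/
structure Compat (l r p : ℕ) : Prop where
  left : c.Agrees c.zl l p
  right : c.Agrees c.br r p
  inn : ∀ h < 3 * c.n, IsUsed p h → c.CompatAt l r p h

/-- The equivalence relations that contain all the connections made by the pattern `p`, and those
made outside the cell according to the state `r`. -/
structure Joins (r p : ℕ) (R : ℕ → ℕ → Prop) : Prop where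
  equiv : Equivalence R
  inn : ∀ h < 3 * c.n, IsUsed p h → c.code h < 3 * c.n → R (h / 3) (c.code h / 3)
  right : ∀ t < 5, digit 3 r t ≠ t →
    R (digit 10 c.br t / 3) (digit 10 c.br (digit 3 r t) / 3)

/-- The pattern `p`, with the outer connections `r`, consists of paths that connect the left
danglers as the state `l` says. -/
structure Fits (l r p : ℕ) : Prop extends c.Compat l r p where
  conn : ∀ R, c.Joins r p R →
    (∀ v < c.n, digit 2 p v ≠ 3 → ∃ t < 5, digit 3 l t ≠ t ∧ R v (digit 10 c.zl t / 3)) ∧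
    ∀ t < 5, digit 3 l t ≠ t → R (digit 10 c.zl t / 3) (digit 10 c.zl (digit 3 l t) / 3)

/-- The pattern `p`, with the outer connections `r`, is a cycle. -/
structure FitsFirst (r p : ℕ) : Prop extends c.Compat noState r p where
  conn : ∀ R, c.Joins r p R → ∀ v < c.n, ∀ w < c.n, digit 2 p v ≠ 3 → digit 2 p w ≠ 3 → R v w

/-- The boolean form of `Compat`, together with the condition that `x` and `y` are the deleted
vertices and all others are in the set `mask`. -/
def compat (l r p x y mask : ℕ) : Bool :=
  c.agrees c.zl l p && c.agrees c.br r p && allBelow c.n fun v => force (digit 2 p v) fun u =>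
    cond (Nat.beq u 3) (Nat.beq v x || Nat.beq v y)
      (!Nat.beq v x && !Nat.beq v y && Nat.testBit mask v &&
        allBelow 3 fun i => Nat.beq u i || c.compatAt l r p (3 * v + i))

/-- Follow the path that enters a vertex by the dart `h`, until it leaves by a left dangler or
`fuel` vertices are visited; `k` is applied to the number of the dangler (`5` if there is none) and
the set of the vertices visited, added to `mask`. A path that leaves by a right dangler returns by
its partner in the state `r`. -/
def trace (r p : ℕ) (k : ℕ → ℕ → Bool) (fuel : ℕ) : ℕ → ℕ → Bool :=
  Nat.rec (fun _ mask => k 5 mask)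
    (fun _ ih h mask => force h fun h =>
      -- the slots at a vertex add up to `3`
      force (c.code (6 * (h / 3) + 3 - h - digit 2 p (h / 3))) fun e =>
      force (mask ||| 1 <<< (h / 3)) fun mask =>
      cond (Nat.blt e (3 * c.n)) (ih e mask)
        (cond (Nat.blt e (3 * c.n + 5)) (k (e - 3 * c.n) mask)
          (ih (digit 10 c.br (digit 3 r (e - (3 * c.n + 5)))) mask))) fuel

/-- The boolean form of `FitsFirst`, together with the condition that `x` and `y` are the deleted
vertices, where `c.n` stands for none. The cycle is followed from a right dangler. -/
def fitsFirst (r p x y : ℕ) : Bool :=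
  force r fun r => force p fun p => force x fun x => force y fun y => force (usedDangler r) fun t =>
    !Nat.beq (digit 3 r t) t && Nat.blt t 5 &&
    c.trace r p (fun _ mask => c.compat noState r p x y mask) c.n (digit 10 c.br t) 0

/-- The boolean form of `Fits`, together with the condition that `x` and `y` are the deleted
vertices, where `c.n` stands for none. The paths are followed from one left dangler of each pair. -/
def fits (l r p x y : ℕ) : Bool :=
  force l fun l => force r fun r => force p fun p => force x fun x => force y fun y =>
    Nat.rec (fun mask => c.compat l r p x y mask) (fun t k mask =>
      cond (Nat.ble (digit 3 l t) t) (k mask)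
        (c.trace r p (fun e mask => Nat.beq e (digit 3 l t) && k mask) c.n (digit 10 c.zl t) mask))
      5 0

end Cell

/-! ### Correctness of the tests for patterns -/

namespace Cell

variable {c : Cell} {l r p : ℕ}

theorem isUsed_iff {h : ℕ} : isUsed p h = true ↔ IsUsed p h := by
  simp only [isUsed, force_eq, Bool.and_eq_true, Bool.not_eq_true', natBeq_eq_false, IsUsed, ne_eq]

theorem of_agrees {T s : ℕ} (h : c.agrees T s p = true) : c.Agrees T s p := by
  intro t ht
  have := of_allBelow h t ht
  simp only [force_eq, Bool.and_eq_true, Bool.or_eq_true, Nat.blt_eq, natBeq_eq_true,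
    isUsed_iff] at this
  exact ⟨this.1.1, this.1.2, fun h => this.2.resolve_left h⟩

theorem of_compatAt {h : ℕ} (hh : c.compatAt l r p h = true) : c.CompatAt l r p h := by
  unfold compatAt at hh
  rw [force_eq] at hh
  unfold CompatAt
  by_cases h1 : c.code h < 3 * c.n
  · rw [show Nat.blt (c.code h) (3 * c.n) = true by rwa [Nat.blt_eq], cond_true, isUsed_iff] at hh
    exact ⟨fun _ => hh, by omega, by omega⟩
  · rw [show Nat.blt (c.code h) (3 * c.n) = false by rwa [← Bool.not_eq_true, Nat.blt_eq],
      cond_false] at hh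
    by_cases h2 : c.code h < 3 * c.n + 5
    · rw [show Nat.blt (c.code h) (3 * c.n + 5) = true by rwa [Nat.blt_eq], cond_true] at hh
      simp only [Bool.and_eq_true, natBeq_eq_true, Bool.not_eq_true', natBeq_eq_false] at hh
      exact ⟨by omega, fun _ _ => hh, by omega⟩
    · rw [show Nat.blt (c.code h) (3 * c.n + 5) = false by rwa [← Bool.not_eq_true, Nat.blt_eq],
        cond_false] at hh
      simp only [Bool.and_eq_true, natBeq_eq_true, Bool.not_eq_true', natBeq_eq_false,
        Nat.blt_eq] at hh
      exact ⟨by omega, by omega, fun _ => ⟨hh.1.1, hh.1.2, hh.2⟩⟩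

theorem of_compat {x y mask : ℕ} (h : c.compat l r p x y mask = true) : c.Compat l r p ∧
    ∀ v < c.n, (digit 2 p v = 3 ↔ v = x ∨ v = y) ∧ (digit 2 p v ≠ 3 → mask.testBit v = true) := by
  unfold compat at h
  simp only [Bool.and_eq_true] at h
  obtain ⟨⟨h1, h2⟩, h3⟩ := h
  have key : ∀ v < c.n, (digit 2 p v = 3 → v = x ∨ v = y) ∧ (digit 2 p v ≠ 3 →
      ¬ (v = x ∨ v = y) ∧ mask.testBit v = true ∧
      ∀ i < 3, digit 2 p v ≠ i → c.CompatAt l r p (3 * v + i)) := by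
    intro v hv
    have h4 := of_allBelow h3 v hv
    rw [force_eq] at h4
    by_cases hu : digit 2 p v = 3
    · rw [hu] at h4
      simp only [natBeq_eq_true.2 rfl, cond_true, Bool.or_eq_true, natBeq_eq_true] at h4
      exact ⟨fun _ => h4, fun h => absurd hu h⟩
    · rw [show Nat.beq (digit 2 p v) 3 = false from natBeq_eq_false.2 hu, cond_false] at h4
      simp only [Bool.and_eq_true, Bool.not_eq_true', natBeq_eq_false] at h4
      refine ⟨fun h => absurd h hu, fun _ => ⟨?_, h4.1.2, fun i hi hne => ?_⟩⟩
      · rintro (h | h)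
        · exact h4.1.1.1 h
        · exact h4.1.1.2 h
      · have := of_allBelow h4.2 i hi
        rw [Bool.or_eq_true, natBeq_eq_true] at this
        exact of_compatAt (this.resolve_left hne)
  refine ⟨⟨of_agrees h1, of_agrees h2, fun h hh hu => ?_⟩, fun v hv => ⟨⟨(key v hv).1, fun h => ?_⟩,
    fun h => ((key v hv).2 h).2.1⟩⟩
  · have := ((key (h / 3) (by omega)).2 hu.1).2.2 (h % 3) (by omega) hu.2
    rwa [Nat.div_add_mod] at this
  · by_contra hne
    exact ((key v hv).2 hne).1 h

theorem trace_succ (k : ℕ → ℕ → Bool) (fuel h mask : ℕ) :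
    c.trace r p k (fuel + 1) h mask =
      let e := c.code (6 * (h / 3) + 3 - h - digit 2 p (h / 3))
      let mask' := mask ||| 1 <<< (h / 3)
      cond (Nat.blt e (3 * c.n)) (c.trace r p k fuel e mask')
        (cond (Nat.blt e (3 * c.n + 5)) (k (e - 3 * c.n) mask')
          (c.trace r p k fuel (digit 10 c.br (digit 3 r (e - (3 * c.n + 5)))) mask')) := by
  change (force h fun h => force (c.code (6 * (h / 3) + 3 - h - digit 2 p (h / 3))) fun e =>
    force (mask ||| 1 <<< (h / 3)) fun mask =>
      cond (Nat.blt e (3 * c.n)) (c.trace r p k fuel e mask)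
        (cond (Nat.blt e (3 * c.n + 5)) (k (e - 3 * c.n) mask)
          (c.trace r p k fuel (digit 10 c.br (digit 3 r (e - (3 * c.n + 5)))) mask))) = _
  rw [force_eq, force_eq, force_eq]

theorem exists_of_trace {k : ℕ → ℕ → Bool} : ∀ {fuel h mask : ℕ},
    c.trace r p k fuel h mask = true → ∃ e mask', k e mask' = true
  | 0, _, mask, h => ⟨5, mask, h⟩
  | fuel + 1, h, mask, ht => by
    rw [trace_succ] at ht
    simp only at ht
    cases h1 : Nat.blt (c.code (6 * (h / 3) + 3 - h - digit 2 p (h / 3))) (3 * c.n) with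
    | true =>
      rw [h1, cond_true] at ht
      exact exists_of_trace ht
    | false =>
      rw [h1, cond_false] at ht
      cases h2 : Nat.blt (c.code (6 * (h / 3) + 3 - h - digit 2 p (h / 3))) (3 * c.n + 5) with
      | true =>
        rw [h2, cond_true] at ht
        exact ⟨_, _, ht⟩
      | false =>
        rw [h2, cond_false] at ht
        exact exists_of_trace ht

theorem testBit_or_shiftLeft {mask v w : ℕ} (h : (mask ||| 1 <<< v).testBit w = true) :
    mask.testBit w = true ∨ w = v := by
  rw [Nat.testBit_or, Nat.one_shiftLeft, Nat.testBit_two_pow, Bool.or_eq_true,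
    decide_eq_true_eq] at h
  exact h.imp_right Eq.symm

theorem Compat.trace (hc : c.Compat l r p) {R : ℕ → ℕ → Prop} (hR : c.Joins r p R) (v : ℕ)
    {k : ℕ → ℕ → Bool} : ∀ {fuel h mask : ℕ}, h < 3 * c.n → IsUsed p h → R v (h / 3) →
    c.trace r p k fuel h mask = true → ∃ e mask', k e mask' = true ∧
      (∀ w, mask'.testBit w = true → mask.testBit w = true ∨ R v w) ∧
      (e < 5 → R v (digit 10 c.zl e / 3))
  | 0, h, mask, _, _, _, ht => ⟨5, mask, ht, fun _ h => Or.inl h, by omega⟩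
  | fuel + 1, h, mask, hh, hu, hv, ht => by
    rw [trace_succ] at ht
    simp only at ht
    have hu1 : digit 2 p (h / 3) < 4 := Nat.mod_lt _ (by norm_num)
    obtain ⟨hu2, hu3⟩ := hu
    have hmask : ∀ w, (mask ||| 1 <<< (h / 3)).testBit w = true → mask.testBit w = true ∨ R v w :=
      fun w hw => (testBit_or_shiftLeft hw).imp_right fun h' => by rw [h']; exact hv
    obtain ⟨x, hx⟩ : ∃ x, 6 * (h / 3) + 3 - h - digit 2 p (h / 3) = x := ⟨_, rfl⟩
    have hx1 : x / 3 = h / 3 := by omega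
    have hx2 : IsUsed p x := by
      unfold IsUsed
      rw [hx1]
      omega
    have hx3 : x < 3 * c.n := by omega
    rw [hx] at ht
    obtain ⟨c1, c2, c3⟩ := hc.inn x hx3 hx2
    by_cases h1 : c.code x < 3 * c.n
    · rw [show Nat.blt (c.code x) (3 * c.n) = true by rwa [Nat.blt_eq], cond_true] at ht
      have := hR.inn x hx3 hx2 h1
      rw [hx1] at this
      obtain ⟨e, mask', k1, k2, k3⟩ := Compat.trace hc hR v h1 (c1 h1) (hR.equiv.trans hv this) ht
      exact ⟨e, mask', k1, fun w hw => (k2 w hw).elim (hmask w) Or.inr, k3⟩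
    · rw [show Nat.blt (c.code x) (3 * c.n) = false by rwa [← Bool.not_eq_true, Nat.blt_eq],
        cond_false] at ht
      by_cases h2 : c.code x < 3 * c.n + 5
      · rw [show Nat.blt (c.code x) (3 * c.n + 5) = true by rwa [Nat.blt_eq], cond_true] at ht
        refine ⟨_, _, ht, hmask, fun _ => ?_⟩
        rw [(c2 (by omega) h2).1, hx1]
        exact hv
      · rw [show Nat.blt (c.code x) (3 * c.n + 5) = false by rwa [← Bool.not_eq_true, Nat.blt_eq],
          cond_false] at ht
        obtain ⟨c4, c5, c6⟩ := c3 (by omega)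
        have ht5 : c.code x - (3 * c.n + 5) < 5 := by omega
        obtain ⟨a1, a2, -⟩ := hc.right _ ht5
        obtain ⟨-, -, a3⟩ := hc.right _ a1
        obtain ⟨b1, b2⟩ := a3 (by rw [a2]; exact c6.symm)
        have := hR.right _ ht5 c6
        rw [c5, hx1] at this
        obtain ⟨e, mask', k1, k2, k3⟩ := Compat.trace hc hR v b1 b2 (hR.equiv.trans hv this) ht
        exact ⟨e, mask', k1, fun w hw => (k2 w hw).elim (hmask w) Or.inr, k3⟩

theorem of_fitsFirst {x y : ℕ} (h : c.fitsFirst r p x y = true) :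
    c.FitsFirst r p ∧ ∀ v < c.n, digit 2 p v = 3 ↔ v = x ∨ v = y := by
  unfold fitsFirst at h
  simp only [force_eq] at h
  generalize usedDangler r = t at h
  simp only [Bool.and_eq_true, Bool.not_eq_true', natBeq_eq_false, Nat.blt_eq] at h
  obtain ⟨⟨h1, h2⟩, h3⟩ := h
  obtain ⟨_, _, h4⟩ := exists_of_trace h3
  obtain ⟨hc, hd⟩ := of_compat h4
  refine ⟨⟨hc, fun R hR => ?_⟩, fun v hv => (hd v hv).1⟩
  obtain ⟨_, _, hu⟩ := hc.right t h2
  obtain ⟨e, mask, k1, k2, -⟩ := hc.trace hR _ (hu h1).1 (hu h1).2 (hR.equiv.refl _) h3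
  have key : ∀ v < c.n, digit 2 p v ≠ 3 → R (digit 10 c.br t / 3) v := fun v hv hv3 =>
    (k2 v (((of_compat k1).2 v hv).2 hv3)).resolve_left (by simp)
  exact fun v hv w hw hv3 hw3 => hR.equiv.trans (hR.equiv.symm (key v hv hv3)) (key w hw hw3)

/-- The loop of `fits`, when the danglers from `t` on have been traced. -/
def fitsFrom (c : Cell) (l r p x y t : ℕ) : ℕ → Bool :=
  Nat.rec (fun mask => c.compat l r p x y mask) (fun t k mask =>
    cond (Nat.ble (digit 3 l t) t) (k mask)
      (c.trace r p (fun e mask => Nat.beq e (digit 3 l t) && k mask) c.n (digit 10 c.zl t) mask)) t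

theorem exists_of_fitsFrom {x y : ℕ} : ∀ {t mask : ℕ}, c.fitsFrom l r p x y t mask = true →
    ∃ mask, c.compat l r p x y mask = true
  | 0, mask, h => ⟨mask, h⟩
  | t + 1, mask, h => by
    change cond (Nat.ble (digit 3 l t) t) (c.fitsFrom l r p x y t mask)
      (c.trace r p (fun e mask => Nat.beq e (digit 3 l t) && c.fitsFrom l r p x y t mask) c.n
        (digit 10 c.zl t) mask) = true at h
    cases h1 : Nat.ble (digit 3 l t) t with
    | true =>
      rw [h1, cond_true] at h
      exact exists_of_fitsFrom h
    | false =>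
      rw [h1, cond_false] at h
      obtain ⟨e, mask', h2⟩ := exists_of_trace h
      rw [Bool.and_eq_true] at h2
      exact exists_of_fitsFrom h2.2

theorem Compat.fitsFrom (hc : c.Compat l r p) {R : ℕ → ℕ → Prop} (hR : c.Joins r p R) {x y : ℕ} :
    ∀ {t mask : ℕ}, t ≤ 5 → (∀ w, mask.testBit w = true → ∃ t < 5, digit 3 l t ≠ t ∧
      R w (digit 10 c.zl t / 3)) → c.fitsFrom l r p x y t mask = true →
    (∀ v < c.n, digit 2 p v ≠ 3 → ∃ t < 5, digit 3 l t ≠ t ∧ R v (digit 10 c.zl t / 3)) ∧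
    ∀ t' < t, t' < digit 3 l t' → R (digit 10 c.zl t' / 3) (digit 10 c.zl (digit 3 l t') / 3)
  | 0, mask, _, hm, h => ⟨fun v hv hv3 => hm v (((of_compat h).2 v hv).2 hv3), by simp⟩
  | t + 1, mask, ht, hm, h => by
    change cond (Nat.ble (digit 3 l t) t) (c.fitsFrom l r p x y t mask)
      (c.trace r p (fun e mask => Nat.beq e (digit 3 l t) && c.fitsFrom l r p x y t mask) c.n
        (digit 10 c.zl t) mask) = true at h
    cases h1 : Nat.ble (digit 3 l t) t with
    | true =>
      rw [h1, cond_true] at h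
      obtain ⟨k1, k2⟩ := Compat.fitsFrom hc hR (by omega) hm h
      refine ⟨k1, fun t' ht' hlt => ?_⟩
      rcases Nat.lt_succ_iff_lt_or_eq.1 ht' with h3 | rfl
      · exact k2 t' h3 hlt
      · exact absurd (Nat.le_of_ble_eq_true h1) (by omega)
    | false =>
      rw [h1, cond_false] at h
      have hlt : t < digit 3 l t := by
        by_contra hlt
        rw [Nat.ble_eq_true_of_le (by omega)] at h1
        exact absurd h1 (by simp)
      obtain ⟨a1, _, a2⟩ := hc.left t (by omega)
      obtain ⟨b1, b2⟩ := a2 (by omega)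
      obtain ⟨e, mask', k1, k2, k3⟩ := hc.trace hR _ b1 b2 (hR.equiv.refl _) h
      rw [Bool.and_eq_true, natBeq_eq_true] at k1
      obtain ⟨rfl, k1⟩ := k1
      obtain ⟨m1, m2⟩ := Compat.fitsFrom hc hR (mask := mask') (by omega) (fun w hw =>
        (k2 w hw).elim (hm w) fun h => ⟨t, by omega, by omega, hR.equiv.symm h⟩) k1
      refine ⟨m1, fun t' ht' hlt' => ?_⟩
      rcases Nat.lt_succ_iff_lt_or_eq.1 ht' with h3 | rfl
      · exact m2 t' h3 hlt'
      · exact k3 a1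

theorem of_fits {x y : ℕ} (h : c.fits l r p x y = true) :
    c.Fits l r p ∧ ∀ v < c.n, digit 2 p v = 3 ↔ v = x ∨ v = y := by
  unfold fits at h
  simp only [force_eq] at h
  obtain ⟨_, h4⟩ := exists_of_fitsFrom (t := 5) (mask := 0) h
  obtain ⟨hc, hd⟩ := of_compat h4
  refine ⟨⟨hc, fun R hR => ?_⟩, fun v hv => (hd v hv).1⟩
  obtain ⟨k1, k2⟩ := hc.fitsFrom hR (t := 5) (mask := 0) le_rfl (by simp) h
  refine ⟨k1, fun t ht hne => ?_⟩
  obtain ⟨a1, a2, _⟩ := hc.left t ht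
  rcases lt_or_gt_of_ne hne with h5 | h5
  · have := k2 _ a1 (by rw [a2]; exact h5)
    rw [a2] at this
    exact hR.equiv.symm this
  · exact k2 t ht h5

end Cell

/-! ### Hamiltonian cycles in chains -/

namespace Cell

variable {c : Cell} {l r p : ℕ}

theorem isUsed_dart {v : ℕ} {i : Fin 3} :
    IsUsed p (3 * v + i) ↔ digit 2 p v ≠ 3 ∧ digit 2 p v ≠ i := by
  have h1 : (3 * v + (i : ℕ)) / 3 = v := by omega
  have h2 : (3 * v + (i : ℕ)) % 3 = i := by omega
  rw [IsUsed, h1, h2]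

/-- Whether a dart given by its number is used, in terms of its vertex and its slot. -/
theorem isUsed_iff_dartV {h : ℕ} (hh : h < 3 * c.n) :
    IsUsed p h ↔ IsUsed p (3 * (c.dartV h : ℕ) + (Fin.ofNat 3 h : Fin 3)) := by
  have h1 : (c.dartV h : ℕ) = h / 3 := Nat.mod_eq_of_lt (by omega)
  have h2 : ((Fin.ofNat 3 h : Fin 3) : ℕ) = h % 3 := rfl
  rw [h1, h2, Nat.div_add_mod]

theorem code_of_inn {v w : Fin c.n} {i i' : Fin 3} (h : c.loc v i = .inn w i') :
    c.code (3 * v + i) < 3 * c.n ∧ c.dartV (c.code (3 * v + i)) = w ∧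
      Fin.ofNat 3 (c.code (3 * v + i)) = i' := by
  unfold loc at h
  split_ifs at h with h1
  injection h with h2 h3
  exact ⟨h1, h2, h3⟩

theorem code_of_left {v : Fin c.n} {i : Fin 3} {t : Fin 5} (h : c.loc v i = .left t) :
    c.code (3 * v + i) = 3 * c.n + t := by
  unfold loc at h
  split_ifs at h with h1 h2
  injection h with h3
  have h4 := congrArg Fin.val h3
  simp only [Fin.ofNat] at h4
  omega

theorem Compat.code_of_right (hc : c.Compat l r p) {v : Fin c.n} {i : Fin 3} {t : Fin 5}
    (hu : IsUsed p (3 * v + i)) (h : c.loc v i = .right t) :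
    c.code (3 * v + i) = 3 * c.n + 5 + t := by
  have h5 := (hc.inn (3 * v + i) (by omega) hu).2.2
  unfold loc at h
  split_ifs at h with h1 h2
  injection h with h3
  have h4 := congrArg Fin.val h3
  simp only [Fin.ofNat] at h4
  have := (h5 (by omega)).1
  omega

theorem loc_of_code_lt {h : ℕ} (hh : h < 3 * c.n) (hc : c.code h < 3 * c.n) :
    c.loc (c.dartV h) (Fin.ofNat 3 h) = .inn (c.dartV (c.code h)) (Fin.ofNat 3 (c.code h)) := by
  have h1 : (c.dartV h : ℕ) = h / 3 := Nat.mod_eq_of_lt (by omega)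
  have h2 : ((Fin.ofNat 3 h : Fin 3) : ℕ) = h % 3 := rfl
  unfold loc
  rw [h1, h2, Nat.div_add_mod, if_pos hc]
  rfl

theorem dartV_val (v : Fin c.n) : (Fin.ofNat c.n v : Fin c.n) = v :=
  Fin.ext (Nat.mod_eq_of_lt v.2)

end Cell

section

open Cell

/-- The patterns `p j` in the cells of a chain, with the states `s j` at the left danglers of `c j`,
fit together to a cycle. -/
structure IsCyclePattern (c : ℕ → Cell) (m : ℕ) (p s : ℕ → ℕ) : Prop where
  zero : s 0 = noState
  last : s m = noState
  first : (c 0).FitsFirst (s 1) (p 0)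
  fits : ∀ j, 0 < j → j < m → (c j).Fits (s j) (s (j + 1)) (p j)

namespace IsCyclePattern

variable {c : ℕ → Cell} {m : ℕ} {p s : ℕ → ℕ}

theorem compat (hp : IsCyclePattern c m p s) {j : ℕ} (hj : j < m) :
    (c j).Compat (s j) (s (j + 1)) (p j) := by
  rcases Nat.eq_zero_or_pos j with rfl | h
  · rw [hp.zero]
    exact hp.first.toCompat
  · exact (hp.fits j h hj).toCompat

/-- The unused darts of a pattern. -/
def unused (c : ℕ → Cell) (m : ℕ) (p : ℕ → ℕ) (v : ChainV c m) : Option (Fin 3) :=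
  if digit 2 (p v.1) v.2 = 3 then none else some (Fin.ofNat 3 (digit 2 (p v.1) v.2))

theorem used_unused_iff {j : ℕ} (hj : j < m) {v : Fin (c j).n} {i : Fin 3} :
    CubicMap.Used (unused c m p) (vtx hj v, i) ↔ IsUsed (p j) (3 * v + i) := by
  rw [isUsed_dart]
  unfold CubicMap.Used unused
  have h4 : digit 2 (p j) v < 4 := Nat.mod_lt _ (by norm_num)
  by_cases h3 : digit 2 (p j) v = 3
  · simp [h3]
  · simp only [h3, if_false, Option.some.injEq, exists_eq_left', not_false_eq_true, ne_eq, true_and]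
    rw [Fin.ext_iff]
    have : ((Fin.ofNat 3 (digit 2 (p j) v) : Fin 3) : ℕ) = digit 2 (p j) v :=
      Nat.mod_eq_of_lt (by omega)
    rw [this, eq_comm]

theorem used_opp (hc : IsCellChain c m) (hp : IsCyclePattern c m p s) (x : ChainV c m × Fin 3)
    (hx : CubicMap.Used (unused c m p) x) : CubicMap.Used (unused c m p) ((chainMap hc).opp x) := by
  change CubicMap.Used _ (CellChain.opp x)
  obtain ⟨⟨⟨j, hj⟩, v⟩, i⟩ := x
  rw [used_unused_iff hj] at hx
  have hcomp := (hp.compat hj).inn _ (by omega) hx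
  rcases cases_loc hj hc v i with ⟨w, i', h1, -⟩ | ⟨t, hj', h1, h2, h3⟩ | ⟨j', t, rfl, h1, h2, h3⟩
  · rw [opp_inn hj h1, used_unused_iff hj]
    obtain ⟨k1, rfl, rfl⟩ := code_of_inn h1
    rw [← isUsed_iff_dartV k1]
    exact hcomp.1 k1
  · rw [opp_right hj hj' h1, used_unused_iff hj']
    have hcode := (hp.compat hj).code_of_right hx h1
    obtain ⟨-, -, k3⟩ := hcomp.2.2 (by omega)
    rw [hcode, Nat.add_sub_cancel_left] at k3
    obtain ⟨k4, k5⟩ := ((hp.compat hj').left t t.2).2.2 k3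
    exact (isUsed_iff_dartV k4).1 k5
  · have hj' : j' < m := by omega
    rw [opp_left hj' hj h1, used_unused_iff hj']
    have hcode := code_of_left h1
    obtain ⟨-, k3⟩ := hcomp.2.1 (by omega) (by omega)
    rw [hcode, Nat.add_sub_cancel_left] at k3
    obtain ⟨k4, k5⟩ := ((hp.compat hj').right t t.2).2.2 k3
    exact (isUsed_iff_dartV k4).1 k5

variable {R : ChainV c m → ChainV c m → Prop}

theorem rel_cross (hc : IsCellChain c m) (hp : IsCyclePattern c m p s)
    (hR : ∀ x, CubicMap.Used (unused c m p) x → R x.1 ((chainMap hc).opp x).1) {j : ℕ}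
    (hj' : j + 1 < m) {t : ℕ} (ht : t < 5) (hs : digit 3 (s (j + 1)) t ≠ t) :
    R (vtx (by omega) ((c j).dartV (digit 10 (c j).br t)))
      (vtx hj' ((c (j + 1)).dartV (digit 10 (c (j + 1)).zl t))) := by
  have hj : j < m := by omega
  obtain ⟨k4, k5⟩ := ((hp.compat hj).right t ht).2.2 hs
  have h := hR (vtx hj ((c j).rv ⟨t, ht⟩), (c j).rs ⟨t, ht⟩)
    ((used_unused_iff hj).2 ((isUsed_iff_dartV k4).1 k5))
  change R _ (CellChain.opp _).1 at h
  rw [opp_right hj hj' (right_ok hc hj' ⟨t, ht⟩).1] at h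
  exact h

theorem joins (hc : IsCellChain c m) (hp : IsCyclePattern c m p s) (hequiv : Equivalence R)
    (hR : ∀ x, CubicMap.Used (unused c m p) x → R x.1 ((chainMap hc).opp x).1) {j : ℕ}
    (hj : j < m) (hnext : ∀ hj' : j + 1 < m, ∀ t < 5, digit 3 (s (j + 1)) t ≠ t →
      R (vtx hj' ((c (j + 1)).dartV (digit 10 (c (j + 1)).zl t)))
        (vtx hj' ((c (j + 1)).dartV (digit 10 (c (j + 1)).zl (digit 3 (s (j + 1)) t))))) :
    (c j).Joins (s (j + 1)) (p j)
      fun v w => R (vtx hj (Fin.ofNat _ v)) (vtx hj (Fin.ofNat _ w)) where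
  equiv := ⟨fun _ => hequiv.refl _, hequiv.symm, hequiv.trans⟩
  inn h hh hu hcode := by
    have := hR (vtx hj ((c j).dartV h), Fin.ofNat 3 h)
      ((used_unused_iff hj).2 ((isUsed_iff_dartV hh).1 hu))
    change R _ (CellChain.opp _).1 at this
    rw [opp_inn hj (loc_of_code_lt hh hcode)] at this
    exact this
  right t ht hs := by
    by_cases hj' : j + 1 < m
    · obtain ⟨a1, a2, -⟩ := (hp.compat hj).right t ht
      exact hequiv.trans (rel_cross hc hp hR hj' ht hs) (hequiv.trans (hnext hj' t ht hs)
        (hequiv.symm (rel_cross hc hp hR hj' a1 (by rw [a2]; exact hs.symm))))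
    · have : j + 1 = m := by omega
      rw [this, hp.last] at hs
      exact absurd ((by decide : ∀ t < 5, digit 3 noState t = t) t ht) hs

theorem rel_left (hc : IsCellChain c m) (hp : IsCyclePattern c m p s) (hequiv : Equivalence R)
    (hR : ∀ x, CubicMap.Used (unused c m p) x → R x.1 ((chainMap hc).opp x).1) :
    ∀ (k j : ℕ), j + k = m → 0 < j → ∀ hj : j < m,
      (∀ t < 5, digit 3 (s j) t ≠ t → R (vtx hj ((c j).dartV (digit 10 (c j).zl t)))
        (vtx hj ((c j).dartV (digit 10 (c j).zl (digit 3 (s j) t))))) ∧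
      ∀ v : ChainV c m, j ≤ v.1 → digit 2 (p v.1) v.2 ≠ 3 →
        ∃ t < 5, digit 3 (s j) t ≠ t ∧ R v (vtx hj ((c j).dartV (digit 10 (c j).zl t)))
  | 0, j, hk, _, hj => by omega
  | k + 1, j, hk, h0, hj => by
    have ih := rel_left hc hp hequiv hR k (j + 1) (by omega) (by omega)
    obtain ⟨k1, k2⟩ := (hp.fits j h0 hj).conn _
      (joins hc hp hequiv hR hj fun hj' => (ih hj').1)
    have key : ∀ v : Fin (c j).n, digit 2 (p j) v ≠ 3 → ∃ t < 5, digit 3 (s j) t ≠ t ∧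
        R (vtx hj v) (vtx hj ((c j).dartV (digit 10 (c j).zl t))) := by
      intro v hv
      obtain ⟨t, t1, t2, t3⟩ := k1 v v.2 hv
      rw [dartV_val] at t3
      exact ⟨t, t1, t2, t3⟩
    refine ⟨k2, ?_⟩
    rintro ⟨⟨i, hi⟩, v⟩ hle hv
    simp only at hle hv
    rcases hle.eq_or_lt with rfl | hlt
    · exact key v hv
    · have hj' : j + 1 < m := by omega
      obtain ⟨t, t1, t2, t3⟩ := (ih hj').2 ⟨⟨i, hi⟩, v⟩ hlt hv
      obtain ⟨-, -, a3⟩ := (hp.compat hj).right t t1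
      obtain ⟨a4, a5⟩ := a3 t2
      obtain ⟨t', u1, u2, u3⟩ := key ((c j).dartV (digit 10 (c j).br t))
        (isUsed_dart.1 ((isUsed_iff_dartV a4).1 a5)).1
      exact ⟨t', u1, u2, hequiv.trans (hequiv.trans t3
        (hequiv.symm (rel_cross hc hp hR hj' t1 t2))) u3⟩

/-- If all vertices but those of `D` are kept by a cycle pattern, then what remains after the
deletion of `D` is hamiltonian. -/
theorem isHamiltonian (hc : IsCellChain c m) (hp : IsCyclePattern c m p s) (hm : 0 < m)
    (D : Set (ChainV c m)) [Fintype ↥Dᶜ]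
    (hD : ∀ v : ChainV c m, digit 2 (p v.1) v.2 = 3 ↔ v ∈ D) (hne : Dᶜ.Nonempty) :
    ((chainMap hc).graph.induce Dᶜ).IsHamiltonian := by
  refine (chainMap hc).isHamiltonian_induce (unused c m p) _ (fun v => ?_) (used_opp hc hp)
    (fun R hequiv hR => ?_) hne
  · rw [Set.mem_compl_iff, ← hD]
    unfold unused
    split_ifs with h <;> simp [h]
  · have hcl := rel_left hc hp hequiv hR
    have hfirst := hp.first.conn _ (joins hc hp hequiv hR hm fun hj' =>
      (hcl (m - 1) 1 (by omega) (by omega) hj').1)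
    have key : ∀ v : ChainV c m, digit 2 (p v.1) v.2 ≠ 3 →
        ∃ w : Fin (c 0).n, digit 2 (p 0) w ≠ 3 ∧ R v (vtx hm w) := by
      rintro ⟨⟨j, hj⟩, v⟩ hv
      rcases Nat.eq_zero_or_pos j with rfl | h0
      · exact ⟨v, hv, hequiv.refl _⟩
      · have h1 : 0 + 1 < m := by omega
        obtain ⟨t, t1, t2, t3⟩ := (hcl (m - 1) 1 (by omega) (by omega) h1).2 ⟨⟨j, hj⟩, v⟩ h0 hv
        obtain ⟨-, -, a3⟩ := (hp.compat hm).right t t1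
        obtain ⟨a4, a5⟩ := a3 t2
        exact ⟨_, (isUsed_dart.1 ((isUsed_iff_dartV a4).1 a5)).1,
          hequiv.trans t3 (hequiv.symm (rel_cross hc hp hR h1 t1 t2))⟩
    intro v w hv hw
    rw [Set.mem_compl_iff, ← hD] at hv hw
    obtain ⟨v', v1, v2⟩ := key v hv
    obtain ⟨w', w1, w2⟩ := key w hw
    have := hfirst v' v'.2 w' w'.2 v1 w1
    rw [dartV_val, dartV_val] at this
    exact hequiv.trans (hequiv.trans v2 this) (hequiv.symm w2)

end IsCyclePattern

end

/-- `Reach c D j s` says that the first `j` cells have fitting patterns for the state `s` at the cut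
behind them, with the vertex number `v` of the cell `i` deleted if `D i v`. -/
inductive Reach (c : ℕ → Cell) (D : ℕ → ℕ → Prop) : ℕ → ℕ → Prop
  | first {r p : ℕ} : (c 0).FitsFirst r p → (∀ v < (c 0).n, digit 2 p v = 3 ↔ D 0 v) → Reach c D 1 r
  | next {j l r p : ℕ} : Reach c D j l → (c j).Fits l r p →
      (∀ v < (c j).n, digit 2 p v = 3 ↔ D j v) → Reach c D (j + 1) r

theorem Reach.exists_pattern {c : ℕ → Cell} {D : ℕ → ℕ → Prop} {j r : ℕ} (h : Reach c D j r) :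
    0 < j ∧ ∃ p s : ℕ → ℕ, s 0 = noState ∧ s j = r ∧ (c 0).FitsFirst (s 1) (p 0) ∧
      (∀ i, 0 < i → i < j → (c i).Fits (s i) (s (i + 1)) (p i)) ∧
      ∀ i < j, ∀ v < (c i).n, digit 2 (p i) v = 3 ↔ D i v := by
  induction h with
  | @first r p h1 h2 =>
    refine ⟨Nat.one_pos, fun _ => p, fun i => if i = 0 then noState else r, rfl, rfl, h1,
      by omega, ?_⟩
    intro i hi
    obtain rfl : i = 0 := by omega
    exact h2
  | @next j l r p _ h1 h2 ih =>
    obtain ⟨hj, p', s, i1, i2, i3, i4, i5⟩ := ih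
    have hs : ∀ i ≤ j, Function.update s (j + 1) r i = s i := fun i hi =>
      Function.update_of_ne (by omega) _ _
    have hp : ∀ i < j, Function.update p' j p i = p' i := fun i hi =>
      Function.update_of_ne (by omega) _ _
    refine ⟨Nat.succ_pos j, Function.update p' j p, Function.update s (j + 1) r, ?_,
      Function.update_self .., ?_, fun i h0 hi => ?_, fun i hi => ?_⟩
    · rw [hs 0 (by omega), i1]
    · rw [hs 1 (by omega), hp 0 (by omega)]
      exact i3
    · rcases Nat.lt_succ_iff_lt_or_eq.1 hi with hi | rfl
      · rw [hs i (by omega), hs (i + 1) (by omega), hp i hi]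
        exact i4 i h0 hi
      · rw [hs i le_rfl, i2, Function.update_self, Function.update_self]
        exact h1
    · rcases Nat.lt_succ_iff_lt_or_eq.1 hi with hi | rfl
      · rw [hp i hi]
        exact i5 i hi
      · rw [Function.update_self]
        exact h2

theorem Reach.isHamiltonian {c : ℕ → Cell} {D : ℕ → ℕ → Prop} {m : ℕ} (hc : IsCellChain c m)
    (h : Reach c D m noState) (S : Set (ChainV c m)) [Fintype ↥Sᶜ] [DecidableEq ↥Sᶜ]
    (hS : ∀ v : ChainV c m, v ∈ S ↔ D v.1 v.2) (hne : Sᶜ.Nonempty) :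
    ((chainMap hc).graph.induce Sᶜ).IsHamiltonian := by
  obtain ⟨hm, p, s, h1, h2, h3, h4, h5⟩ := h.exists_pattern
  convert IsCyclePattern.isHamiltonian hc ⟨h1, h2, h3, h4⟩ hm S (fun v => ?_) hne
  rw [h5 v.1 v.1.2 v.2 v.2.2, hS]

/-! ### Drawings of cells -/

theorem Apart.translate {a b c d a' b' c' d' : ℝ} (h : Apart a b c d a' b' c' d' 0) (x y m : ℝ) :
    Apart (a - x) (b + y) (c - x) (d + y) (a' - x - m) (b' + y) (c' - x - m) (d' + y) m := by
  intro s t hs hs' ht ht' h1 h2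
  exact h s t hs hs' ht ht' (by linarith) (by linarith)

theorem apart_of_lt_left {a b c d a' b' c' d' m : ℝ} (h1 : a < a' + m) (h2 : a < c' + m)
    (h3 : c < a' + m) (h4 : c < c' + m) : Apart a b c d a' b' c' d' m := by
  have h := ((apart_of_lt (b := a) (d := c) (b' := a' + m) (d' := c' + m) (a := b) (c := d)
    (a' := b') (c' := d') (m := 0) h1 h2 h3 h4).transpose).translate 0 0 m
  simpa using h

/-- A plane drawing of a cubic map with straight edges on a cylinder. The predicate `C` selects one
dart of each edge. -/
theorem CubicMap.isPlanar_of_cylinder {V : Type*} (M : CubicMap V) {W : ℕ} (hW : 0 < W)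
    (C : V × Fin 3 → Prop) (hC : ∀ d, C (M.opp d) ↔ ¬ C d) (X Y : V → ℕ) (ex : V × Fin 3 → ℤ)
    (hX : ∀ v, X v < W) (hXY : ∀ u v, X u = X v → Y u = Y v → u = v)
    (hex : ∀ d, C d → ∃ m : ℤ, ex d = X (M.opp d).1 + m * W)
    (hlen : ∀ d, C d → |ex d - X d.1| < W)
    (hsep : ∀ d d', C d → C d' → d ≠ d' → ∀ m : ℤ, Apart (X d.1) (Y d.1) (ex d) (Y (M.opp d).1)
      (X d'.1) (Y d'.1) (ex d') (Y (M.opp d').1) (m * W)) : M.graph.IsPlanar := by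
  have key : ∀ d d', d.1 = d'.1 → (M.opp d).1 = (M.opp d').1 → d = d' := by
    rintro ⟨u, i⟩ ⟨v, j⟩ rfl h
    rw [M.opp_inj u i j h]
  refine _root_.isPlanar_of_cylinder (E := {d // C d}) M.graph hW (fun d => d.1.1)
    (fun d => (M.opp d.1).1) X Y (fun d => ex d.1) (fun d => M.adj_opp d.1) ?_ ?_
    (fun v => ⟨_, M.adj_opp (v, 0)⟩) hX hXY (fun d => hex _ d.2) (fun d => hlen _ d.2)
    (fun d d' hne => hsep _ _ d.2 d'.2 fun h => hne (Subtype.ext h))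
  · rintro u v ⟨i, rfl⟩
    by_cases h : C (u, i)
    · exact ⟨⟨_, h⟩, rfl⟩
    · exact ⟨⟨M.opp (u, i), (hC _).2 h⟩, by rw [M.opp_opp, Sym2.eq_swap]⟩
  · rintro ⟨d, hd⟩ ⟨d', hd'⟩ h
    rcases Sym2.eq_iff.1 h with ⟨h1, h2⟩ | ⟨h1, h2⟩
    · exact Subtype.ext (key d d' h1 h2)
    · have : M.opp d = d' := key _ _ h2 (by rw [M.opp_opp]; exact h1)
      rw [← this] at hd'
      exact absurd hd ((hC d).1 hd')

namespace Cell

variable (c : Cell)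

/-- The darts selected for the drawing: one dart of each edge inside a cell, and the left
danglers. -/
def Canon (h : ℕ) : Prop := h < c.code h ∧ c.code h < 3 * c.n + 5

/-- The height of the other end of an edge. -/
def endY (h : ℕ) : ℕ := cond (Nat.blt (c.code h) (3 * c.n)) (digit 10 c.Y (c.code h / 3)) 0

/-- The abscissa of the other end of an edge; a left dangler leads straight down. -/
def endX (h : ℕ) : ℕ :=
  cond (Nat.blt (c.code h) (3 * c.n)) (digit 10 c.X (c.code h / 3)) (digit 10 c.X (h / 3))

/-- Apply `f` to the segment that represents an edge, if the dart `h` is selected. -/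
def withSeg (h : ℕ) (f : ℕ → ℕ → ℕ → ℕ → Bool) : Bool := force (c.code h) fun e =>
  !(Nat.blt h e && Nat.blt e (Nat.add (Nat.mul 3 c.n) 5)) || force (Nat.div h 3) fun v =>
    force (digit 10 c.X v) fun a => force (digit 10 c.Y v) fun b =>
    force (digit 12 c.ex h) fun a' => force (c.endY h) fun b' => f a b a' b'

/-- Two segments on a cylinder of circumference `1000` do not cross. The abscissae of the second
ends are shifted by the circumference. If the segments are not separated by their heights, then the
first one is compared with the second one and with its translates by a full turn in both directions,
which suffices for segments that span less than half a turn. -/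
def sepCyl (a b c d a' b' c' d' : ℕ) : Bool :=
  (Nat.blt b b' && Nat.blt b d' && Nat.blt d b' && Nat.blt d d') ||
  (Nat.blt b' b && Nat.blt b' d && Nat.blt d' b && Nat.blt d' d) ||
  (sepTest (a + 1000) b c d (a' + 1000) b' c' d' && sepTest (a + 2000) b (c + 1000) d
    (a' + 1000) b' c' d' && sepTest (a + 1000) b c d (a' + 2000) b' (c' + 1000) d')

/-- The tables describe a drawing of the cell on a cylinder of circumference `1000`, with the right
danglers at the top, at fixed places, and with the left danglers leading straight down. -/
structure Drawn (l r : Bool) : Prop where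
  x_lt : ∀ v < c.n, digit 10 c.X v < 1000
  y_le : ∀ v < c.n, digit 10 c.Y v ≤ c.top
  y_pos : l = true → ∀ v < c.n, 0 < digit 10 c.Y v
  inj : ∀ v < c.n, ∀ w < v, Nat.beq (digit 10 c.X v) (digit 10 c.X w) = false ∨
    Nat.beq (digit 10 c.Y v) (digit 10 c.Y w) = false
  left : l = true → ∀ t : Fin 5, digit 10 c.X (c.lv t) = 200 * t + 100
  right : r = true → ∀ t : Fin 5, digit 10 c.X (c.rv t) = 200 * t + 100 ∧
    digit 10 c.Y (c.rv t) = c.top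
  edge : ∀ h < 3 * c.n, c.Canon h → digit 12 c.ex h % 1000 = c.endX h ∧
    digit 10 c.X (h / 3) + 500 < digit 12 c.ex h ∧
    digit 12 c.ex h < digit 10 c.X (h / 3) + 1500 ∧
    (digit 10 c.Y (h / 3) < c.top ∨ c.endY h < c.top)
  sep : (allBelow (3 * c.n) fun h => c.withSeg h fun a b a' b' => allBelow h fun h' =>
    c.withSeg h' fun x y x' y' => sepCyl a b a' b' x y x' y') = true

instance (h : ℕ) : Decidable (c.Canon h) := inferInstanceAs (Decidable (_ ∧ _))

end Cell

/-! ### Drawings of chains -/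

/-- Segments that pass `sepCyl` do not meet on the cylinder, when they are not too long. -/
theorem apart_of_sepCyl {a b c d a' b' c' d' : ℕ} (h : Cell.sepCyl a b c d a' b' c' d' = true)
    (ha : a < 1000) (ha' : a' < 1000) (hc : a + 500 < c) (hc2 : c < a + 1500) (hc' : a' + 500 < c')
    (hc2' : c' < a' + 1500) (y : ℝ) (m : ℤ) :
    Apart a (y + b) ((c : ℝ) - 1000) (y + d) a' (y + b') ((c' : ℝ) - 1000) (y + d')
      (m * 1000) := by
  have r1 : (a : ℝ) < 1000 := by exact_mod_cast ha
  have r2 : (a' : ℝ) < 1000 := by exact_mod_cast ha'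
  have r3 : (a : ℝ) + 500 < c := by exact_mod_cast hc
  have r4 : (c : ℝ) < a + 1500 := by exact_mod_cast hc2
  have r5 : (a' : ℝ) + 500 < c' := by exact_mod_cast hc'
  have r6 : (c' : ℝ) < a' + 1500 := by exact_mod_cast hc2'
  have r7 : (0 : ℝ) ≤ a := Nat.cast_nonneg _
  have r8 : (0 : ℝ) ≤ a' := Nat.cast_nonneg _
  simp only [Cell.sepCyl, Bool.or_eq_true, Bool.and_eq_true, Nat.blt_eq] at h
  rcases h with (h | h) | h
  · obtain ⟨⟨⟨h1, h2⟩, h3⟩, h4⟩ := h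
    refine apart_of_lt ?_ ?_ ?_ ?_ <;> simpa
  · obtain ⟨⟨⟨h1, h2⟩, h3⟩, h4⟩ := h
    have : Apart (a' : ℝ) (y + b') ((c' : ℝ) - 1000) (y + d') a (y + b) ((c : ℝ) - 1000) (y + d)
        (-(m * 1000)) := by
      refine apart_of_lt ?_ ?_ ?_ ?_ <;> simpa
    simpa using this.symm
  · obtain ⟨⟨h1, h2⟩, h3⟩ := h
    have hm : m ≤ -2 ∨ m = -1 ∨ m = 0 ∨ m = 1 ∨ 2 ≤ m := by omega
    rcases hm with hm | rfl | rfl | rfl | hm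
    · have r9 : (m : ℝ) ≤ -2 := by exact_mod_cast hm
      have := (apart_of_lt_left (a := a') (b := y + b') (c := (c' : ℝ) - 1000) (d := y + d')
        (a' := a) (b' := y + b) (c' := (c : ℝ) - 1000) (d' := y + d) (m := -(m * 1000))
        (by linarith) (by linarith) (by linarith) (by linarith)).symm
      simpa using this
    · convert (apart_of_sepTest h2).translate 2000 y (-1000) using 1 <;> push_cast <;> ring
    · convert (apart_of_sepTest h1).translate 1000 y 0 using 1 <;> push_cast <;> ring
    · convert (apart_of_sepTest h3).translate 1000 y 1000 using 1 <;> push_cast <;> ring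
    · have r9 : (2 : ℝ) ≤ m := by exact_mod_cast hm
      exact apart_of_lt_left (by linarith) (by linarith) (by linarith) (by linarith)

namespace Cell

variable {c : Cell} {l r : Bool}

theorem of_withSeg {h : ℕ} {f : ℕ → ℕ → ℕ → ℕ → Bool} (hf : c.withSeg h f = true)
    (hh : c.Canon h) :
    f (digit 10 c.X (h / 3)) (digit 10 c.Y (h / 3)) (digit 12 c.ex h) (c.endY h) = true := by
  unfold withSeg at hf
  simp only [force_eq, Bool.or_eq_true, Bool.not_eq_true'] at hf
  refine hf.resolve_left ?_
  rw [Bool.not_eq_false, Bool.and_eq_true, Nat.blt_eq, Nat.blt_eq]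
  exact hh

theorem Drawn.sepCyl (hd : c.Drawn l r) {h h' : ℕ} (hh : h < 3 * c.n) (hlt : h' < h)
    (hc : c.Canon h) (hc' : c.Canon h') :
    Cell.sepCyl (digit 10 c.X (h / 3)) (digit 10 c.Y (h / 3)) (digit 12 c.ex h) (c.endY h)
      (digit 10 c.X (h' / 3)) (digit 10 c.Y (h' / 3)) (digit 12 c.ex h') (c.endY h') = true :=
  of_withSeg (of_allBelow (of_withSeg (of_allBelow hd.sep h hh) hc) h' hlt) hc'

/-- The edges of one cell do not cross. -/
theorem Drawn.apart (hd : c.Drawn l r) {h h' : ℕ} (hh : h < 3 * c.n) (hh' : h' < 3 * c.n)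
    (hc : c.Canon h) (hc' : c.Canon h') (hne : h ≠ h') (y : ℝ) (m : ℤ) :
    Apart (digit 10 c.X (h / 3)) (y + digit 10 c.Y (h / 3)) ((digit 12 c.ex h : ℝ) - 1000)
      (y + c.endY h) (digit 10 c.X (h' / 3)) (y + digit 10 c.Y (h' / 3))
      ((digit 12 c.ex h' : ℝ) - 1000) (y + c.endY h') (m * 1000) := by
  obtain ⟨-, e1, e2, -⟩ := hd.edge h hh hc
  obtain ⟨-, e1', e2', -⟩ := hd.edge h' hh' hc'
  have x1 := hd.x_lt (h / 3) (by omega)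
  have x2 := hd.x_lt (h' / 3) (by omega)
  rcases lt_or_gt_of_ne hne with hlt | hlt
  · have := (apart_of_sepCyl (hd.sepCyl hh' hlt hc' hc) x2 x1 e1' e2' e1 e2 y (-m)).symm
    simpa using this
  · exact apart_of_sepCyl (hd.sepCyl hh hlt hc hc') x1 x2 e1 e2 e1' e2' y m

end Cell

namespace CellChain

variable {c : ℕ → Cell} {m : ℕ}

/-- The number of a dart in its cell. -/
def num (d : ChainV c m × Fin 3) : ℕ := 3 * d.1.2 + d.2

/-- The height of the bottom of the cell `j` in the drawing of a chain. -/
def base (c : ℕ → Cell) (j : ℕ) : ℕ := ∑ i ∈ Finset.range j, (c i).top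

theorem base_succ (j : ℕ) : base c (j + 1) = base c j + (c j).top := Finset.sum_range_succ _ _

theorem base_le {i j : ℕ} (h : i ≤ j) : base c i ≤ base c j :=
  Finset.sum_le_sum_of_subset (Finset.range_subset_range.2 h)

/-- The abscissa of a vertex. -/
def posX (v : ChainV c m) : ℕ := digit 10 (c v.1).X v.2

/-- The ordinate of a vertex. -/
def posY (v : ChainV c m) : ℕ := base c v.1 + digit 10 (c v.1).Y v.2

/-- The selected darts of a chain. -/
def Canon (d : ChainV c m × Fin 3) : Prop := (c d.1.1).Canon (num d)

theorem code_eq_of_inn {c : Cell} {v w : Fin c.n} {i i' : Fin 3} (h : c.loc v i = .inn w i') :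
    c.code (3 * v + i) = 3 * w + i' := by
  obtain ⟨k1, rfl, rfl⟩ := Cell.code_of_inn h
  rw [show (c.dartV _ : ℕ) = _ from Nat.mod_eq_of_lt (Nat.div_lt_of_lt_mul k1)]
  exact (Nat.div_add_mod _ 3).symm

theorem canon_left {c : Cell} {v : Fin c.n} {i : Fin 3} {t : Fin 5} (h : c.loc v i = .left t) :
    c.Canon (3 * v + i) := by
  have := Cell.code_of_left h
  constructor <;> omega

theorem not_canon_right {c : Cell} {v : Fin c.n} {i : Fin 3} {t : Fin 5}
    (h : c.loc v i = .right t) : ¬ c.Canon (3 * v + i) := by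
  rintro ⟨_, h2⟩
  unfold Cell.loc at h
  split_ifs at h

theorem canon_opp (hc : IsCellChain c m) (d : ChainV c m × Fin 3) :
    Canon ((chainMap hc).opp d) ↔ ¬ Canon d := by
  change Canon (opp d) ↔ ¬ Canon d
  obtain ⟨⟨⟨j, hj⟩, v⟩, i⟩ := d
  rcases cases_loc hj hc v i with ⟨w, i', h1, h2, h3, -⟩ | ⟨t, hj', h1, rfl, rfl⟩ |
    ⟨j', t, rfl, h1, rfl, rfl⟩
  · rw [opp_inn hj h1]
    have e1 := code_eq_of_inn h1
    have e2 := code_eq_of_inn h2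
    have hne : (w : ℕ) ≠ v := fun h => h3 (Fin.ext h)
    change (_ < (c j).code (3 * w + i') ∧ _) ↔ ¬ (_ < (c j).code (3 * v + i) ∧ _)
    simp only [num]
    rw [e1, e2]
    omega
  · rw [opp_right hj hj' h1]
    exact iff_of_true (canon_left (left_ok hc hj' t).1) (not_canon_right h1)
  · have hj'' : j' < m := by omega
    rw [opp_left hj'' hj h1]
    exact iff_of_false (not_canon_right (right_ok hc hj t).1) (not_not.2 (canon_left h1))

/-- All cells of a chain are drawn. -/
def IsDrawn (c : ℕ → Cell) (m : ℕ) : Prop :=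
  ∀ j, j < m → (c j).Drawn (decide (0 < j)) (decide (j + 1 < m))

theorem num_lt (d : ChainV c m × Fin 3) : num d < 3 * (c d.1.1).n := by
  have := d.1.2.2
  unfold num
  omega

theorem num_div (d : ChainV c m × Fin 3) : num d / 3 = d.1.2 := by
  unfold num
  omega

/-- The position of the other end of a selected dart. -/
theorem pos_opp (hc : IsCellChain c m) (hd : IsDrawn c m) (d : ChainV c m × Fin 3)
    (h : Canon d) : posY ((chainMap hc).opp d).1 = base c d.1.1 + (c d.1.1).endY (num d) ∧
      digit 12 (c d.1.1).ex (num d) % 1000 = posX ((chainMap hc).opp d).1 := by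
  have he := ((hd d.1.1 d.1.1.2).edge _ (num_lt d) h).1
  obtain ⟨⟨⟨j, hj⟩, v⟩, i⟩ := d
  change digit 12 (c j).ex (3 * v + i) % 1000 = (c j).endX (3 * v + i) at he
  change posY (opp (vtx hj v, i)).1 = base c j + (c j).endY (3 * v + i) ∧
    digit 12 (c j).ex (3 * v + i) % 1000 = posX (opp (vtx hj v, i)).1
  rw [he, Cell.endX, Cell.endY]
  rcases cases_loc hj hc v i with ⟨w, i', h1, h2, h3, -⟩ | ⟨t, hj', h1, h2, h3⟩ |
    ⟨j', t, rfl, h1, rfl, rfl⟩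
  · have e1 := code_eq_of_inn h1
    have hlt : Nat.blt ((c j).code (3 * v + i)) (3 * (c j).n) = true := by
      rw [Nat.blt_eq]
      omega
    have hdiv : (c j).code (3 * v + i) / 3 = w := by omega
    rw [opp_inn hj h1, hlt, hdiv]
    exact ⟨rfl, rfl⟩
  · exact absurd h (not_canon_right h1)
  · have hj'' : j' < m := by omega
    have e1 := Cell.code_of_left h1
    have hlt : Nat.blt ((c (j' + 1)).code (3 * (c (j' + 1)).lv t + (c (j' + 1)).ls t))
        (3 * (c (j' + 1)).n) = false := by
      rw [← Bool.not_eq_true, Nat.blt_eq]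
      omega
    have hdiv : (3 * ((c (j' + 1)).lv t : ℕ) + (c (j' + 1)).ls t) / 3 = (c (j' + 1)).lv t := by
      omega
    have hl := (hd (j' + 1) hj).left (by simp) t
    obtain ⟨hr1, hr2⟩ := (hd j' hj'').right (by simpa using hj) t
    rw [opp_left hj'' hj h1, hlt, hdiv]
    refine ⟨?_, ?_⟩
    · change base c j' + digit 10 (c j').Y ((c j').rv t) = _
      rw [hr2, ← base_succ]
      rfl
    · change digit 10 (c (j' + 1)).X ((c (j' + 1)).lv t) = digit 10 (c j').X ((c j').rv t)
      rw [hl, hr1]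

theorem posY_le (hd : IsDrawn c m) (v : ChainV c m) : posY v ≤ base c (v.1 + 1) := by
  have := (hd v.1 v.1.2).y_le v.2 v.2.2
  rw [base_succ]
  exact Nat.add_le_add_left this _

theorem lt_posY (hd : IsDrawn c m) (v : ChainV c m) (h : 0 < (v.1 : ℕ)) : base c v.1 < posY v :=
  Nat.lt_add_of_pos_right ((hd v.1 v.1.2).y_pos (by simpa using h) v.2 v.2.2)

/-- Edges of different cells do not cross, since they are separated by a horizontal line. -/
theorem apart_of_lt_cell (hc : IsCellChain c m) (hd : IsDrawn c m) {d d' : ChainV c m × Fin 3}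
    (h : Canon d) (h' : Canon d') (hlt : (d.1.1 : ℕ) < d'.1.1) (a b a' b' x : ℝ) :
    Apart a (posY d.1) b (posY ((chainMap hc).opp d).1) a' (posY d'.1) b'
      (posY ((chainMap hc).opp d').1) x := by
  have e1 := (pos_opp hc hd d h).1
  have e2 := (pos_opp hc hd d' h').1
  obtain ⟨-, -, -, e3⟩ := (hd d.1.1 d.1.1.2).edge _ (num_lt d) h
  rw [num_div] at e3
  have e4 : (c d.1.1).endY (num d) ≤ (c d.1.1).top := by
    unfold Cell.endY
    cases hb : Nat.blt ((c d.1.1).code (num d)) (3 * (c d.1.1).n) with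
    | true =>
      rw [Nat.blt_eq] at hb
      exact (hd d.1.1 d.1.1.2).y_le _ (Nat.div_lt_of_lt_mul hb)
    | false => exact Nat.zero_le _
  have e5 := posY_le hd d.1
  have e6 := lt_posY hd d'.1 (by omega)
  have e7 := base_le (c := c) (Nat.succ_le_of_lt hlt)
  have e8 := base_succ (c := c) d.1.1
  have e9 : posY d.1 = base c d.1.1 + digit 10 (c d.1.1).Y d.1.2 := rfl
  rw [Nat.succ_eq_add_one] at e7
  refine apart_of_le (τ := base c (d.1.1 + 1)) ?_ ?_ ?_ ?_ ?_ ?_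
  · exact_mod_cast e5
  · exact_mod_cast (by omega)
  · simp only [Nat.cast_lt]
    omega
  · exact_mod_cast (by omega)
  · exact_mod_cast (by omega)
  · left
    exact_mod_cast (by omega)

theorem pos_inj (hd : IsDrawn c m) {u v : ChainV c m} (hx : posX u = posX v)
    (hy : posY u = posY v) : u = v := by
  have key : ∀ {u v : ChainV c m}, posY u = posY v → ¬ (u.1 : ℕ) < v.1 := by
    intro u v h hlt
    have h1 := posY_le hd u
    have h2 := lt_posY hd v (by omega)
    have h3 := base_le (c := c) (Nat.succ_le_of_lt hlt)
    rw [Nat.succ_eq_add_one] at h3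
    omega
  have h1 := key hy
  have h2 := key hy.symm
  obtain ⟨⟨i, hi⟩, u⟩ := u
  obtain ⟨⟨j, hj⟩, v⟩ := v
  obtain rfl : i = j := by
    simp only at h1 h2
    omega
  have h3 : ∀ {u v : Fin (c i).n}, digit 10 (c i).X u = digit 10 (c i).X v →
      digit 10 (c i).Y u = digit 10 (c i).Y v → ¬ (v : ℕ) < u := by
    intro u v e1 e2 hlt
    rcases (hd i hi).inj u u.2 v hlt with h | h
    · exact natBeq_eq_false.1 h e1
    · exact natBeq_eq_false.1 h e2
  have hy' : digit 10 (c i).Y u = digit 10 (c i).Y v := Nat.add_left_cancel hy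
  obtain rfl : u = v :=
    Fin.ext (Nat.le_antisymm (not_lt.1 (h3 hx hy')) (not_lt.1 (h3 hx.symm hy'.symm)))
  rfl

/-- A chain of drawn cells is planar. -/
theorem isPlanar (hc : IsCellChain c m) (hd : IsDrawn c m) : (chainMap hc).graph.IsPlanar := by
  refine (chainMap hc).isPlanar_of_cylinder (W := 1000) (by norm_num) Canon (canon_opp hc) posX posY
    (fun d => (digit 12 (c d.1.1).ex (num d) : ℤ) - 1000) ?_ (fun u v => pos_inj hd) ?_ ?_ ?_
  · intro v
    exact (hd v.1 v.1.2).x_lt v.2 v.2.2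
  · intro d h
    obtain ⟨-, h1⟩ := pos_opp hc hd d h
    refine ⟨(digit 12 (c d.1.1).ex (num d) : ℤ) / 1000 - 1, ?_⟩
    rw [← h1]
    push_cast
    omega
  · intro d h
    obtain ⟨-, h1, h2, -⟩ := (hd d.1.1 d.1.1.2).edge _ (num_lt d) h
    rw [num_div] at h1 h2
    change |_ - ((digit 10 (c d.1.1).X d.1.2 : ℕ) : ℤ)| < _
    rw [abs_lt]
    push_cast
    omega
  · intro d d' h h' hne x
    rcases lt_trichotomy (d.1.1 : ℕ) d'.1.1 with hlt | heq | hlt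
    · exact apart_of_lt_cell hc hd h h' hlt _ _ _ _ _
    · have e1 := (pos_opp hc hd d h).1
      have e2 := (pos_opp hc hd d' h').1
      rw [e1, e2]
      obtain ⟨⟨⟨j, hj⟩, v⟩, i⟩ := d
      obtain ⟨⟨⟨j', hj'⟩, v'⟩, i'⟩ := d'
      obtain rfl : j = j' := heq
      have hne' : 3 * (v : ℕ) + i ≠ 3 * v' + i' := by
        intro e
        obtain rfl : v = v' := Fin.ext (by omega)
        obtain rfl : i = i' := Fin.ext (by omega)
        exact hne rfl
      have := (hd j hj).apart (num_lt (vtx hj v, i)) (num_lt (vtx hj v', i')) h h' hne'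
        (base c j : ℝ) x
      rw [num_div, num_div] at this
      simpa [posX, posY] using this
    · have := (apart_of_lt_cell hc hd h' h hlt (posX d'.1)
        (((digit 12 (c d'.1.1).ex (num d') : ℤ) - 1000 : ℤ) : ℝ) (posX d.1)
        (((digit 12 (c d.1.1).ex (num d) : ℤ) - 1000 : ℤ) : ℝ) (-(x * (1000 : ℕ)))).symm
      rwa [neg_neg] at this

end CellChain

/-! ### The core, the tube and the cap -/

/-- The core, with right danglers only. Its first `131` vertices and `64` faces are the set `Z` and
the faces inside it of an obstruction. -/
def cellC : Cell where
  m := 212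
  f := 104
  opp := 0x2786ca6b759de9b67e9424a7ee7264674835f88e2669e65e9f24490a559966e99e63991cd7560293e6c96a578fe5d7d6339722e9a1da84a5194a7797e48801b86d67691e4e9262d6fa6a796698e63e96e408edf78f5a69066f8d5ac8dde4962178c23173e5691a0f7f1ee81221a1dce88e08895d18a1977cdd9751f0681d3862198ca1468e167da536e60e8b2109c684819c7a22248160b81e29772606f24d7f58e7fe2b9d5d87ca708f213965f187df97d21c7b62a7bdc67a1e3789eb70dbd90e347a9e977dba7867a75e0371254879fa7767b9861d8699a889c98be26989ca6fdcc74286829ec701db79dbba15c572e4579a01709e08464c625b492db66c67d6cdaf6c0386ae366b5a96a8296963a69da2855a467e1b6859d6781a665d266d968819865195039909cd92635fe63d8b630026dcb42fc744a1256098333d4c5e17b5d56f5f8ad4e97f3e92a5f57258d745c1715f16d5b8e73b09b2b9675a100591655cd60395622013b36c774a554029513f8103d55a40530561363994b521805384e2694d3403a4fcbc1503149c845153d4f83d579793e0ac4cd5004d2d4dd1b3d9524b92f4d10d3e57656d855051e611212d8b74911f481260d10e4c816455040707e464b340906441114311c4b10f4290b41ce8425123ad182051354d66259573dcfb3f1774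ad393f531554f101cee3d097010f21496b414822ad085b14f5844d334df37076388d6100e1574d31c0d7360de32c72368d134947604ca38c43354ce1a4c1310be214c72ecb8320b561cc62214430cb92e8c248923301884501f1f451261695e9383a479298a3168a92809d2a05d088a51f04b2904a5a9491a8af3c0ff2389122c6725058154950b82b24c651b0bd21887315401fcea40d5f20d162c49f1e87b2a84c570e01c5861b4d41d4d91b86f1cc8914c99324642484622868188631245e16c602882517ca713c901585723d431aced2c0451654a390782789c18447120661400033041108dd0f83f4f03b0f1460ddae0e4350d91d0c8335082f0c08d0b02d230286a02a0982717023090a1080212c81d079170659c06c170611a050154d411049560359303c0b03159020093cc05018ef0058a00c44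
  zl := 0x0
  br := 0x20989dc87060c
  lab := 0x681384d1685b1784e1a0641186211c471885017866168551a04d198671605a198581685815855174681846519c651846019c651605d14864174641a04f18c4513c4e1906313c6415055134671984c184671304b1844c130661784d1305e19460164651645818c641885f15c481b06b164481b05917c4811c5c16c56128491644a1646012c4a180641485018864140691b4571b46c120571b44814c5d1544518c461186318850170471844b1805c17c4717c5c1585717c561445417854144531504d17851178501405e16c5d14c5216c5c1405b16856164491206b16059158581a86a1606b1a4571585214c511a8691585515053148511404f114421384f1084d138421344210c4c13443130431104b130441284b110491284412444100481244011c481004710041118471044511841114411083f0f83d0f03b0fc3c0fc3a0e4380dc360dc380d4380e4340e4370cc340dc330dc360cc360c8310c02f0c42f0d0310d0330b8310cc2d0b02b0a8340a42809c2a098290d02509c280c4240e83c0e82408c310e822084200f01f0782d080210b4210b0380d41d070250a01b0941c074270941d0941b0a8390d03b0f01e0fc3b068220683b0883b0781906c1c060170642e05c1806416054190541b0741b0541d054320c8150581905c16098340bc2a09c350a8350e41d0d4270a42605013050260481404c330c8160d81d0c8240c42e044100ac0f0ac100b0110ac230380f08c0f0403f038230fc230e8120401108c100483e0340c0800c0341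a0343e0f43e030220800d0880d0683f0683e0b81802c3004c2f0d8380740a0240801c08024060280802c0702424028060c03108c2f04c260140400c0200c0407c0401401014030b43d0302d0302005c330582e0cc170b80b0242e0240a0b42b03c3f0f40e0b40f0382d0383d0483008c0000c020040300001000060200101807004080f0020103c0101f0c01204c240083c0902e0282401800090000084204811108110b0420b02110821088431082210c22078430781f10c1f01443014011104300444004071100702c4402c18110180644011019100190704007028100280a8411002a1042a0a4410a414104140484210412
  X := 0xef4c0dc1b4925a4fa70585590f28322d7fce3394892f8a0435bf7e21c615689163025c44af3160b8dfae27396cd32a864e10173d8731f4a18dc7b2808843d024b0ff408ef35927c0e4b605f42ccf54b1023b488300f84e5867c22799eb3be73bed3cb0d8531407d7d271ceb32cfb3ecc32cc8b54d2b25bd83fdbb4adcb3eb1687bf8bd784961cf39ce32ece32ed45cb5dd5963324baedfc471ec9321c5effd9344d1b3de0f83e5314c9acb050050d3b6f2b6bbb803ef4b72d0e8228d3418fab076dcc68da2283a5a87d1f7189e388422e1ac92c0af2a9e9e0600000c25e0649926639d2758da0de065da966d97020120833412e609ca7f21b89664a4abcb8afec7f3cd778fe1b96ee015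
  Y := 0x1376d93d559726c94a705cb7c14f6e5b773558531314d53b55da969d9365160725ee532059622c725c86d1b468561582589623c55d38525a1691c27720b5ad635857c6815b6b9cf756358d6588f9639615b5ad214991d3e92d4ad6e62d915d9a0651535212e428100041039ce73b4e235ce23a09c2d0c22ec6238d0533d041944d1285a1945318cf0425063fd003983b0402e12d093c4e13ccfd3e8f23bced2f8f93bcf8334bf2e8e93b4991bc5e1c435160100047f1d0260d41c0803f0b401378a73b0bd318b4340a91e4b72448a228a10a43b390d5338bc14c010e02121490274a52d4c71f079288712a89d2289a200751f0a51e47b24cb43a0d936cea41131465114451d3ccd9330d0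
  ex := 0x4c44e04e250f4ea5514d74cd4a646547a41e45549248956d56d5184da4d74f55a75e756d5515a954c56d56950f4de4cd4e26155e75e05f461f62d5f46185a94d74bb4cd4cb4c44da48845b4704a84c44884714a647f4ea4e25145a956d5e05f45a760461f5e060f5a755155056e56d51461565b61862d6335e74884924654703ff4160006336fe76c6a46eb42c3b44634be50f48869b6eb65b6a062d64364f65b61f4cb4d549247f4bb47a0003ff49b0006fe7e744c38442c4d74da4ea47146543b45b47f4554be46347a6046436154884164894634c747042c48849b4ea5144e74f74dd4ea4f55504f74f74ea4d54e75184be4de4dd4cb4c74894ea51854c4c76a07236fe5dc6186a454c5dc51456963300044c4705144d74ea4d500049b5694f54ea4de4dd4e74bb4714384a84a64704e04d74a85214e051656e5505215d856e60d60f6045d864f64360f69b6a064f6e169b6e67236eb6e179c7fe7237b379c7778064553cb43b45b41e43843b3fd4704e24723e85b355f6595dc6d666f72671a72671472271972172272e73972271870d72671471871a70a71470e6fc72f75573273c74c70d7327186de6b370d6da45b41c40073975a76e72672c74576b75674c7207327206b366f6e66596ad64572f6ad6d64b847e4bb5f55b25b347a4a545b47e46b42772672571971672672471672070c7257267167207167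0c72e7267565dc5c95745dc5414e24ee55f5745415b356a7067167076c76e76ca6da6d36a96e76ff7066f970c70c71670670970c6ff70e7096f96fc6d36ea6f975a73275973272572e72c72673972172c72075a76b77e77c76b7597a076b76970a6ff6ea71970970a6ad6de68d3eb3ed41c4003fc3ca4303fc4277537d37b279e7d57a57d079e6d67536e66593bd3fc4087b27d37694d049c47247a49f4bb4ee49f4e246549f4534a549c4ee4bb4d054155f4d04656c76a468f76975973c71a72170e68667066b65d67567e66f67565c67a67068f68d66b65573c6e676975576b74c5f862061663160f61e5f560f5e460360f63140d47247a45349c47e6da6fc6e76de6ea6c76a967e68668f67568d4273ed3eb46540d36b4003b640d3eb3e845376972f7a563162064461663164b63165565c65d64b66b64c65c6706456205f561e5f85c976977c75564461e66f6b368666f66f64b6446556316453fd3eb43040841c46b43045b4b846b4a55165214b856a5165745b256a5c95e45b25f86035e461660d5d860364c60d65d67a64c67e6a467a6a96ca6a46d36e66e16ca7076e670c7247077207457247327777b374576e77775677e76e76b7a077e77c7e54383b8408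
  top := 600

/-- The tube, which can be repeated: a face cut by its right curve has a multiple of `3` corners in
it, as in the core, so that the tube or cap behind determines the length of the face modulo `3`. -/
def cellA : Cell where
  m := 65
  f := 32
  opp := 0x164c11a46f310bf300500e834218cd1303e1dc9f29cb32d0132c0b122c8f298a9028a32b0a02d4ad040072a8450fca82d89a1cc4117c9e2348c07094238962489307c622b895264982bc1621437138bb2247c120cf1a05b0a06533884160cc1d8562dc7914c6d274711c85d308461d0041786730c811a8601f843134901686626c6b1c022200613147b13c780f02e1d4cb124be15c8718cb91284b144831006e2883d1902b27047284b811055000bd0e039220350d8bc0c4ca0cc2f0c0540b02d108290a87f094c909c230905c080212441d07897064c806c170608a050152c811048a5034c703c0b030ab02009290050186c004c600c3b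
  zl := 0x320981a03802
  br := 0x821f4ba1e852
  lab := 0x901b070050701b0141b048220442306013050170800905c09028170281f0202001c1501c20024200200601c1505c1508017078160741e05c1f02c0c0741f0301d0300d05c1f0740b07c0a06811048230441a06425090190380f09023068220841406014084050581e0141e07006058050701d090190901d0640f04c1d034190781d0700d0381906c240682205010060210941206c1a064130601906025054160181004c0f05c160541404c1001005048040481101011088030102200c22040030400f00c0f0380200c0e0080e034020340c0080c02c010080b0040b02801028090040902000004080000801c0001c06000060140400005
  X := 0x89ddc66df410d836a9d95555b5ad4a5cda6782138a26f7d5eb70e26e133caf12c271977494c95edce8eb980ee19046b191e0f9c0056fc55f02f459443c784f3f97cbebcab66c899f4759a35a52c4e1273c864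
  Y := 0x5e9404f6587746e1c0851806f17c731ecba34c8329cc62a87569a1d960fe962588bcc6424905919b57d16454e172da19618f7362a221542519b39d46514323c5002ec32238961b8321585c13c321446218432
  ex := 0x6295c463f5ba60f5835c45c84fe4d960e0003e741748455b55359256b58b5c15925d35dd55354352053253d55b56b53d55150f54354356454356b5c857f5645eb58e5dd5d360e6105dd5fb6576106546a15c16105c85fb5c15be60e52c5c85dc5ab6a47d00006c46c971778b00060e62900048445342b51444c53458e5ba57f5eb5c454357f4da5eb6c460f76c63f6a17247ad7cf6576c96c45c863f5ba6957246a160f6a45c85144173cf4840003e85836295ab78b8137d03e744c3845645345327ff78b77f58e54355b42b3c545344c58352c4fe5ab4d952c5dc38476c8c17b776c83b77f7b77ad71777f7246a46a47176956a46c965469565760e6545fb5dc5dc60e5be5dc5d358b5be59255158b55351451455152051453d50f5205324da50f53444c44c4da4fe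
  top := 600

/-- The cap: a pentagon whose vertices are the ends of the left danglers. -/
def cellP : Cell where
  m := 4
  f := 5
  opp := 0x10241301c120341102c0501802040040380f
  zl := 0xc0280800c00
  br := 0x0
  lab := 0x4014030140200c0100805004050000001404
  X := 0x384af1f44b064
  Y := 0x3c1403214032
  ex := 0x8346a476c5dc6a476c5dc6a45145dc44c51451438444c
  top := 100

theorem valid_cellP : cellP.Valid true false := by
  constructor <;> decide +kernel

theorem valid_cellA : cellA.Valid true true := by
  constructor <;> decide +kernel

theorem valid_cellC : cellC.Valid false true := by
  constructor <;> decide +kernel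

/-! ### Face lengths of the three cells -/

theorem corners_cellA :
    (∀ x, cellA.corners (.inl x) % 3 = 2) ∧ ∀ t, cellA.corners (.inr t) % 3 = 0 := by
  decide +kernel

theorem corners_cellP : ∀ x, cellP.corners (.inl x) % 3 = 2 := by
  decide +kernel

theorem corners_cellC : ∀ t, cellC.corners (.inr t) % 3 = 0 := by
  decide +kernel

set_option maxHeartbeats 4000000 in
/-- The five darts that leave the first `131` vertices are `26`, `14`, `2`, `56` and `41`. -/
theorem obstructs_cellC :
    cellC.Obstructs 131 64 (26 + 14 * 2 ^ 10 + 2 * 2 ^ 20 + 56 * 2 ^ 30 + 41 * 2 ^ 40) where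
  le := by decide +kernel
  lt := by decide +kernel
  leaves := by decide +kernel
  inj := by decide +kernel
  stays := by decide +kernel
  face := by decide +kernel
  face_prev := by decide +kernel
  face_lt := by decide +kernel
  face_ge := by decide +kernel
  corners x := by
    rw [Cell.corners_eq_labCount]
    revert x
    decide +kernel
  cornersBelow x := by
    rw [Cell.cornersBelow_eq_labCount _ (by decide)]
    revert x
    decide +kernel
  card := by decide +kernel
  card_le := by decide +kernel

/-! ### Patterns in the three cells -/

/-- The states in which two consecutive danglers are connected, or two nested such pairs. -/
def pairStates : List ℕ := [
  18049, 18000, 17608, 14472, 1676, 5344, 14346, 668, 9985, 16467]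

/-- The states in which two danglers at distance two are connected. -/
def skipStates : List ℕ := [
  17930, 17048, 9992, 16523, 5792]

/-- Patterns in `cellC`: for each edge, given by a dart, a right state and a cycle pattern without
its ends. -/
def patternsC : List (ℕ × ℕ × ℕ) := [
  (0, 5344, 0x5194aa2418642019452146a81644a1522111145a54504a2182a2249418a44869550650a41489949aa5a86208244950b948924a2623),
  (1, 5344, 0x266a48a081864241945a19aa81664a152211114514209895818580a69908094060895054a4a668890558994a4884996621222264a4f),
  (2, 16467, 0x58562a1519185616929a606aa459562651486684c9a4512812068925a080958a2029065242568016184292a2499441626222265153),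
  (4, 17608, 0x106089152668145459aa89a2841a406498616a184a95222451a046525650995866ae8a0a116241204a094994202254a49152921514d),
  (5, 18000, 0x101125941918258086a85814a41121626114612884a69258652515025a109584a0a958880051a1409a6294a212222615149924913d),
  (7, 16467, 0x2a8849a12a4462646229a806a41aa060598a6118602219651a9800802109922155d1282550a661548a5292828022246621259489138),
  (8, 18049, 0x2a1664a09111a5280911a2656a996182404a4612882844a29105209429096546a2245a21582561948a5a248628229966248994888f8),
  (10, 14472, 0x1994a64958611981822216144401258695a144a2102219658e505149210a642655581588a42561548a09248a28225866512294888e4),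
  (11, 14472, 0x96566a241918541851a159441602985a21111451650924861089126998a0820a05925a10825498166a4292199862809488852623e6),
  (13, 1676, 0x9156601419a890a846164584a412986a6111145a45092145888a66690a425454882682510051489a50980228244540894922564f8a),
  (14, 18000, 0x158a104951866958286a8a0915069161646646134845a2246652422295a0995848528a889142152a1a5a49562244958a4a498915388),
  (16, 18049, 0x198a14495106696802a9aa0960a221805866188449209889a7551129890842822059558a6698aa8160099920865952124a222214d24),
  (17, 14346, 0x1149110498828692a169a28a5a4464aa14a8a2884584a28462626259a2982011599894900516161829894a4129914a56484913d24),
  (19, 17608, 0x1092145894041291545282228a994a968064a118492528a5a545190d8426648664505a8a52192554aa502424209285164a245513888),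
  (20, 18049, 0x10621048a6061958685881981a99910a006486184890125299a5a8925208295826a41a211825608144502486288689662624524f888),
  (22, 14346, 0x8156610a6988221045014616a596a9aa114a112a28a4548680246048253289888080588a562426251584491949991964a52224e494),
  (23, 5344, 0x9694aa241864241845a159841602a15221111451658448868258219418842828a594065256249a8065a4951982099a48889223e626),
  (25, 17608, 0x51912a54186441409a284694a455066a6111a45a59a692596504a59260a24254a5a950a256a61014a01808088294864912448f8a26),
  (26, 14472, 0x2a14a505016a181604624869441a68849a1144d2a64528a51542408485a1928164514508829205680aa65251912026a12149893888a),
  (28, 18049, 0x914aa09411a5985910861410a1010a104a46184a852895146246494652d48655004a10996240625129469555299588915288d2491),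
  (29, 9985, 0x266a1058aa04650aa585685010a69960598a6884602092629a1519698056289888501825508495961a52944282468548912593d2121),
  (31, 9985, 0x2a9a88489821698aa21162141a99a562418a44a2118504a20a1a04802221454695506056429a2d414a0996884246566121529389121),
  (32, 9985, 0x1986a4166a28146a0599600161a02a9141a1688461884494456255594a22648662004054a6192496915824295499959491528f88891),
  (34, 14472, 0x1566a4496a211941922a19a680a6458499a144a2124098a5065244a928a4454651504894929209a2daa456595199269248928e14888),
  (35, 668, 0x261812a481464424099014696065500a12111a45a520921450a804a9482624855182650a669a2094810990808422546488923e6264a),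
  (37, 5344, 0x9698aa541a14441852a15944a412a162611114515809224465259692a202545515a45908a1925aa1aa62059592b898951493964a26),
  (38, 18049, 0x1984a649516119680229a6056401218254614484489a4554646059025a0a9820510102610825606041012996242244a52124f889491),
  (40, 14346, 0x9112489411a9a14210161460a1156a904a44a8488a45546a9a9902920a642648882248a690a068a58654962a504a122123e489124),
  (41, 17608, 0x269a10a4888644940992882941665065a288da44649a4512a10599142a090958a20a92610825680905502946288489652124e262156),
  (43, 18000, 0x198a88596a21625802aa880140a2221419a6188460258492046820a04909429a1150a06564256828200b265a2490541626234889488),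
  (44, 14346, 0x220011490151896102281985606215689a1484a2888a455226526a092a20995811500248a6112456905246262646858a264f5514888),
  (46, 9985, 0x2a6a8848aa21696a021961a56a996562418a44a2102844884128209259089940a25160656690a596128c594a24995456248e8915148),
  (47, 5344, 0x2282481091988241929a1a02816206152114a8a2109092521805a4a6920a442688080a21182568814521262629292aa2263e2212494),
  (49, 9985, 0x9149111498a29a52a04a1015020619244a68a848252222a1251d1255089958a6269261482565161aa629462929894921398915151),
  (50, 1676, 0x1986a4496a2119680228180560a2218899a14484628a4508656a15194a5298982226a5a14a90820140a659819529226148f98888891),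
  (52, 14472, 0x2a681658aa4465018586145044012986958a6884602844a441a82890480d228162a560656690a1814a84508a2886486624e29249148),
  (53, 5344, 0x109210a494041496651242141a9998624064a11849909889146899604a2192811125682512192281440122819029406493e44889491),
  (55, 1676, 0x1966a44a6a21194a8219619441a0258581a484a211286252a6552619245698200a51158a654890a8a0588990849095164f922488888),
  (56, 18000, 0x269a10a4888644980992882941665215228d1a44652504884905955420252958a6588054a6192122565224995a592a9093952262126),
  (58, 5344, 0x5698aa541a14441952a15a68a454a16261111451425a224608531248509229948a685a148a665098a589022888499a54d22256264a),
  (59, 14346, 0x5198a4941a1492152201466aa45456aa6111169a54018a509aa22594188928166896056414892a8a9588298409091153d2224a4a26),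
  (61, 14472, 0x2a6465a211518216020642654a586484891484a2125a4552280880c691a244268808224a26920856150956442a46584a3a485212494),
  (62, 17608, 0x90566114198825102aa85814a412696a614a8a2884299098462426949a2989811269588a542162820a4495a25902210fa484912491),
  (64, 17608, 0x261811a50146441409a280694a45506686111a45a4858488510a08a69a082958a008a0e564a666090101944286444260e1244964a56),
  (65, 16467, 0x1092105894041291645082101a999a1a0064a118488844a281a268904a09228122a5558880256689a8a4202a2184810be6222549148),
  (67, 9985, 0x198a88056a2a686802a8180960a2221819a618846142195518aa008251a2442655802a0a754a1854a1092624265256138a485489488),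
  (69, 18000, 0x9894aa151844258022a86054a412216251161121225a8a5965064a29456082048599a10982549016a58292558869b0e24929249124),
  (70, 668, 0x1162885a6a211206944560628a98480409a4848462258488654502248951629a202480656562422a90a644919744228c8a492488891),
  (71, 668, 0x2a1a884881a14921421018546162250922111169a64a45484462488258a42958115805908a92066800845459549042bd48884965626),
  (73, 18049, 0x2684610111588958222882051a45910a0514a11210921965998066469222982064a51a211a1121414a2149862936287896545212121),
  (74, 18049, 0x1584a24951611958222886051405910a146144844a20188989a58a594056648626a45894916242a2745244995259813a51258888888),
  (75, 9985, 0x1618a4a5121190a9205665410a00560591484a2125a45146565a21949a298986202806502110016b5a64981912926e126492488891),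
  (76, 5344, 0x2a0849a101464264086a11896a41206246148612889a45520805a886920a442688080065242568606501263a2a524ad226245212494),
  (77, 14472, 0x106214a4a6041456551a41a68a9948868061611848821949890a9946920a9820a4593588a690a14166a4598a298689ca51229212124),
  (78, 668, 0x10921458948412a654516a22a51a4881606161184a4a4552a467aa0258a66426112412508a11005484a6448559228b6124899489491),
  (79, 5344, 0x9898a1651a84464099a1601616020616114aa12119299099a9064a98222989808a695210a192220600129919652e31126545212121),
  (81, 18000, 0x46911a52686645809aa89a94506521525161a121095a2120215a8a2960a942588528065242563225601229a2a594e9226244889148),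
  (82, 16467, 0x260461a10151825122288985106696181a1484a28a8219092a9a8a002251954515ae6a9099624268a48642955a504e124a492489124),
  (83, 9985, 0x2a1889491161692a02216a65641a6560584a44a2885584886100662698a69820a001806500051220415289928c222ca524959212151),
  (84, 16467, 0x5656201419a89610469a5a96a45596266111145155a45486808ae048189629a8858225209489168a658849448903815249224a2626),
  (85, 1676, 0x9656601419a894a846965984a412986a6111145159a694990005946960a082088091a121a98aa4161ac99244586300891245262656),
  (86, 16467, 0x22801159115182640869aa016062106059148612119219491905888692209221a425050a269a256a160992508a44f9888a484914891),
  (88, 17608, 0x10621458a6041251545a81a28a994a968061611848258492029580a02909995811a48054a4a660225472969a4929e98a21258889148),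
  (90, 1676, 0x198a144a6a0669680298100961a0218981a61884604a6949a442620695a29820082512508805125e50098986465b525126485212491),
  (91, 14346, 0x226210589111a20682856a5040a21464991618a211509889146880a049a1028111256a0a114a1aa824092254224f50088a485249491),
  (93, 1676, 0x1966a4496a21194a8229699440a2258499a484a2105522546658a20925a29820550120650005104355098982824d544926484888891),
  (94, 1676, 0x10621458a6041568599811a2aa99418a8064aa184a552212a545a21425899958262692520825402064218994493d2a1126244888891),
  (98, 668, 0x19888a05516a686402a816096401200a146618844a909254488588a48251629a4880089610a644aa1584945842f446924a484912488),
  (100, 18049, 0x10621058a6041558699881901a99910a0064aa184a558488446880a259a298201125a58a0292020144a4598823e920654a484889491),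
  (101, 17608, 0x56912a54186445409aa85a94a455066a6111a45165012486928a2194188629aa6582252082541a8a60b84944ae05809248924a4a26),
  (103, 18000, 0x589124a51864958285a860911649161611486121128625454680892542664264a00250a669a209691729480875944548a252489491),
  (105, 14472, 0x10621458a6041541959a11a28a9949868061688449209252a46055225856642611241250ad489094805224855c22286488959489491),
  (106, 5344, 0x198a885a58216296228642011a98a46049a618a212929925a65586202a519958515a9a8a11624128ae2949942d20990a4a522489124),
  (108, 14346, 0x2a081559014442610468198160622a989a1161128a5018898925809041892281a6595065256241814609e0893a465a6221229249124),
  (109, 1676, 0x1964a64a6a611928020414656418618899a48484605862522460621945a298980a50024a240514aa10a486573584248a26484912488),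
  (110, 18049, 0x1964a64a6a6119280205a4656418618059a48484618a4548646aa6025a5298201125205481489268a4528991f250221126552489491),
  (112, 9985, 0x1162884a6a21194a9219619411a0056141a144a2109a4512212895104a099299a20aa5b92690a01485525282e822286648959489154),
  (113, 18000, 0x158a104a6a066958229a800911a4916141a6188462452252046a008045a1429a15502a925a92086820a4565ce59026124a484889488),
  (114, 14346, 0x8698a48a6a14941a21815941a59a56aa11484a2104299092a12592290a6942588528067a405112a92522293964485888a252489121),
  (116, 17608, 0x1162881648281494598681a28a9840648aa4aa184b409252246a112259a2442611502a925a19089610092647565956524a484889488),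
  (118, 668, 0x1894a515146814a605a16a21641a68805864a884488504a209aa08904209429a26a4a7a540a66a14a850962e809281154a245489121),
  (119, 18049, 0x585620151988958222886051a45910a2514a112105a45523805a20691a2442688080a2118051868055a865e882099a626492212494),
  (121, 18000, 0x151660a15186121808628a694506521524614612884584928652666028a5295811509054a40514358058843a4486956494929549121),
  (122, 16467, 0x618949262119419229a1941a810562451484a2122a451465680219495298986202a5a14962402a11a449f1958424494a484888891),
  (124, 14472, 0x90566a141918256022a45854a412486a61484a28a984494654046142a5165466200406525624081c15244e1942924a48a552488891),
  (125, 16467, 0x11104aa16a51a5019521a4541401096255a61112a02a45520805aa448025429a88080588a6112c56155046ea2899899656244912494),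
  (126, 1676, 0x2a6465a10151854a85296994406229849a111145165a694920805106958ab82008a505a108254a5690a42b2195862089488854a264a),
  (127, 16467, 0x46561a12691a2516228899415069619244a44a84a884492254a95142a51254522246250882544a824292f555920990921528948891),
  (128, 9985, 0x1516a005482a18a8086019a960a652181aa14612892584a4d46500a2590a282051519825516a65090a522b419244266221258949488),
  (129, 1676, 0x1160165a6a44152859841462a418418899a16a1860850488490a99542209495ba658a588a690a91616525d4a2a46894a51259212124),
  (130, 18049, 0x1092105894041598699082101a99910a0064aa1849952212a5605912562092212653924a2619241610842d44249944548a484915121),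
  (132, 1676, 0x109214489406198a9451622a8a99498680614484482528a5929513802551094055a55a21588499540aa6394629222a6221499249148),
  (133, 14472, 0x1514a64948611981922215a68405458696a484a2898a45221a1a2a42920895458852682551e965561a5032419099855496244915121),
  (134, 1676, 0x198a14495186696802a81a0965022189a46618844885848854626a604a09629a11248a109a90a2225050f4964499819496244889491),
  (136, 14472, 0x2a9465a21851a2960212422545186485818a44a211952252221895002609922195092a92182d60548552e2844822286648959489154),
  (139, 14346, 0x9694aa141864246846965984a412866a6111145155a6955a0805106958a9820488115a10948905691d7298194992455488924a264a),
  (142, 9985, 0x266461a10151856a052969a5606659605a111145154a455450a2448258a4295851800508a54a146801dd2451942095a48894496564a),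
  (145, 18049, 0x26666400aa1aa9285845a06aaa854182458a4618602a6909a4605912545644260a26925088849a14a0f599264522400921229489491),
  (150, 14472, 0x2a666410aa18a256045a41a14a996886818a61121125a8a5a2151122950a9820c8099a925a98a1014ba6998449292a6248898889154),
  (151, 18049, 0x180a48a0a6066558299881891a99a10a00661a128a9844885545a6542a5199402275450a242545a80721895089202aa096544912121),
  (152, 18049, 0x1162104a6a061918684480581a98910809a146186095049219a58892520899582688882510a6672a175296528244818a21258915124),
  (154, 18049, 0x1896a448942119a80211a2256a99618240648484482012622900d11421519958a65005a1488495969e099622864654894a485512121),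
  (155, 9985, 0x6111492691894aa22969941a5a9560691484a2115a69798215a242958a982088011592094890414d2189884529266156244889151),
  (157, 14346, 0x2a688aa481614446851965944061286692111145159a696594404a46960a082048591a12196a69437a0189244822482491245262626),
  (160, 668, 0x1966a4166a281426058560616a98688049a4a88462458492054a80a489a1429a2050a8949292081cc4a65649512026624a492488888),
  (163, 16467, 0x1584a205516818646229a606a405906254616118482504884a9526402025654615a44065661122779009449a2652529094929489121),
  (166, 9985, 0x226288489121190a920562541a810562451484a21225a222865508a984569898085a989650a6423d68a499984184810a4a222212124),
  (171, 1676, 0x1162145a6a04152859841062aa98418889a4aa18625862484655808985a042820825c58a02920ac144a65928212922a14a492214891),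
  (172, 17608, 0x198a14a55106645105aa8a0940a22a94986618844a909889a56046394a50629a22249065256246e820214451952020088a544914891),
  (173, 18049, 0x58562025198895822188605116491092111611211272909a4651509442698981526924a661926c1605229242659221088958912491),
  (174, 17608, 0x19888a595161625402aa860144012066946618844a4504b8592a225941a0629aa624a82552110714aaa444219192221096485514891),
  (179, 5344, 0x118210056a9aa86402aa18096502106165a6188460909252865068a92a08b958115010652690ac948001548a2422446626245514888),
  (180, 668, 0x56912a641864464099815a96164500922111a451785a22454426666960a2425485a8a109948b5098a0980264a445aa094922562626),
  (181, 14472, 0x2200154901518941922a11868a410586861484a28a9522085548aa54260909582626a82512317a14040149419022406496245248891),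
  (182, 18049, 0x1092104894061998685082181a99910a006486184a5844922560621949d244862250424a2540b89690a446242586248a26485488888),
  (183, 14346, 0x260812a481444446a519658680659866921161128a2844a4618511142979994062a5458a64a4c5814a5a9920882999a648898912148),
  (184, 5344, 0x2a184aa0814642018452145840612a1612111145a548625450aa195944a628984a80250a66b8d48901019440864446609124496264a),
  (185, 18000, 0x56912a54186445809aa85a94a45521626111a451650188989258a5940a42281a65955920827c589a6a480284984890951222564a26),
  (187, 18049, 0x509125a41844558299885811164910922116a128920188999a508925054994026a5550a65cb9694a0a699208522810888899515121),
  (188, 5344, 0x1586a01551a8145625aa4a01150698616461688448484494656a3119498a6486620062614807908141a624862529266124898888891),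
  (190, 14472, 0x9656602419a8941845a159841602985a211114515252264608506042425222155a505a14b5e25498a584021988499a54892256264a),
  (191, 18049, 0x1614a024898a9985204859415000109268a61184b401889292aa21041899281a6596248a42d419486a6428629222a6224899489124),
  (193, 18049, 0x268660009198895822188a051166910921116112105299099a1580a9818a9898885a9a211b765516165229462a592a5221258912124),
  (196, 14472, 0x190664a26a11a501a50610468a98a98489a61112a24219152a9a110921a095455582658a67d5046821a49250859026124a484914888),
  (202, 14472, 0x1916a44a482119818212119441a0258582a144a28980126219a248904209429a26a40a10bd6a6a9698a426255186818921229489121),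
  (203, 14472, 0x1916a4495121190182221a5440a22584986144a2888a45620a925942920a442608a4004cae90aa5698a4562a2186818891229489121),
  (205, 668, 0x1594a205586818a4022016256405500a15a161121140126449aa009041a1629a66a42d4a754a11948aa6248829222a6121499489121),
  (207, 1676, 0x2a1465a11151a52809201a65641a6188984a46128a35a208621a0622945624258852aa90d9624516125240455659265248958949148),
  (208, 16467, 0x116210a66a041411650480541a989a1809a4a118605522520460e24045a1429a15240054e405185694a4862a4986288896485489491),
  (209, 14346, 0x158462a16a51a56165281406a405996a95a61118619a4508654819142a0909582226a5a3ca98aa0900849940848440654a222248891),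
  (211, 18049, 0x2a6664a0aa11a5680919a1a56a996182418a461211401889092aa25041899281a65965bba5489194865a82884822996654899489124),
  (214, 17608, 0x158a10a651066454699a820a81a4906580661a18488584a2121268a02a0999589124870c882561225a0126962a594a9126244889151),
  (215, 18049, 0x56562026a98a9186204845415049109258a611860486264429a265024a529584aa428bd580515961a09844a4a595a5254928949148),
  (219, 9985, 0x2a8a48a09184426802181a05616222192111611210884488712a15104a092281a20960e56690a6961158504a2499915648928949154),
  (220, 18000, 0x26846101115a8958286a8a091066916059114612105844929185aa5428a5994022a55de118051494a48689228a524a1254899512148),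
  (223, 14472, 0x415a54a04211981921211a681a44585821484a2884092622a1a192290a6442688502f6550051989aaa42626218485088a222489121),
  (229, 9985, 0x5156201419a892a046164696a45596266111145a6509254e888a226918a442648883252082548aa150986544a445889248848a2626),
  (230, 14346, 0x2a866410aa18a26162981002aa99a69a818a68a8619a6955965d59498608629a48003a121a98a456915294244646858891259514891),
  (231, 14472, 0x190a144a51066901a286124a8a98a584886618a2892584e46655112029092545515aca925a98a1225a589094489999964a222249124),
  (232, 17608, 0x2a6889052a686854022a89a5441a6064998a6112112a696506580259250a98384a08e896516a6201490986884029506651228888894),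
  (235, 9985, 0x1092881494a814a859901a22a51a42192064aa18484a4522a182421429a1655e22a79a8891421609a85a44262244910a4a492512148),
  (236, 17608, 0x198a8805512a685402aa8a0940a22064986618844a9018c99900649422516222a65315210a908594a22154219522240926545512121),
  (238, 14346, 0x98566115198826102a816016a41269aa514a8a2112844946565111049092281627d458a6698a0a251589090849995964a222249124),
  (241, 17608, 0x159a10a55886649409a28a2945065065a5a61a12109a69158295aa50265199584af6906525409028a5a6499a2920890896492489151),
  (245, 668, 0x50912a541844446a52965868a4598062614a11289252889a4e599025424994095d95588a6192549060129419a444a624a244915494),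
  (246, 1676, 0x2a646600815a894a8459659840612986921111451450125468a89119e18a0820578920652484989615a499428986284888885262626),
  (247, 16467, 0x106089152668145115a889a1141a4a181864a88448486262a542421695a298203b591a88914216a828094956225052124a484912124),
  (248, 668, 0x11124802511aa9019450125811a009090066111288229955244811348951429a530020656484985611099642864654488a485212491),
  (249, 668, 0x86566a0a6918266021965a56a596482611484a2109528a59a9064898e5264864c88582510849656195094428099205626544912124),
  (250, 18000, 0x158812495146695822aa860914059162546618844a2ac522165828a2985694250c5aa82550254216988422819099405626222489124),
  (251, 14472, 0x1516a44948211981922219a680a645849aa144a28925049465681509482664867d00624a66192054810924842422546488929488891),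
  (254, 9985, 0x1584a2155168145a25a8460114059a1a146168844925a889975500a02509295839249521496a6220605824919492911521229249491),
  (256, 5344, 0x1182881551a8144195aa1a0285020a15246168844a5a450e1125a65048a59299e226882512110222545842919099919494928889151),
  (257, 17608, 0x1966a4066a2a1811044680694a986a9489a48484609528a594e0688946526486d5a4582510849649a88694228244400a26492512488),
  (258, 5344, 0x869891526a8644185aa199045022a15244a68844885221441a2489256086e2766828054a4a6641691a4902a4586858a21229515148),
  (260, 14472, 0x10621448a6061941945a11aa8a9949868064848448958492165068a92a0ad82311518a2118256416908422262499449626222548888),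
  (262, 9985, 0x26666010aa18a21a6444485010a69a18198a61186295a889865584a986509e9c0825905600a64616142999484129914921528914891),
  (263, 668, 0x11821006511aa8640298120961a0100900661884488098a5a65266292a52443e51595248a54099890a5849462884996626522212124),
  (266, 1676, 0x1916a44a5121190a8211625441a02585806144a28925288915481144850999f824246a125a98a254800996844422506491229488891),
  (268, 18000, 0x11821006511aa858029a820941a012150066188449950492a9259919420a23e1a609958a2698a40165509020889989164a244948894),
  (269, 5344, 0x10621058a6041256645a41901a9998624064a118494522628292408235a099e015a51894914a1649a85a29295244910a4a492515148),
  (270, 1676, 0x2a8664009118a96862181206aa99a18a804a61184885048859824894220b635a26a48a1098a66616905294264646818a21259514888),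
  (272, 668, 0x198a14a55186646605a96a096502288164661884488219099822688252529f44950a5a1098849268a1a699964520810a26492489494),
  (277, 18000, 0x1162881648281498598681a28a9842140aa4aa1849221949aa150209210af42695081a92596a6a4161098424465952124a222248894),
  (283, 18000, 0x9149011498a99852228a1415020161644a6118489092486a15992b920b6426882402610a90a596965254262a46898921259514891),
  (286, 18000, 0x266a10a481864458099a89a94166521522111a451490924858059166930e642688580a211a90a1a256a4549629992a90914848a2626),
  (287, 18000, 0x56912a54186445809aa85a94a45521626111a451425288981058a46947c9940a40955888142125695a6498a21298149514924a4a56),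
  (289, 668, 0x10921458940412a654516222aa9948824061611849552889a215910025f999409525524a2619215486a6298429222a6088899489151),
  (293, 1676, 0x2a966400981aa9a8085012296a99618a818a461210e5a8898210556296d2082088099588a690aa0161a4592a2586200a51529249154),
  (295, 9985, 0x22124800819a890a945168581162096162111145a595049469a89d194324629a6688a24a261920169584248428994854889224a4a26),
  (296, 16467, 0x5694aa2418645615999a5aaa164456162111a6916e528a59540408697a4094064595508a69209416a0959219a46580888885264a26),
  (297, 1676, 0x815a5492621190a822160544a812586851484a2a25862522d45a2142d89922122250252082540a04421829449222aa126245212151),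
  (298, 16467, 0x1162105a6a041211644480501a989a1809a161186080b488690259248e092281a0094248a690a6aa11a450562584818a21228948894),
  (301, 18000, 0x5694aa26a8662185846846a85044215258a4618602522484658114b3509629a15242065642562548009248a2422506491229488891),
  (302, 17608, 0x106214a4a6041451551a81a68a994a968064a118499a696584606642f650629a48501896114895561a2184484129244a56544915488),
  (304, 18000, 0x118012595151a25802aa8601440112161466188449929909aa35a624e251995888269252094891014621898449292a6126544888891),
  (307, 18049, 0x1986a44a512119680219a20561a0218140614484492528a5a545020f9509654664585a92596a61414aa6848449292a6248898889124),
  (310, 9985, 0x1112884a5121190a9211625411a00561406144a289252889a235020d450a648695085a92596a624141a684844529226248898889154),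
  (314, 1676, 0x969165a6a84650a8585645045002985a58a6884604ac562192a267250a49221a6512825500511606a5282928252261094959215121),
  (315, 14346, 0x46561122618a2566298419011a49469804a68a849852208756a88d9460a08982626a814916a6a1614a429495186814891229248891),
  (317, 5344, 0x1162105a48041296644641901a9898604aa161184a4a4514654a13d429a199586202a0656611000141a649819529266091498888891),
  (319, 14472, 0x2200164881518941921a158680610586921144a288486224529a379024a525454aa66a21594215816a5840262899991624928949148),
  (328, 17608, 0x1092881494a8149459928a22851a4065a0616a1849209895146dd9694826448651006a0a52192896155226442246854891259212491),
  (331, 14472, 0x1090155a144412965452422285184885806161184a85a895065f4a698650429a4800a59089624816118646495646444951499214891),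
  (332, 14472, 0x1914a64948611981822215944401258696a484a2893504922a9782092108454615a44a92196a686804528654482028a64a252214888),
  (337, 14346, 0x9698a166a2864068585645040a02864998a6884602012484b3599544055629aa6080894908496aa1552945a4244818a51258912494),
  (340, 5344, 0x191a885a512162018292125041a02615006618a288229909aed5aa229054995888a69248a5409120660149962a524a1226245215148),
  (352, 1676, 0x1162144a480619a8584411aaaa9841888aa486184a5a6913c465a252558a04250a269592082548140421824849222a6156245249491),
  (355, 14472, 0x1514a649516119019222166684054586946144a288850e13498a99542209095826a6a588a690a81614a4594a2986894a51229248888),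
  (356, 5344, 0x2a1849a101464201846210584a412a1606111145a455a88f60859126958a082048a5806524849928065a9952882099a48889226264a),
  (359, 16467, 0x22801248915189610219a60560611562511484a21158627e0460409945a298984a00058a014a14aa19092658224454894a484912491),
  (365, 14346, 0x116288496a2119419228199410a2056899a144a2109a63d2144599448609929908260a211a90a45694a452262986898891229512491),
  (367, 9985, 0x2a68890611684828020412656a5862180914a112112723a465451114250999406659458a6698a5a80a21995089202aa24a244912124),
  (368, 18000, 0x56912a54186445809aa85a94a45521626111a45165a4f9521a062194988429a628082520825482a1109865446445489248848a4a4a),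
  (370, 18049, 0x9149011498a99852208a1415020109244a611848903e5511858894260992216681082510a6649695a492228186858a21229512148),
  (373, 1676, 0x19046602515aa90aa445664a8418a98498661112892d748854680892542698200a25aa125a9a221690849984449940548a222489491),
  (376, 18000, 0x2668894a11616918120682651504416145161112112dd208698059248025229924a68588a619262800012051942040a64a244948888),
  (379, 9985, 0x159a104a580669aa0291622961a4556141a618a2102f5949a8206a12502608208a091248a6112a81618449262499401626222249494),
  (386, 668, 0x198a14a56a06646605a9680960a2288059a6188460f52889246aa60046a192811525606500051268a40982928250521126522489491),
  (393, 18000, 0x1818890504686898022289a5441a62141b6661128e529909921580a029a19958910a9a0a1292020145a65984212922608a498889156),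
  (395, 5344, 0x2a866410aa98a261629a1802a51aa691618a68a93d2528898025114045092281950955924a98a241410990884646526151229249656),
  (397, 14346, 0x2210895a01611216145040611518486982114484fa2522544658264924560820550120566425484161a489284586240894929248891),
  (398, 668, 0x2a6664a09111a266021963a56a996482404a44a238801252092a99594208429aa6082588a690a8961552564a2a46894a51259214894),
  (400, 9985, 0x2a1465a10851a2aa022169a5641a66905a8a44a3d555a889921588a984a4629a88089a0a114a1614a5a624242122810888899514a56),
  (401, 17608, 0x19e6a45a58211291044682214a986a9489a14484d29a691584659959465298984a02958a02908428258659582250461151498912491),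
  (404, 14346, 0x108011592644156165a81802a41a99689861688f644092620542596488a5429a2058058880051aaa1852265a2244818951258888a26),
  (406, 16467, 0x5056202419889616219a586a16495616214a13e8a9528a585404884865142826451589610a64954aa849928409244164a485488888),
  (407, 14472, 0x909164a41864941c45a158941602985a214848e88829925a29266202a21095851a69248a61129016a5249262a592a1226552249148),
  (409, 1676, 0x1115492691890a922168668a5a4584a91484f5a0884488656266194a50228122594248a54092a040214096252222a226545264a24),
  (410, 17608, 0x198a48a16a066254046a880940a22c6499a61134602a451221282a1048559299a202a26149409014810142862422446526245489151),
  (413, 5344, 0x2a8a8804912a6864685a120aaa99a062411613d91022192528a511094152948555a645a1488491625a0992928a595a914a4848a2621),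
  (415, 14346, 0x2a1a8858882165a1099011a16a99656a828a4fa2882528a5946524804455228155515825508491606a0990928252561224929249488),
  (416, 14472, 0x1986a40551a818560e2a4a0545022885a461638449252262918524869426982024a5182552192649085229419244226224958912148),
  (418, 14472, 0x190a145a6a046501a58610428a98a98489a63d45a24862220022409255a095458a524894929201a25a095299525956924a4848a5648),
  (419, 16467, 0x118288495121196154e9aa06a0a2096058614d184925225282152a40245529589500159249489454a1a684284522850954899549151),
  (421, 16467, 0x22604901015889419229a1941a4105624614f4a2169a4512929584802a51254511a6550a24a64468245290508a502a108a55894914a),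
  (422, 14472, 0x2a0664a08193a256685a498a851aa485a21636698a909252165064a92a509958115005210a9080aa90a4569195842489265224a4a21),
  (425, 9985, 0x158812a56a46646869a8140aa405921a15a3da186025221285604099450a989826529054a4a660014009998a4429546621228888888),
  (427, 9985, 0x266465a22a51a22a52056066a5044691458f84a86225a20862104a229454995888528588a562450142014921942944a64a244915148),
  (428, 5344, 0x2262881481a83401958618628a5a4a142a13a88465984492054895542a2145462250658a0219289614502648209924555154488888a),
  (431, 9985, 0x1514a2494161192a0221646564055562563d44a2a525a2086655222295522425085a825249489601405a8024442991a526498949126),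
  (433, 1676, 0x1908165a6a44650aa58564428418a98498fa6885a4486262146a265254a644260a58282550051a96185886428099915494928889626),
  (434, 18049, 0x32614a008118a9585218859410a1010a123a6119149a4552102588825a0a44269108052108a6685695a496228986898921229489656),
  (436, 9985, 0x269889150868449a15a040211a454a1a07d4a8846195a212a215992296089958880a958a2698a001450199808a464a624a245215154),
  (437, 14472, 0x8116589d041541959a160280a1098690d4a8844a25848866550a2928569820112580656562422a90a44991958481888a222488891),
  (440, 14472, 0x18846501365aa941a46a1a0a841aa9849b661112122a6915a4651112555224254a0290656425441611a42041959926508a484949491),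
  (441, 16467, 0x11149269189210235a8456a4215606c4884a2a495289592959540265199405581582510849068a5529992825026109155248914a),
  (442, 16467, 0x1614a126a18a2419299a5a280b846141d8a68a2102a692594652499445698984a529825508495161a5899428099955624928912488),
  (443, 1676, 0x86566a0a691a54a8519659445012987ad161145124862129462409945a224850a525a109a920489a05a5025564495088a492562621),
  (444, 9985, 0x4698aa4a6a1442859041c66a066421839148618619522129560689256209958265295210a192416108429419499445526484915121),
  (445, 668, 0x88565a2149182a6020562056b402481744884a21625a889a215192294569820885190656425411692862981965946508889248914a),
  (446, 1676, 0x2a64a54a11e1190a8205625440a02584b91144a21020126459a800904109629a6688282550a66294890994828022506621229489124),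
  (447, 14346, 0x2a68155a11444206a44562501a58a8e0c914a145129504a468a055025250654655a445a10a9081625a505491989928954a5448a5621),
  (448, 1676, 0x228011492a461948a868180a841a910cd98886446085049459aa8892520822216689aa1098a66001450190864a464a6221245265124),
  (451, 1676, 0x611648a606190a9445646a8b99498799114484625a69099465849254a644260a269a0a12920a28242959542120910888928889491),
  (452, 14346, 0x61114a04861981a4441998151b996baa114484482844a2a125261258249940a22552614a1121814a5849862886996524929215151),
  (454, 668, 0x116214a66a061424198410693a98408c49a11a44619a4524446059494a0a2485510a48961298a26049019098402240a651245262494),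
  (455, 18000, 0x268461a111518548a92ba2068a45916e45148612122098a5946528a0485522815151582552908589aaa450219184850a26222549488),
  (457, 668, 0x158660a16a11a56665296806a0a69b7059a6111861286252a6505919242698200a511a909a19208140012985542944664a244888888),
  (458, 668, 0x196664125118a201a44412501a98aaf808666112159844886a159510222165468a584065261921a256292491992999888a528889126),
  (461, 9985, 0x5098e4941a1495a222845851a4595ea261484a2882584928215aa602855295891089588a54094016550442a2899891656244949154),
  (462, 18000, 0x1162884a4821199d520681a68a9847140aa484a8499522245540649426219958660a88251219222a990929919244508a26522488894),
  (463, 14346, 0x1966a41648281396628441901a98a7988aa168a91688449468aa9519425264864a8862508a908494a5a4542559922a1121529512626),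
  (465, 14346, 0x6111592604154385a961904a811d66851168a211221965a98526069056982064a51252494895682a5889544890991524928912121),
  (467, 9985, 0x11608a066a6a18285e84146aa4184e1819a11a68614018a589a2449250a4094066a55590894a19816a5829295899991548922265121),
  (468, 5344, 0x1986a006582818a4320612056a98b06049a161121028626444681152550a64264a0828a55290a2948909548a2022506651229489494),
  (469, 9985, 0x8694ea0a686426a585965aaaa59769260488668499a45229a9048898222248508a6550a029a2656188490408099405521484962121),
  (470, 14346, 0xc61115a26041561599811a2a1a475698048aa6849809252180a88a48209429a88082a10996a6889a5a426255984890a212224a2494),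
  (471, 5344, 0x149a105894846281a4521a22851eda152066614449801264498a2654225129586688289651489281490984884246526256529262124),
  (472, 14346, 0x1180124951461941a46816381401d96a946144844840188929aa991940a4928126a56a8890051696148622462259425248898914888),
  (473, 668, 0x1162145a6a041266345961a161a0c88141a4a145104504a22a1a220921a045469550606540051949aa5a862282449509264924a4a21),
  (474, 9985, 0x14966003949a89aa04616a296a475962646111444a452252046a848254a49221152525908a920056945252895a592a51489524a5491),
  (476, 17608, 0x91566a24111a21102128c654a9b6696821644a2a69a45485a15a6429252642688580a1218254162562984944929998896528889126),
  (478, 16467, 0x2e928814982814818991a2104a9d26160188aa62112a45245a9524829024254548a645214a1921604a21209199222aa124945265121),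
  (479, 9985, 0x4698906042a689a5444419811bc0a19061611184825222201a82a504425929926a6a8a5521122014801428a2029406656244889148),
  (482, 14472, 0x2a1465112a58a21602a240614e396486858a68a2a02a6949a6505102950a982008591248a690a254800959862422506621229489124),
  (483, 14472, 0x2202144881118941921a11868ee10586821144a28a4a4508654a0214298909582226a5a149624a1400a649419522226148899248891),
  (484, 18000, 0x40562a0a60432186206844684c59216144a6119a58a690994625952562099580a5a9508a6192614a0a629219522810891499515626),
  (485, 5344, 0x15684aa251c642161446466915c44861646111121522194928282a02505644269508225249489a56118486444499405524884889496),
  (488, 5344, 0x198816a66a446461051a14056f202a9151a66144629a4522a12046125a500958a2529a8a116249016aa449242186240a4a529265148),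
  (493, 16467, 0x2a688906116a48214845a26afa58661409148669108a4548446264894a52289811580054a48492604021949a452222a226545262624),
  (494, 18000, 0x1114a1241988238929284503160021522116885a4421955298a950480a5429a64882248a4051856152926462929994888928888a26),
  (496, 14346, 0x2200894a01611941b2181186d5188569821144a289858492046a95604a51429a1150a89491489814a45826295092951651529489488),
  (497, 16467, 0x199a48a15806629108608a1bd0a2261819a64662109092528655a6692a20295811241065261124a82458445a2890991496528964891),
  (498, 1676, 0x228015492a51a96812281837a41a4188998a44846188625226525910262199580a5002508a1920a250a626955529858921498889121),
  (499, 14346, 0x9149111498a286d4616a1385020865a44a61184a401895098a849420a545466680689492920896155856495099955648928888888),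
  (501, 18049, 0x2a8849b12a4669582228880d141aa108198a448460809252080a99648209429a88082588a425688165a4262a2986890a51229212494),
  (502, 9985, 0x15181259484662a808e015ad6405521a16a61a128a25a212165808a2945694250852aa1258a6401480019284442244648a245489121),
  (503, 668, 0x22108959016312245220186ea41a40081a116119a5884488654259142a216546225842508a1922a250a624955529818921498888a26),
  (504, 14346, 0x26788a58aa614216585044701065446a9188866861458492044a88a428a599581150a894914a1028a4a626995120850a488924a2488),
  (507, 18000, 0x5e94aa241066518198685e910a441605a161a12884a6965a652510985a0629a48081a8890051649a95a24262244910a4a492514894),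
  (508, 9985, 0x4856101049aa9ea646969caa5069961661611184945a222829240a295a2242508a69894914a1614a8a42029519222124a485549148),
  (509, 668, 0x2292881491281424599013e2aa99400a0048aa18659a692594604492562099584a0a950a029a2609a90999208244500921522515496),
  (512, 18049, 0x40562a0b60615582998878910a5910a12111a12a42522084125115045092299a6528065642565098258202a248495a49122254914a),
  (514, 14472, 0x2a6667112a18a25602aa4da14a9a6484898a68a210809254688259248209629a48800248a690a4aa11a454562584858a21228912488),
  (516, 9985, 0x865a55a262112788859319061a022914114864510884488682aaa19422264868a586248a61121a8a6a644962920890a264924a2624),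
  (517, 16467, 0x158a10a56a06645625a9f80910a6986059a61884609a45128185a8942a09995822a6906524256409a452292a2a44890a26252512148),
  (518, 5344, 0x221248a08191a21112133865151a4619221644a2a6986252a295a610265129580aa4125208254489040984444a445a612652894914a),
  (520, 16467, 0x196a8806482a68a30284d1a96a9862180aa6188448852252229aaa002621922115a52248a6112068a48642962a504a1226492489148),
  (525, 18049, 0x57562a241061558298c858910a491081a111a1216252889a215060024559940955150656562415692524981965926508895248914a),
  (526, 14346, 0x91115926841256647c4810151a9869a048a118655844929545889428a5654622505a0a114a109694a62484212985488889248888a),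
  (527, 14346, 0x261664a08811a2e1520c1066aa85469a868a44a9a640126449aa049940a4629a6688258a42920694a92954282122910948929514a26),
  (530, 668, 0x48912a794844486a5356606816498052048a1121425221441a5115255089958668280656690a0225158599a249995949122221514a),
  (532, 9985, 0x56562a14191856a03e965a56a455562661118a2159299098a159969820a9898885a95920a98a101465099884886896551245212126),
  (535, 14346, 0x1162144a48061ea1534411aaaa9846988aa144a914429909a022462258a62425910a9248a5421201415240862646226088959249656),
  (536, 5344, 0x58912a5518644562f6a46091a45986265148612104a45646a9a1102918a642648a42065648491414a21948289292a608a244889121),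
  (545, 18000, 0x1182105951041578c9aa8a0160a2116058616a1848486212265a861924a495450a526a8891421494a45842262092951648929514888),
  (547, 1676, 0x190a14a66a06640fa985604a8a98a08489a61a45a025226464606a025454222155590248a54091604a014096282248a626245265624),
  (557, 1676, 0x9656601639a89ca846964584a412986a51111446088449208aa9959420a44860aa46588a42568961401264a2a594a52512448a2488),
  (558, 1676, 0x2614655d0151830a92a160628a454586861118a2a4284494418526542825994062814065661120a04121499a252226a09494521214a),
  (560, 668, 0x8698a04a6a84f61051815a56a59690a2048a144482a6955865511498508629a480010656690a0414121548a25292660912448a4891),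
  (563, 18000, 0x8194ab0a6844e18099284614a5962162114aa45a25504a21920409941a0429aa6508a0a129209169a095624224654888a4854a4a21),
  (565, 9985, 0x8194aa08491f58aa51165941a59a962621611458a5092621a1040a981a0429a88500a0a129209aa1a095654224454888a4848a4a21),
  (568, 18049, 0x116e64026a1ad9285845a06aaa98418049a48618604a4522212a111049899299a226a5a1488491014a21928289292a614a244889151),
  (569, 9985, 0x2a6a8858aa34d54aa99961901a99a5624188aa6210252895954526469454654664005a2159409068a109449626505610949224a4891),
  (571, 5344, 0x5891205518f4841a2aa160a8a4596162514a8a21095a2128295a8a9860a989808a69065242564016450292a2899891626244912148),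
  (574, 5344, 0x505a20541bd8841a22a15868a459616261484a2884a45622a9a220981a2989808a4206540051654a82986228122910926485512121),
  (575, 14346, 0x98916e9518d4261022816056a41269aa51484a2104844a46a92421021a165464a884a88914212aa995a44962244918a4a492489124),
  (578, 18000, 0x181d2a151b48258022a86054a4112162514a1121085221221aaa6104651929926a6a248a5409028a42942962920990a26522489148),
  (580, 668, 0x83104894d1a9a162041a06aa9a9508284a44a9142522622545190694549221245900654084966a185292528244818921258914a26),
  (583, 1676, 0x1090155a2f4415a859901022a518418981a16a18624a6909146a889254a604250a26a50882920a01645252219246810921259249491),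
  (584, 14346, 0x9998a0573aa4886846166184a412866a611114448821949898259469208295824a41588a42566682050245a2490811651244964888),
  (586, 1676, 0x230016494d51a94a9229658684010586968a44a2884862622652461024a599580a580a88914212a2585846962099919648928889124),
  (591, 18049, 0x198a1758d10465680999a60160a1218250666a44499504884825848942226486952445920a9a216256589498489999954a5288a2491),
  (592, 1676, 0x27646500e65a89285844186aa0664188991486186295a895844044a48651629a4800959208a64414a1219428452224094a545512491),
  (593, 9985, 0x1988155bd144626a0469620165002a914466614448921949998064869252082024a5152108849a54005299428422206526559262121),
  (597, 668, 0x158ad04d6a21686462281806a0a6900819a611186195a222821048a29620995888529896129a2514aa849928409244164a485515148),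
  (599, 16467, 0x58562ed51988451252886051a459a1a2514a14512952895a0a599094652648655805a8a1290805695a654842129854a4a4924a2648),
  (602, 14472, 0x2a86a4f891281941a29a12028a99a586811168a212529915a465a62948a69898510290650211042825a449519190261124928912491),
  (606, 16467, 0x638b5a046112819445a5a284184a141a11448448209252a46066204855629a11501248a5409094805244862422246624959489488),
  (611, 14346, 0x15863ca55104146165281a06a0a69a989861611849929909046884a25a2294251126a056029a2201440992884029506521528889491),
  (613, 5344, 0x2a84f9a111611241a22a1a06841aa614191144a21048622226524a1024a595450a5a4a88914212a2588642962259429248898889124),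
  (614, 16467, 0x116e385a6a0465419999a19011a0056141a66a62112a4564446808825824295851502896529a21606a849498409244164a229265488),
  (619, 16467, 0x366b48a0914642019445a26a8a454a1604611112152528a5854508869424654664085056429a2654a95094284092811521245514896),
  (621, 14346, 0x1d6e64a26a046261021811a561a4669981a66162124a45220a1a008291a095458852658a429201548a5a5288202295654a4994a5121),
  (626, 18049, 0x4f5a14904a11998222088051506910926111112a6484488482a2252518865468a08659248254689a15a84284644910954892515496),
  (632, 9985, 0x376912a56686446809a815a96a45521a24611a4448452222a102551424a50958a6529a88900519090a5229462244266248952262148)]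

/-- Patterns in `cellC` for the right states `skipStates`, without deletions. -/
def patternsSkipC : List (ℕ × ℕ) := [
  (17930, 0x1014a02419889489219a58681600165a214a112899018898925a65942526486a6245592094891a8a6a4849849902a1156522488891),
  (17048, 0x49911591484659105a28a2145065905244a6884499a4554446884825a22082051012056029a2854050999484022546521529249491),
  (9992, 0x114a008498899a521245a68a594566a214a169892584a201082a6698549958a050a896514891014a01868840294466562448a4a48),
  (16523, 0x2a0815a501466444a9a9a98a841aa0849a161a458925a889a4451126950a08200859958a6698aa0900589940848491664a222262624),
  (5792, 0x226214489191891a12064a651a5a4580691144a210809252288a99248209429a08a42248a4256896145226462a46894a21259212488)]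

/-- Patterns in `cellA`: for each edge, a left state, a right state and a pattern without its
ends. -/
def patternsA : List (ℕ × ℕ × ℕ × ℕ) := [
  (0, 9992, 18049, 0x5062a500509594a8060194ae156514a23),
  (1, 17048, 18049, 0xa4a2a5199495950558925948a2496488f),
  (4, 16523, 18049, 0x20a421092896963049115584a2126564d),
  (5, 16523, 18049, 0x204886592896810049292964a21264a3d),
  (7, 17048, 18049, 0x2064a70928968210492921a4a2126513a),
  (8, 17048, 18049, 0x50520a658496965521019864a512648fa),
  (10, 17048, 18049, 0x5062d40994959485180190a4a549648e6),
  (11, 9992, 18049, 0x8540848589594800a0190a21565153e6),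
  (13, 9992, 18049, 0x86252105095814042292962126514f96),
  (16, 5792, 18049, 0x8528c49949580804a2921a2126564d26),
  (17, 5792, 18049, 0x8652109959594a00a0194a2156563d4a),
  (19, 9992, 18049, 0x88e844a969594804a115182126513a26),
  (20, 9992, 18000, 0x5164a525286694884505296514a24fa26),
  (22, 9992, 18049, 0x849004223959650020190a215648e64a),
  (23, 16523, 18049, 0xa448004858959615188290a8a5493e648),
  (25, 5792, 18049, 0x865500121959650020190a21564f948a),
  (28, 17930, 17608, 0x8a0850a74a056a55629421026264d2621),
  (29, 17930, 18049, 0x50520a49949580a5582925a4a263d4a51),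
  (31, 16523, 18049, 0xa448004a3a96821569aa21a8a213a2648),
  (32, 16523, 18049, 0xa46421245895961806829868a54fa5648),
  (34, 16523, 5344, 0xa642109284254a25b0525a9648e65648),
  (35, 5792, 18049, 0x508984412194948886115084893e62126),
  (37, 5792, 18000, 0x5162a525946596555005296514f96488a),
  (40, 17048, 17608, 0x8a098441210768888584229264d262126),
  (41, 17048, 14472, 0xa008a5992809692518948404a3d26488a),
  (43, 17930, 18000, 0xa10802662a268a1845a42b54a3a212651),
  (44, 5792, 18049, 0x5049844121969488050190a48fa262126),
  (46, 5792, 18000, 0xa124500848258a156ab421848e64a548a),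
  (47, 17930, 18000, 0x894802662a259655508429623e6212651),
  (49, 17930, 17608, 0xa20850a62a066a1845942104f8a212621),
  (52, 9992, 18049, 0xa362a5122225950806809864d56488a26),
  (53, 9992, 17608, 0xa24212458446a5082052a53d4a51564a),
  (55, 17930, 18049, 0x8862a50222d594a8068094a3a56488a21),
  (56, 17930, 14472, 0x501229a6864068aaa605261fa4a488a48),
  (58, 17930, 14346, 0xe65212595992250024a886e656549648),
  (60, 9992, 18049, 0x8495090519481408239223214a512626),
  (61, 9992, 18000, 0xa16421245825961846942b7489651564a),
  (62, 17048, 14472, 0xa0e2500a86086a15aa9442b4a214a248a),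
  (63, 17048, 18049, 0x506286c984969485290198e4a51264896),
  (64, 17930, 18049, 0x50495080519594a806019ce4a56512621),
  (65, 17048, 18049, 0x50925ab594959545501159c4a24964896),
  (67, 16523, 14346, 0x922212686202a52e2409b58a514a2648),
  (69, 17930, 18049, 0x50642324589594a806019c64a56515651),
  (70, 17930, 18049, 0xa46450245895823846aa2d68a26515624),
  (72, 9992, 18049, 0x8642108489e94a2690135a214a21564a),
  (73, 9992, 14472, 0x54498449859a2085694e31a214a248a26),
  (74, 9992, 668, 0x50a52125854a56552101fa5514a24964a),
  (76, 5792, 18000, 0xa1e2a52594258a1806a4e86489656488a),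
  (77, 16523, 18000, 0xa8802662a949650c215e9426214a2651),
  (78, 16523, 18000, 0x5622a51040d48945a2272a596214a4a24),
  (79, 16523, 17608, 0xa522a5199425290558d72948a24964a24),
  (80, 16523, 18000, 0xd22a509942488a08a272694a21564a21),
  (83, 17930, 18000, 0xa10850a62a269e18058c9214a4a212621),
  (86, 9992, 14472, 0x2488509a2a9a35004976410214a212626),
  (88, 9992, 18049, 0xa048509a2a45d50518c19025156212626),
  (89, 9992, 17608, 0xd124212458652a5042d5294512651564a),
  (90, 17048, 18049, 0x20645218489695003b019864a514a5496),
  (91, 9992, 18049, 0x50a52125959796559311584489654964a),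
  (93, 17930, 18049, 0xa4642108589594e80e8294a8a56515648),
  (94, 9992, 18049, 0x848509a2a95814d5c292122126212626),
  (95, 17930, 18049, 0x5089026c519596584e115944a26512651),
  (96, 17048, 14472, 0xa022500a86006a17b8842294a488a248a),
  (98, 17048, 18049, 0x2048a5993895952038019424a5496488a),
  (101, 9992, 14472, 0x54252125859b2a55e156894212624964a),
  (103, 5792, 14472, 0x2022a52594416a1f4615294512656488a),
  (104, 16523, 18049, 0xa488509a2a9c81078aaa4218a214a2624),
  (105, 16523, 18049, 0xd4520a658496808d65aa2968a21264a54),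
  (109, 5792, 18049, 0x848a59a2a9583b04a2925221264a2126),
  (111, 5792, 18049, 0x78498441219580c5502921a2126262126),
  (113, 17930, 18049, 0xa4622112229597d510829868a56212648),
  (115, 5792, 18000, 0x8954087528269798458421a214a26514a),
  (118, 9992, 1676, 0x82521099599bca00a29869212654964a),
  (119, 17930, 668, 0xa0c802662a0a5e1845884964a4a212651),
  (124, 5792, 18000, 0x2548865928b6d5004946296214a264896),
  (133, 5792, 17608, 0xa1120a5a86f569056a9429451264a2156),
  (134, 16523, 14472, 0xb120a4994b068a298052692648964a51),
  (139, 17930, 18049, 0x5063a50a2b9594a5180194a4a56214a21),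
  (140, 17048, 18049, 0x50a550034396965561115184a2126548a),
  (141, 17930, 18049, 0x2048026e9e9596100a019864a56512651),
  (142, 5792, 18049, 0x8645210ec958140422929621264a5496),
  (143, 17930, 18049, 0x5063a5019d9594a8060194a4a56548a21),
  (146, 9992, 14472, 0xa0120a58f40969052a948844896514a56),
  (148, 17048, 18049, 0x20520a5be696810049292964a21262156),
  (154, 17930, 18049, 0x20520a7c509581204a2925a4a26514a51),
  (159, 16523, 18049, 0x20b80ad92896952049115504a21264a51),
  (160, 16523, 18049, 0x206471d92896952009019424a51265621),
  (163, 5792, 18049, 0x8897349959594804a115182126562496),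
  (166, 17930, 18049, 0x5055de912195816550292524a26249651),
  (167, 17930, 18049, 0xa479ad105195810846aa2968a26512624),
  (169, 17930, 18049, 0xa488f5645895961846925948a26514a48),
  (176, 17930, 18049, 0x504f02652995825550292964a26249651),
  (179, 17048, 18049, 0x50be29259495965550115944a2496514a),
  (191, 5792, 17608, 0x7d22a52594642a1886462a5514a56488a),
  (193, 5792, 18000, 0xf9488659282695004984296214a264896)]

/-- Patterns in `cellA` with the same state in `skipStates` on both sides. -/
def patternsSkipA : List (ℕ × ℕ) := [
  (17930, 0xa4802662a96a2504109296264a212651), (17048, 0xa062a5259406561845842964a4896488a),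
  (9992, 0x512550004161a88a66152185126489626), (16523, 0x541229a5949628a805429618a48964a48),
  (5792, 0x5088a5a5289a94a84515450488a26488a)]

/-- Patterns in `cellA` with the same state in `pairStates` on both sides. -/
def patternsPairA : List (ℕ × ℕ) := [
  (18049, 0xa45258a59495821846aa2128a26564888), (18000, 0xa55084121969650410521a264a24914a),
  (17608, 0x522421262a446a5590052a5564888964a), (14472, 0xa024212448026a1a659429448888a564a),
  (1676, 0x84850a62a99a250020980221564a2621), (5344, 0x8a1429a4580a48a805a4861248891514a),
  (14346, 0x922212696212a5210509848894912648), (668, 0xa048844a2a09421518a880a48948a2121),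
  (9985, 0x89525aa6862180aa66a82522126488891), (16467, 0x8a925a922204556590805612648888891)]

/-- For each edge between `cellC` and `cellA`, the state at the cut with a pattern in `cellC`, and
the right state with a pattern in `cellA`, without the ends of the edge. -/
def patternsCutCA : List (ℕ × ℕ × ℕ × ℕ) := [
  (5792, 0x266811490146496a02ab69a9606655081a1118a2154a45085102449428a59958a2528508a54a150142212921952926a08894491214a, 18000, 0x9495291216695604105252914a262493),
  (17930, 0x1011205419a88680869a5896a411212e6148645882862128295a899245425450aa65054a48494890401904a4a444a6226244964a48, 18049, 0xa45558a59595961806829028a56549388),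
  (17048, 0x1618a0648aa1891584685981500067166888668492a45645a95248980262898488808255219266809212451912022a224944962124, 18049, 0x5055084051958255502921a4a2493914a),
  (9992, 0x1182105a4811a28da44610028a9898648aa64484654844a441aa22525988994062a56592494895961a0989484a595a515622891514a, 18049, 0x8652125959682504129296212394964a),
  (16523, 0x22601559015182469468d1901a41088a861144851495288922189909265045469508606500849a41658696228246400921499214a56, 18049, 0x84950a59594825082292022391562621)]

/-- For each edge between two copies of `cellA`, the left state, the state at the cut and a pattern
in the left copy, and the right state with a pattern in the right copy. -/
def patternsCutAA : List (ℕ × ℕ × ℕ × ℕ × ℕ) := [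
  (17048, 5792, 0x2092084a86908212aa2d5294a214a214a, 18000, 0x9495291216695604105252914a262493),
  (16523, 17930, 0xa8802662a94b65082215a526214a2651, 18049, 0xa45558a59595961806829028a56549388),
  (16523, 17048, 0x57242109286408a598662699621265648, 18049, 0x5055084051958255502921a4a2493914a),
  (17930, 9992, 0x562521004140e8aaa646269964a489648, 18049, 0x8652125959682504129296212394964a),
  (17930, 16523, 0x88a2a526860d608a66984948a26488a24, 18049, 0x84950a59594825082292022391562621)]

/-- Patterns in `cellP` for the left states `pairStates`. -/
def patternsPairP : List (ℕ × ℕ) := [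
  (18049, 102), (18000, 72), (17608, 144), (14472, 288), (1676, 609), (5344, 264), (14346, 657),
  (668, 294), (9985, 585), (16467, 150)]

/-- Patterns in `cellP`: for each edge, a left state and a pattern without its ends. -/
def patternsP : List (ℕ × ℕ × ℕ) := [
  (1, 17048, 807), (2, 9992, 591), (5, 16523, 190), (7, 5792, 504), (9, 17930, 977)]

/-- For each edge between `cellA` and `cellP`, the left state, the state at the cut, a pattern in
`cellA` and a pattern in `cellP`. -/
def patternsCutAP : List (ℕ × ℕ × ℕ × ℕ) := [
  (17048, 5792, 0x509429a5289080aa942d5614a2126514a, 615),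
  (16523, 17930, 0xaa2a5099494b4a08a215692621564a21, 78),
  (16523, 17048, 0x572450092864088598662299621265624, 184),
  (17930, 9992, 0x561229a68641e8aa66562509626488a48, 464),
  (17930, 16523, 0x5462a526869d208a264a8868a56488a24, 801)]

namespace Cell

variable (c : Cell)

/-- One dart of each edge inside a cell. -/
def edgeDarts : List ℕ :=
  (List.range (3 * c.n)).filter fun h => Nat.blt h (c.code h) && Nat.blt (c.code h) (3 * c.n)

variable {c}

theorem mem_edgeDarts {h : ℕ} (h1 : h < c.code h) (h2 : c.code h < 3 * c.n) : h ∈ c.edgeDarts := by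
  rw [edgeDarts, List.mem_filter, List.mem_range, Bool.and_eq_true, Nat.blt_eq, Nat.blt_eq]
  exact ⟨h1.trans h2, h1, h2⟩

theorem exists_mem_of_map_fst {α : Type*} {L : List (ℕ × α)} (hL : L.map Prod.fst = c.edgeDarts)
    {h : ℕ} (h1 : h < c.code h) (h2 : c.code h < 3 * c.n) : ∃ a, (h, a) ∈ L := by
  have := mem_edgeDarts h1 h2
  rw [← hL, List.mem_map] at this
  obtain ⟨⟨_, a⟩, h3, rfl⟩ := this
  exact ⟨a, h3⟩

theorem of_fits_one {l r p x : ℕ} (h : c.fits l r p x c.n = true) :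
    c.Fits l r p ∧ ∀ v < c.n, digit 2 p v = 3 ↔ v = x :=
  ⟨(of_fits h).1, fun v hv => by rw [(of_fits h).2 v hv, or_iff_left hv.ne]⟩

theorem of_fits_none {l r p : ℕ} (h : c.fits l r p c.n c.n = true) :
    c.Fits l r p ∧ ∀ v < c.n, digit 2 p v ≠ 3 :=
  ⟨(of_fits h).1, fun v hv => by rw [ne_eq, (of_fits h).2 v hv, or_self]; exact hv.ne⟩

end Cell

/-- Whether an entry of `patternsC` is as described there. -/
def isPatternC (e : ℕ × ℕ × ℕ) : Bool := decide (e.2.1 ∈ pairStates) &&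
  cellC.fitsFirst e.2.1 e.2.2 (e.1 / 3) (cellC.code e.1 / 3)

theorem isPatternC_partA : (patternsC.take 80).all isPatternC = true := by
  decide +kernel

theorem isPatternC_partB : ((patternsC.drop 80).take 80).all isPatternC = true := by
  decide +kernel

theorem isPatternC_partC : ((patternsC.drop 160).take 80).all isPatternC = true := by
  decide +kernel

theorem isPatternC_partD : (patternsC.drop 240).all isPatternC = true := by
  decide +kernel

theorem fits_patternsC : ∀ e ∈ patternsC, e.2.1 ∈ pairStates ∧
    cellC.fitsFirst e.2.1 e.2.2 (e.1 / 3) (cellC.code e.1 / 3) = true := by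
  intro e he
  have h : isPatternC e = true := by
    rw [← List.take_append_drop 80 patternsC, List.mem_append] at he
    refine he.elim (List.all_eq_true.1 isPatternC_partA e) fun he => ?_
    rw [← List.take_append_drop 80 (patternsC.drop 80), List.mem_append, List.drop_drop] at he
    refine he.elim (List.all_eq_true.1 isPatternC_partB e) fun he => ?_
    rw [← List.take_append_drop 80 (patternsC.drop _), List.mem_append, List.drop_drop] at he
    exact he.elim (List.all_eq_true.1 isPatternC_partC e) (List.all_eq_true.1 isPatternC_partD e)
  rwa [isPatternC, Bool.and_eq_true, decide_eq_true_eq] at h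

theorem map_fst_patternsC : patternsC.map Prod.fst = cellC.edgeDarts := by
  decide +kernel

theorem fits_patternsSkipC : ∀ t ∈ skipStates, ∃ e ∈ patternsSkipC, e.1 = t ∧
    cellC.fitsFirst t e.2 cellC.n cellC.n = true := by
  decide +kernel

theorem fits_patternsA : ∀ e ∈ patternsA, e.2.1 ∈ skipStates ∧ e.2.2.1 ∈ pairStates ∧
    cellA.fits e.2.1 e.2.2.1 e.2.2.2 (e.1 / 3) (cellA.code e.1 / 3) = true := by
  decide +kernel

theorem map_fst_patternsA : patternsA.map Prod.fst = cellA.edgeDarts := by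
  decide +kernel

theorem fits_patternsSkipA : ∀ t ∈ skipStates, ∃ e ∈ patternsSkipA, e.1 = t ∧
    cellA.fits t t e.2 cellA.n cellA.n = true := by
  decide +kernel

theorem fits_patternsPairA : ∀ s ∈ pairStates, ∃ e ∈ patternsPairA, e.1 = s ∧
    cellA.fits s s e.2 cellA.n cellA.n = true := by
  decide +kernel

theorem fits_patternsCutCA : ∀ t < 5, ∃ e ∈ patternsCutCA, e.2.2.1 ∈ pairStates ∧
    cellC.fitsFirst e.1 e.2.1 (digit 10 cellC.br t / 3) cellC.n = true ∧
    cellA.fits e.1 e.2.2.1 e.2.2.2 (digit 10 cellA.zl t / 3) cellA.n = true := by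
  decide +kernel

theorem fits_patternsCutAA : ∀ t < 5, ∃ e ∈ patternsCutAA, e.1 ∈ skipStates ∧
    e.2.2.2.1 ∈ pairStates ∧
    cellA.fits e.1 e.2.1 e.2.2.1 (digit 10 cellA.br t / 3) cellA.n = true ∧
    cellA.fits e.2.1 e.2.2.2.1 e.2.2.2.2 (digit 10 cellA.zl t / 3) cellA.n = true := by
  decide +kernel

theorem fits_patternsPairP : ∀ s ∈ pairStates, ∃ e ∈ patternsPairP, e.1 = s ∧
    cellP.fits s noState e.2 cellP.n cellP.n = true := by
  decide +kernel

theorem fits_patternsP : ∀ e ∈ patternsP, e.2.1 ∈ skipStates ∧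
    cellP.fits e.2.1 noState e.2.2 (e.1 / 3) (cellP.code e.1 / 3) = true := by
  decide +kernel

theorem map_fst_patternsP : patternsP.map Prod.fst = cellP.edgeDarts := by
  decide +kernel

theorem fits_patternsCutAP : ∀ t < 5, ∃ e ∈ patternsCutAP, e.1 ∈ skipStates ∧
    cellA.fits e.1 e.2.1 e.2.2.1 (digit 10 cellA.br t / 3) cellA.n = true ∧
    cellP.fits e.2.1 noState e.2.2.2 (digit 10 cellP.zl t / 3) cellP.n = true := by
  decide +kernel

/-! ### Drawings of the three cells -/

theorem drawn_cellP : cellP.Drawn true false := by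
  constructor <;> decide +kernel

theorem drawn_cellA : cellA.Drawn true true := by
  constructor <;> decide +kernel

set_option maxHeartbeats 4000000 in
theorem drawn_cellC : cellC.Drawn false true := by
  constructor <;> decide +kernel

/-! ### Deletion of adjacent vertices in the family -/

/-- The cells of the members of the family: `cellC`, then `k` copies of `cellA`, then `cellP`. -/
def hypoCell (k j : ℕ) : Cell := if j = 0 then cellC else if j ≤ k then cellA else cellP

theorem hypoCell_zero (k : ℕ) : hypoCell k 0 = cellC := rfl

theorem hypoCell_of_le {k j : ℕ} (h0 : 0 < j) (hj : j ≤ k) : hypoCell k j = cellA := by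
  rw [hypoCell, if_neg h0.ne', if_pos hj]

theorem hypoCell_last (k : ℕ) : hypoCell k (k + 1) = cellP := by
  rw [hypoCell, if_neg (by omega), if_neg (by omega)]

theorem isCellChain_hypoCell {k : ℕ} : IsCellChain (hypoCell k) (k + 2) := by
  intro j hj
  rcases Nat.eq_zero_or_pos j with rfl | h0
  · rw [hypoCell_zero, decide_eq_true (by omega : 0 + 1 < k + 2)]
    exact valid_cellC
  · rw [decide_eq_true h0]
    rcases Nat.lt_or_ge k j with h1 | h1
    · obtain rfl : j = k + 1 := by omega
      rw [hypoCell_last, decide_eq_false (by omega)]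
      exact valid_cellP
    · rw [hypoCell_of_le h0 h1, decide_eq_true (by omega : j + 1 < k + 2)]
      exact valid_cellA

namespace Reach

variable {k : ℕ} {D : ℕ → ℕ → Prop}

/-- Before the deleted vertices, the state stays the same. -/
theorem skip : ∀ {j : ℕ}, j ≤ k → (∀ i ≤ j, ∀ v, ¬ D i v) → ∀ t ∈ skipStates,
    Reach (hypoCell k) D (j + 1) t
  | 0, _, hD, t, ht => by
    obtain ⟨e, _, _, he⟩ := fits_patternsSkipC t ht
    obtain ⟨h1, h2⟩ := Cell.of_fitsFirst he
    refine .first (p := e.2) h1 fun v hv => ?_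
    rw [h2 v hv, or_self, iff_false_right (hD 0 le_rfl v)]
    exact (show v < cellC.n from hv).ne
  | j + 1, hj, hD, t, ht => by
    obtain ⟨e, _, _, he⟩ := fits_patternsSkipA t ht
    obtain ⟨h1, h2⟩ := Cell.of_fits_none he
    rw [← hypoCell_of_le (Nat.succ_pos j) hj] at h1 h2
    refine .next (skip (by omega) (fun i hi => hD i (by omega)) t ht) h1 fun v hv => ?_
    rw [iff_false_right (hD _ le_rfl v)]
    exact h2 v hv

/-- Behind the deleted vertices, the state stays the same. -/
theorem pair : ∀ {i j : ℕ}, j + i = k + 1 → 0 < j → (∀ i ≥ j, ∀ v, ¬ D i v) → ∀ s ∈ pairStates,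
    Reach (hypoCell k) D j s → Reach (hypoCell k) D (k + 2) noState
  | 0, j, hj, h0, hD, s, hs, h => by
    obtain rfl : j = k + 1 := by omega
    obtain ⟨e, _, _, he⟩ := fits_patternsPairP s hs
    obtain ⟨h1, h2⟩ := Cell.of_fits_none he
    rw [← hypoCell_last k] at h1 h2
    refine .next h h1 fun v hv => ?_
    rw [iff_false_right (hD _ le_rfl v)]
    exact h2 v hv
  | i + 1, j, hj, h0, hD, s, hs, h => by
    obtain ⟨e, _, _, he⟩ := fits_patternsPairA s hs
    obtain ⟨h1, h2⟩ := Cell.of_fits_none he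
    rw [← hypoCell_of_le h0 (by omega : j ≤ k)] at h1 h2
    refine pair (by omega : (j + 1) + i = k + 1) (by omega) (fun i hi => hD i (by omega)) s hs
      (.next h h1 fun v hv => ?_)
    rw [iff_false_right (hD _ le_rfl v)]
    exact h2 v hv

/-- The deletion of the ends of an edge inside a cell. -/
theorem edge {j h : ℕ} (hj : j < k + 2) (h1 : h < (hypoCell k j).code h)
    (h2 : (hypoCell k j).code h < 3 * (hypoCell k j).n)
    (hD : ∀ i v, D i v ↔ i = j ∧ (v = h / 3 ∨ v = (hypoCell k j).code h / 3)) :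
    Reach (hypoCell k) D (k + 2) noState := by
  have hD' : ∀ i ≠ j, ∀ v, ¬ D i v := fun i hi v h => hi ((hD i v).1 h).1
  rcases Nat.eq_zero_or_pos j with rfl | h0
  · obtain ⟨⟨r, p⟩, hm⟩ := Cell.exists_mem_of_map_fst map_fst_patternsC h1 h2
    obtain ⟨hr, hf⟩ := fits_patternsC _ hm
    obtain ⟨k1, k2⟩ := Cell.of_fitsFirst hf
    refine pair (j := 1) (i := k) (by omega) Nat.one_pos (fun i hi => hD' i (by omega)) r hr
      (.first k1 fun v hv => ?_)
    rw [hD]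
    exact (k2 v hv).trans ⟨fun h => ⟨rfl, h⟩, fun h => h.2⟩
  · obtain ⟨j, rfl⟩ : ∃ i, j = i + 1 := ⟨j - 1, by omega⟩
    rcases Nat.lt_or_ge k (j + 1) with h3 | h3
    · obtain rfl : j = k := by omega
      rw [hypoCell_last] at h1 h2 hD
      obtain ⟨⟨l, p⟩, hm⟩ := Cell.exists_mem_of_map_fst map_fst_patternsP h1 h2
      obtain ⟨hl, hf⟩ := fits_patternsP _ hm
      obtain ⟨k1, k2⟩ := Cell.of_fits hf
      rw [← hypoCell_last] at k1
      refine .next (skip le_rfl (fun i hi => hD' i (by omega)) l hl) k1 fun v hv => ?_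
      rw [hypoCell_last] at hv
      rw [hD, k2 v hv]
      simp
    · have hA := hypoCell_of_le h0 h3
      rw [hA] at h1 h2 hD
      obtain ⟨⟨l, r, p⟩, hm⟩ := Cell.exists_mem_of_map_fst map_fst_patternsA h1 h2
      obtain ⟨hl, hr, hf⟩ := fits_patternsA _ hm
      obtain ⟨k1, k2⟩ := Cell.of_fits hf
      refine pair (j := j + 2) (i := k - (j + 1)) (by omega) (by omega)
        (fun i hi => hD' i (by omega)) r hr
        (.next (skip (by omega) (fun i hi => hD' i (by omega)) l hl) (p := p) (hA ▸ k1)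
          fun v hv => ?_)
      rw [hA] at hv
      rw [hD, k2 v hv]
      simp

/-- The deletion of the ends of an edge between two cells. -/
theorem cut (hk : 0 < k) {j t : ℕ} (hj : j < k + 1) (ht : t < 5)
    (hD : ∀ i v, D i v ↔ (i = j ∧ v = digit 10 (hypoCell k j).br t / 3) ∨
      (i = j + 1 ∧ v = digit 10 (hypoCell k (j + 1)).zl t / 3)) :
    Reach (hypoCell k) D (k + 2) noState := by
  have hD' : ∀ i, i ≠ j → i ≠ j + 1 → ∀ v, ¬ D i v := fun i hi hi' v h =>
    ((hD i v).1 h).elim (fun h => hi h.1) fun h => hi' h.1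
  have hl : ∀ v, D j v ↔ v = digit 10 (hypoCell k j).br t / 3 := fun v => by
    rw [hD]
    simp
  have hr : ∀ v, D (j + 1) v ↔ v = digit 10 (hypoCell k (j + 1)).zl t / 3 := fun v => by
    rw [hD]
    simp
  rcases Nat.eq_zero_or_pos j with rfl | h0
  · have hA := hypoCell_of_le (j := 0 + 1) Nat.one_pos hk
    obtain ⟨e, _, hs, f1, f2⟩ := fits_patternsCutCA t ht
    obtain ⟨k1, k2⟩ := Cell.of_fitsFirst f1
    obtain ⟨m1, m2⟩ := Cell.of_fits_one f2
    rw [← hA] at m1 m2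
    refine pair (j := 2) (i := k - 1) (by omega) (by omega)
      (fun i hi => hD' i (by omega) (by omega)) _ hs
      (.next (.first k1 fun v hv => ?_) m1 fun v hv => ?_)
    · rw [hl, k2 v hv, hypoCell_zero, or_iff_left]
      exact (show v < cellC.n from hv).ne
    · rw [hr, m2 v hv]
  · obtain ⟨j, rfl⟩ : ∃ i, j = i + 1 := ⟨j - 1, by omega⟩
    have hA := hypoCell_of_le h0 (by omega : j + 1 ≤ k)
    have hskip := skip (k := k) (D := D) (j := j) (by omega)
      (fun i hi => hD' i (by omega) (by omega))
    rcases Nat.lt_or_ge k (j + 2) with h3 | h3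
    · obtain rfl : k = j + 1 := by omega
      have hP := hypoCell_last (j + 1)
      obtain ⟨e, _, hs, f1, f2⟩ := fits_patternsCutAP t ht
      obtain ⟨k1, k2⟩ := Cell.of_fits_one f1
      obtain ⟨m1, m2⟩ := Cell.of_fits_one f2
      rw [← hA] at k1 k2
      rw [← hP] at m1 m2
      refine .next (.next (hskip _ hs) k1 fun v hv => ?_) m1 fun v hv => ?_
      · rw [hl, k2 v hv]
      · rw [hr, m2 v hv]
    · have hA' := hypoCell_of_le (j := j + 2) (by omega) h3
      obtain ⟨e, _, hs, hs', f1, f2⟩ := fits_patternsCutAA t ht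
      obtain ⟨k1, k2⟩ := Cell.of_fits_one f1
      obtain ⟨m1, m2⟩ := Cell.of_fits_one f2
      rw [← hA] at k1 k2
      rw [← hA'] at m1 m2
      refine pair (j := j + 3) (i := k - (j + 2)) (by omega) (by omega)
        (fun i hi => hD' i (by omega) (by omega)) _ hs'
        (.next (.next (hskip _ hs) k1 fun v hv => ?_) m1 fun v hv => ?_)
      · rw [hl, k2 v hv]
      · rw [hr, m2 v hv]

end Reach

theorem CellChain.eq_iff {c : ℕ → Cell} {m : ℕ} {u v : ChainV c m} :
    u = v ↔ (u.1 : ℕ) = v.1 ∧ (u.2 : ℕ) = v.2 := by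
  constructor
  · rintro rfl
    exact ⟨rfl, rfl⟩
  · obtain ⟨⟨i, _⟩, u⟩ := u
    obtain ⟨⟨j, _⟩, v⟩ := v
    rintro ⟨h1, h2⟩
    obtain rfl : i = j := h1
    obtain rfl : u = v := Fin.ext h2
    rfl

theorem br_hypoCell_lt {k j : ℕ} (hj : j < k + 1) (t : Fin 5) :
    digit 10 (hypoCell k j).br t < 3 * (hypoCell k j).n := by
  rcases Nat.eq_zero_or_pos j with rfl | h0
  · exact (by decide +kernel : ∀ t : Fin 5, digit 10 cellC.br t < 3 * cellC.n) t
  · rw [hypoCell_of_le h0 (by omega)]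
    exact (by decide +kernel : ∀ t : Fin 5, digit 10 cellA.br t < 3 * cellA.n) t

theorem zl_hypoCell_lt {k j : ℕ} (hj : j < k + 1) (t : Fin 5) :
    digit 10 (hypoCell k (j + 1)).zl t < 3 * (hypoCell k (j + 1)).n := by
  rcases Nat.lt_or_ge k (j + 1) with h | h
  · obtain rfl : j = k := by omega
    rw [hypoCell_last]
    exact (by decide +kernel : ∀ t : Fin 5, digit 10 cellP.zl t < 3 * cellP.n) t
  · rw [hypoCell_of_le (Nat.succ_pos j) h]
    exact (by decide +kernel : ∀ t : Fin 5, digit 10 cellA.zl t < 3 * cellA.n) t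

/-- The deletion of the ends of any edge leaves a pattern. -/
theorem Reach.of_adj {k : ℕ} (hk : 0 < k) (u : ChainV (hypoCell k) (k + 2)) (i : Fin 3)
    {D : ℕ → ℕ → Prop} (hD : ∀ j v, D j v ↔ (j = u.1 ∧ v = u.2) ∨
      (j = ((CellChain.opp (u, i)).1.1 : ℕ) ∧ v = (CellChain.opp (u, i)).1.2)) :
    Reach (hypoCell k) D (k + 2) noState := by
  have hc := isCellChain_hypoCell (k := k)
  obtain ⟨⟨j, hj⟩, v⟩ := u
  have hval : ∀ (c : Cell) (h : ℕ), h < 3 * c.n → (c.dartV h : ℕ) = h / 3 := fun c h hh =>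
    Nat.mod_eq_of_lt (by omega)
  rcases cases_loc hj hc v i with ⟨w, i', h1, h2, h3, -⟩ | ⟨t, hj', h1, h2, h3⟩ |
    ⟨j', t, rfl, h1, h2, h3⟩
  · rw [opp_inn hj h1] at hD
    have hw : (w : ℕ) ≠ v := fun h => h3 (Fin.ext h)
    have hcode : ∀ {v w : Fin (hypoCell k j).n} {i i' : Fin 3},
        (hypoCell k j).loc v i = .inn w i' → (hypoCell k j).code (3 * v + i) = 3 * w + i' := by
      intro v w i i' h
      obtain ⟨k1, rfl, rfl⟩ := Cell.code_of_inn h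
      rw [hval _ _ k1]
      exact (Nat.div_add_mod _ 3).symm
    have c1 := hcode h1
    have c2 := hcode h2
    have e1 : (3 * (v : ℕ) + i) / 3 = v := by omega
    have e2 : (3 * (w : ℕ) + i') / 3 = w := by omega
    rcases Nat.lt_or_ge (v : ℕ) w with hlt | hge
    · refine edge hj (h := 3 * v + i) (by omega) (by omega) fun a b => ?_
      rw [hD, c1, e1, e2]
      exact and_or_left.symm
    · refine edge hj (h := 3 * w + i') (by omega) (by omega) fun a b => ?_
      rw [hD, c2, e1, e2, or_comm]
      exact and_or_left.symm
  · rw [opp_right hj hj' h1] at hD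
    refine cut hk (j := j) (by omega) t.2 fun a b => ?_
    have e1 : (v : ℕ) = digit 10 (hypoCell k j).br t / 3 := by
      rw [← h2]
      exact hval _ _ (br_hypoCell_lt (by omega) t)
    have e2 : ((hypoCell k (j + 1)).lv t : ℕ) = digit 10 (hypoCell k (j + 1)).zl t / 3 :=
      hval _ _ (zl_hypoCell_lt (by omega) t)
    rw [hD, e1, e2]
  · rw [opp_left (by omega) hj h1] at hD
    refine cut hk (j := j') (by omega) t.2 fun a b => ?_
    have e1 : ((hypoCell k j').rv t : ℕ) = digit 10 (hypoCell k j').br t / 3 :=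
      hval _ _ (br_hypoCell_lt (by omega) t)
    have e2 : (v : ℕ) = digit 10 (hypoCell k (j' + 1)).zl t / 3 := by
      rw [← h2]
      exact hval _ _ (zl_hypoCell_lt (by omega) t)
    rw [hD, e1, e2, or_comm]

/-- The deletion of the ends of any edge leaves a hamiltonian graph. -/
theorem isK2Hamiltonian_hypoCell {k : ℕ} (hk : 0 < k) :
    (chainMap (isCellChain_hypoCell (k := k))).graph.IsK2Hamiltonian := by
  rintro u _ ⟨i, rfl⟩
  convert Reach.isHamiltonian isCellChain_hypoCell (Reach.of_adj hk u i fun _ _ => Iff.rfl)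
    {u, ((chainMap isCellChain_hypoCell).opp (u, i)).1}
    (fun v => ?_) ?_
  · rw [← CellChain.eq_iff, ← CellChain.eq_iff]
    rfl
  · rw [Set.nonempty_compl]
    intro h
    have h1 := Set.ncard_insert_le u {((chainMap isCellChain_hypoCell).opp (u, i)).1}
    rw [h, Set.ncard_singleton, Set.ncard_univ, Nat.card_eq_fintype_card, card_chainV,
      Fin.sum_univ_succ] at h1
    have h2 : (hypoCell k ((0 : Fin (k + 2)) : ℕ)).n = 213 := rfl
    omega

/-! ### The infinite family -/

theorem isDrawn_hypoCell {k : ℕ} : IsDrawn (hypoCell k) (k + 2) := by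
  intro j hj
  rcases Nat.eq_zero_or_pos j with rfl | h0
  · rw [hypoCell_zero, decide_eq_true (by omega : 0 + 1 < k + 2)]
    exact drawn_cellC
  · rw [decide_eq_true h0]
    rcases Nat.lt_or_ge k j with h1 | h1
    · obtain rfl : j = k + 1 := by omega
      rw [hypoCell_last, decide_eq_false (by omega)]
      exact drawn_cellP
    · rw [hypoCell_of_le h0 h1, decide_eq_true (by omega : j + 1 < k + 2)]
      exact drawn_cellA

theorem sum_hypoCell (f : Cell → ℕ) (k : ℕ) :
    ∑ j : Fin (k + 2), f (hypoCell k j) = f cellC + f cellP + k * f cellA := by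
  have h : ∑ j ∈ Finset.range k, f (hypoCell k (j + 1)) = k * f cellA := by
    rw [Finset.sum_congr rfl fun j hj => by
      rw [hypoCell_of_le (Nat.succ_pos j) (Finset.mem_range.1 hj)], Finset.sum_const,
      Finset.card_range, smul_eq_mul]
  rw [Fin.sum_univ_eq_sum_range (fun j => f (hypoCell k j)), Finset.sum_range_succ,
    Finset.sum_range_succ', h, hypoCell_last, hypoCell_zero]
  omega

theorem card_hypoCell (k : ℕ) :
    Fintype.card (ChainV (hypoCell k) (k + 2)) = 218 + 66 * k := by
  rw [card_chainV, sum_hypoCell Cell.n, show cellC.n = 213 from rfl, show cellA.n = 66 from rfl,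
    show cellP.n = 5 from rfl]
  omega

/-- The set `Z` of the obstruction is in the core, so that the rest of the chain matters only
through the lengths of its faces. -/
theorem not_isHamiltonian_hypoCell {k : ℕ} :
    ¬ (chainMap (isCellChain_hypoCell (k := k))).graph.IsHamiltonian := by
  have hc := isCellChain_hypoCell (k := k)
  have ho := isObstruction hc (Nat.succ_pos (k + 1)) (z := 131) obstructs_cellC ?_ ?_ ?_
  · refine ho.not_isHamiltonian (face_opp hc) (face_surjective hc) ?_
    rw [card_hypoCell, card_chainF, sum_hypoCell Cell.nf, show cellC.nf = 105 from rfl,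
      show cellA.nf = 33 from rfl, show cellP.nf = 6 from rfl]
    omega
  · intro j h0 hj
    rcases Nat.lt_or_ge k j with h1 | h1
    · obtain rfl : j = k + 1 := by omega
      rw [hypoCell_last]
      exact corners_cellP
    · rw [hypoCell_of_le h0 h1]
      exact corners_cellA.1
  · intro j hj
    rcases Nat.eq_zero_or_pos j with rfl | h0
    · exact corners_cellC
    · rw [hypoCell_of_le h0 (by omega)]
      exact corners_cellA.2
  · rw [card_hypoCell]
    omega

namespace SimpleGraph

variable {V W : Type*} [Fintype V] [Fintype W] {G : SimpleGraph V} {H : SimpleGraph W}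

theorem Iso.isCubic (e : G ≃g H) (h : G.IsCubic) : H.IsCubic := by
  classical
  intro w
  rw [← h (e.symm w), ← card_neighborSet_eq_degree, ← card_neighborSet_eq_degree]
  exact Fintype.card_congr (e.symm.mapNeighborSet w)

theorem Iso.isPlanar {V W : Type*} {G : SimpleGraph V} {H : SimpleGraph W} (e : G ≃g H)
    (h : G.IsPlanar) : H.IsPlanar := by
  obtain ⟨D⟩ := h
  have hmem : ∀ f ∈ H.edgeSet, f.map e.symm ∈ G.edgeSet := by
    intro f
    induction f with
    | h u v => exact fun h => e.symm.map_rel_iff.2 h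
  refine ⟨⟨D.point ∘ e.symm, fun f => D.arc (f.map e.symm),
    D.point_injective.comp e.symm.injective, fun u v huv => ?_, fun f hf w hw => ?_,
    fun f hf g hg hne => ?_⟩⟩
  · exact D.isPlaneArc _ _ (e.symm.map_rel_iff.2 huv)
  · obtain ⟨w', h1, h2⟩ := Sym2.mem_map.1 (D.mem_of_point_mem_arc _ (hmem f hf) _ hw)
    rwa [← e.symm.injective h2]
  · rw [Set.range_comp, e.symm.surjective.range_eq, Set.image_univ]
    exact D.arc_inter_arc _ (hmem f hf) _ (hmem g hg)
      fun h => hne (Sym2.map.injective e.symm.injective h)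

theorem Iso.isHamiltonian [DecidableEq V] [DecidableEq W] (e : G ≃g H) (h : G.IsHamiltonian) :
    H.IsHamiltonian := by
  intro hne
  obtain ⟨a, p, hp⟩ := h (by rwa [Fintype.card_congr e.toEquiv])
  exact ⟨_, p.map e.toHom, hp.map e.bijective⟩

theorem Iso.isK2Hypohamiltonian (e : G ≃g H) (h : G.IsK2Hypohamiltonian) :
    H.IsK2Hypohamiltonian := by
  classical
  refine ⟨fun u v huv => ?_, fun hH => h.2 (by convert e.symm.isHamiltonian hH)⟩
  have h1 := h.1 _ _ (e.symm.map_rel_iff.2 huv)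
  let f : G.induce ({e.symm u, e.symm v}ᶜ : Set V) ≃g H.induce ({u, v}ᶜ : Set W) :=
    { toEquiv := e.toEquiv.subtypeEquiv fun x => by
        simp only [Set.mem_compl_iff, Set.mem_insert_iff, Set.mem_singleton_iff]
        rw [← e.symm_apply_apply x, e.symm.injective.eq_iff, e.symm.injective.eq_iff]
        simp
      map_rel_iff' := e.map_rel_iff }
  convert f.isHamiltonian (by convert h1)

end SimpleGraph

/-- There are infinitely many (pairwise non-isomorphic) finite cubic planar `K₂`-hypohamiltonian
graphs. -/
theorem mainTheorem12 :
    ∃ (n : ℕ → ℕ) (G : ∀ i : ℕ, SimpleGraph (Fin (n i))),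
      (∀ i j : ℕ, i ≠ j → IsEmpty (G i ≃g G j)) ∧
      ∀ i : ℕ, (G i).IsCubic ∧ (G i).IsPlanar ∧ (G i).IsK2Hypohamiltonian := by
  let M := fun i => chainMap (isCellChain_hypoCell (k := i + 1))
  refine ⟨fun i => 218 + 66 * (i + 1), fun i => (M i).graph.overFin (card_hypoCell (i + 1)),
    fun i j hij => ⟨fun e => ?_⟩, fun i => ?_⟩
  · have := Fintype.card_congr e.toEquiv
    simp only [Fintype.card_fin] at this
    omega
  · have e := (M i).graph.overFinIso (card_hypoCell (i + 1))
    exact ⟨e.isCubic (M i).isCubic, e.isPlanar (isPlanar _ isDrawn_hypoCell),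
      e.isK2Hypohamiltonian ⟨isK2Hamiltonian_hypoCell (Nat.succ_pos i),
        fun h => not_isHamiltonian_hypoCell (by convert h)⟩⟩
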